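/- **Virtual double categories.** A virtual double category $\mathcal D$ consists of a category of objects and (vertical) arrows; for any two objects a collection of proarrows $J : X ⇸ Y$; 2-cells $\alpha : J_1,\dots,J_k \Rightarrow K$ with vertical boundary $f : X_0\to Y_0$, $g : X_k \to Y_1$, for each list of composable proarrows $J_i : X_{i-1} ⇸ X_i$ ($k\ge 0$) and each $K : Y_0 ⇸ Y_1$; identity 2-cells $\mathrm{id}_J : J\Rightarrow J$; and multi-composites $\beta(\alpha_1,\dots,\alpha_\ell)$ that are associative and unital. A 2-cell $J_1,\dots,J_k\Rightarrow J$ with identity vertical boundary exhibits $J$ as the *composite* of $J_1,\dots,J_k$ if every 2-cell $\Gamma_1,J_1,\dots,J_k,\Gamma_2\Rightarrow K$ factors uniquely through it; a *unit* $U_X$ is a composite of the empty list at $X$. A 2-cell $L \Rightarrow K$ with vertical boundary $f,g$ is *cartesian*, and $L=K(f,g)$ is the *restriction* of $K$, if every 2-cell $\Gamma\Rightarrow K$ with vertical boundary $f\circ h,\ g\circ k$ factors uniquely through it as a 2-cell $\Gamma\Rightarrow L$ with boundary $h,k$. A *virtual equipment* is a virtual double category in which all units and all restrictions exist. The companion and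 the conjoint of $f: A\to B$ are $U_B(f,1) : A ⇸ B$ and $U_B(1,f): B ⇸ A$. A *functor* of virtual double categories maps objects, arrows, proarrows and 2-cells compatibly with boundaries and preserves identities and composites of arrows, identity 2-cells and multi-composites of 2-cells. **Enriched categories.** Let $\mathcal E$ be a virtual double category. An $\mathcal E$-enriched category $C$ has a class of objects $a$, each with an extent $C(a)\in\mathcal E$, proarrows $C(a,b): C(a)⇸ C(b)$, and 2-cells $()\Rightarrow C(a,a)$ and $C(a,b),C(b,d)\Rightarrow C(a,d)$ with identity vertical boundary, subject to the identity and associativity laws. A functor $F: C\to D$ assigns to $a$ an object $Fa$ of $D$ and an arrow $F_a : C(a)\to D(Fa)$, and to $a,b$ a 2-cell $C(a,b)\Rightarrow D(Fa,Fb)$ with vertical boundary $F_a,F_b$, compatibly with identities and composition. A profunctor $J : C⇸ D$ consists of proarrows $J(a,d): C(a)⇸ D(d)$ and actions $C(a,a'),J(a',d)\Rightarrow J(a,d)$ and $J(a,d),D(d,d')\Rightarrow J(a,d')$ that are unital, associative, and commute with each other. A morphism $J_1,\dots,J_k\Rightarrow K$ along functors $F,G$ is a family of 2-cells $J_1(c_0,c_1),\dots,J_k(c_{k-1},c_k)\Rightarrow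 K(Fc_0,Gc_k)$ with vertical boundary $F_{c_0}, G_{c_k}$ that equalizes the two actions of every intermediate category $C_i$ and commutes with the actions of $C_0$ and $C_k$ via $F$ and $G$ (for $k=0$: the two 2-cells $C_0(c,c')\Rightarrow K(Fc,Gc')$ that it induces agree). **Statement.** Let $\mathcal E$ be a virtual equipment, with chosen units $U_Y$ and restrictions. 1. With componentwise identities and multi-composites, $\mathcal E$-enriched categories, functors, profunctors and morphisms of profunctors form a virtual double category $\mathrm{VCat}(\mathcal E)$, and it is a virtual equipment. Its restrictions are componentwise: for a profunctor $K$ and functors $F,G$, the proarrows $K(Fa,Gd)(F_a,G_d)$, with the induced actions, form a profunctor, and their cartesian 2-cells in $\mathcal E$ form a cartesian morphism from it to $K$. 2. The following data are well defined and constitute a functor of virtual double categories $|\cdot| : \mathcal E\to\mathrm{VCat}(\mathcal E)$. - For an object $Y$, the enriched category $|Y|$ has as objects the arrows $x : B\to Y$ of $\mathcal E$, with extent $B$, and as hom from $x$ to $y$ the proarrow $U_Y(x,y)$, which is the composite of the companion of $x$ and the conjoint of $y$ (via the canonical 2-cell); identities and composition are induced by those of $U_Y$. - For an arrow $f : Y\to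 Z$, the functor $|f|$ sends $x$ to $f\circ x$, with identity arrows between extents; its action $U_Y(x,y)\Rightarrow U_Z(fx,fy)$ is induced by the canonical 2-cell $U_Y\Rightarrow U_Z$ along $f$. - For a proarrow $J: Y⇸ Z$, the profunctor $|J|$ has components $J(x,y)$, and $J(x,y)$ is the composite of the companion of $x$, $J$, and the conjoint of $y$ (via the canonical 2-cell); the actions are induced by $U_Y,J\Rightarrow J$ and $J,U_Z\Rightarrow J$. - For a 2-cell $\alpha : J_1,\dots,J_k\Rightarrow K$ with vertical boundary $f,g$, the component of $|\alpha|$ at $x_0,\dots,x_k$ is the unique 2-cell $J_1(x_0,x_1),\dots,J_k(x_{k-1},x_k)\Rightarrow K(f x_0, g x_k)$ with identity vertical boundary whose composite with the cartesian 2-cell of $K(fx_0,gx_k)$ is the composite of $\alpha$ with the cartesian 2-cells of the $J_i(x_{i-1},x_i)$. -/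

import Mathlib

universe u v p c w

namespace VirtualEquipments

/-! ## Virtual double categories -/

/-- Composable lists of proarrows `A ⇸ ⋯ ⇸ B` (possibly empty, when `A = B`). -/
inductive ProPath {Obj : Type u} (Pro : Obj → Obj → Type p) : Obj → Obj → Type (max u p)
  | nil (A : Obj) : ProPath Pro A A
  | cons {A B C : Obj} (J : Pro A B) (Γ : ProPath Pro B C) : ProPath Pro A C

namespace ProPath

variable {Obj : Type u} {Pro : Obj → Obj → Type p}

/-- The list consisting of one proarrow. -/
def single {A B : Obj} (J : Pro A B) : ProPath Pro A B := cons J (nil B)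

/-- Concatenation of lists of proarrows. -/
def append : ∀ {A B C : Obj}, ProPath Pro A B → ProPath Pro B C → ProPath Pro A C
  | _, _, _, nil _, Δ => Δ
  | _, _, _, cons J Γ, Δ => cons J (append Γ Δ)

theorem append_nil : ∀ {A B : Obj} (Γ : ProPath Pro A B), Γ.append (nil B) = Γ
  | _, _, nil _ => rfl
  | _, _, cons J Γ => congrArg (cons J) (append_nil Γ)

theorem append_assoc : ∀ {A B C D : Obj} (Γ : ProPath Pro A B) (Δ : ProPath Pro B C)
    (Θ : ProPath Pro C D), (Γ.append Δ).append Θ = Γ.append (Δ.append Θ)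
  | _, _, _, _, nil _, _, _ => rfl
  | _, _, _, _, cons J Γ, Δ, Θ => congrArg (cons J) (append_assoc Γ Δ Θ)

/-- Apply maps of objects and of proarrows to a list of proarrows. -/
def map {Obj' : Type*} {Pro' : Obj' → Obj' → Type*} (o : Obj → Obj')
    (m : ∀ {A B : Obj}, Pro A B → Pro' (o A) (o B)) :
    ∀ {A B : Obj}, ProPath Pro A B → ProPath Pro' (o A) (o B)
  | _, _, nil A => nil (o A)
  | _, _, cons J Γ => cons (m J) (map o m Γ)

theorem map_append {Obj' : Type*} {Pro' : Obj' → Obj' → Type*} (o : Obj → Obj')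
    (m : ∀ {A B : Obj}, Pro A B → Pro' (o A) (o B)) :
    ∀ {A B C : Obj} (Γ : ProPath Pro A B) (Δ : ProPath Pro B C),
      (Γ.append Δ).map o m = (Γ.map o m).append (Δ.map o m)
  | _, _, _, nil _, _ => rfl
  | _, _, _, cons J Γ, Δ => congrArg (cons (m J)) (map_append o m Γ Δ)

end ProPath

/-- The underlying collections of a virtual double category: objects, (vertical) arrows,
proarrows, and 2-cells. A 2-cell `Cell f g Γ K` has vertical domain `f`, vertical codomain `g`,
the list `Γ` as its horizontal domain, and `K` as its horizontal codomain. -/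
structure VDCSig where
  Obj : Type u
  Hom : Obj → Obj → Type v
  Pro : Obj → Obj → Type p
  Cell : ∀ {A B A' B' : Obj}, Hom A A' → Hom B B' → ProPath Pro A B → Pro A' B' → Type c

namespace VDCSig

variable (S : VDCSig.{u, v, p, c})

/-- Composable lists of proarrows. -/
abbrev Path (A B : S.Obj) := ProPath S.Pro A B

variable {S}

/-- Transport of a 2-cell along equalities of its vertical boundary. -/
def reframe {A B A' B' : S.Obj} {f f' : S.Hom A A'} {g g' : S.Hom B B'} {Γ : S.Path A B}
    {K : S.Pro A' B'} (hf : f = f') (hg : g = g') (α : S.Cell f g Γ K) : S.Cell f' g' Γ K :=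
  cast (by rw [hf, hg]) α

variable (S) in
/-- A row of 2-cells, side by side, with matching vertical boundaries. `Row f g Γ Δ` has leftmost
boundary `f`, rightmost boundary `g`; `Γ` is the concatenation of the horizontal domains, and `Δ`
is the list of horizontal codomains. The empty row consists of a single arrow. -/
inductive Row : ∀ {A B A' B' : S.Obj}, S.Hom A A' → S.Hom B B' → S.Path A B → S.Path A' B' →
    Type (max u v p c)
  | nil {A A' : S.Obj} (f : S.Hom A A') : Row f f (ProPath.nil A) (ProPath.nil A')
  | cons {A B C A' B' C' : S.Obj} {f : S.Hom A A'} {g : S.Hom B B'} {h : S.Hom C C'}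
      {Γ : S.Path A B} {Γ' : S.Path B C} {Θ : S.Path A C} {K : S.Pro A' B'} {Δ : S.Path B' C'}
      (α : S.Cell f g Γ K) (R : Row g h Γ' Δ) (e : Γ.append Γ' = Θ) :
      Row f h Θ (ProPath.cons K Δ)

namespace Row

/-- The row consisting of one 2-cell. -/
def single {A B A' B' : S.Obj} {f : S.Hom A A'} {g : S.Hom B B'} {Γ : S.Path A B}
    {K : S.Pro A' B'} (α : S.Cell f g Γ K) : S.Row f g Γ (ProPath.single K) :=
  cons α (nil g) Γ.append_nil

/-- Concatenation of rows. -/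
def append : ∀ {A B C A' B' C' : S.Obj} {f : S.Hom A A'} {g : S.Hom B B'} {h : S.Hom C C'}
    {Γ : S.Path A B} {Γ' : S.Path B C} {Θ : S.Path A C} {Δ : S.Path A' B'} {Δ' : S.Path B' C'},
    S.Row f g Γ Δ → S.Row g h Γ' Δ' → Γ.append Γ' = Θ → S.Row f h Θ (Δ.append Δ')
  | _, _, _, _, _, _, _, _, _, _, _, _, _, _, nil _, R, rfl => R
  | _, _, _, _, _, _, _, _, _, _, _, _, _, _, cons α Q rfl, R, e =>
      cons α (append Q R rfl) ((ProPath.append_assoc _ _ _).symm.trans e)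

end Row

variable (S) in
/-- A row of pairs, each consisting of a row of 2-cells and a 2-cell below it. `Γ`, `Δ` and `Θ`
are the top, middle and bottom lists of proarrows. -/
inductive Tower : ∀ {A B A' B' A'' B'' : S.Obj}, S.Hom A A' → S.Hom A' A'' → S.Hom B B' →
    S.Hom B' B'' → S.Path A B → S.Path A' B' → S.Path A'' B'' → Type (max u v p c)
  | nil {A A' A'' : S.Obj} (f : S.Hom A A') (f' : S.Hom A' A'') :
      Tower f f' f f' (ProPath.nil A) (ProPath.nil A') (ProPath.nil A'')
  | cons {A B C A' B' C' A'' B'' C'' : S.Obj} {f : S.Hom A A'} {f' : S.Hom A' A''}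
      {g : S.Hom B B'} {g' : S.Hom B' B''} {h : S.Hom C C'} {h' : S.Hom C' C''}
      {Γ : S.Path A B} {Γ' : S.Path B C} {ΓΓ' : S.Path A C}
      {Δ : S.Path A' B'} {Δ' : S.Path B' C'} {ΔΔ' : S.Path A' C'}
      {K : S.Pro A'' B''} {Θ : S.Path B'' C''}
      (R : S.Row f g Γ Δ) (α : S.Cell f' g' Δ K) (T : Tower g g' h h' Γ' Δ' Θ)
      (e : Γ.append Γ' = ΓΓ') (e' : Δ.append Δ' = ΔΔ') :
      Tower f f' h h' ΓΓ' ΔΔ' (ProPath.cons K Θ)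

namespace Tower

/-- All upper 2-cells of a tower, as one row. -/
def top : ∀ {A B A' B' A'' B'' : S.Obj} {f : S.Hom A A'} {f' : S.Hom A' A''} {g : S.Hom B B'}
    {g' : S.Hom B' B''} {Γ : S.Path A B} {Δ : S.Path A' B'} {Θ : S.Path A'' B''},
    S.Tower f f' g g' Γ Δ Θ → S.Row f g Γ Δ
  | _, _, _, _, _, _, _, _, _, _, _, _, _, nil f _ => Row.nil f
  | _, _, _, _, _, _, _, _, _, _, _, _, _, cons R _ T e rfl => R.append T.top e

/-- The lower 2-cells of a tower. -/
def bot : ∀ {A B A' B' A'' B'' : S.Obj} {f : S.Hom A A'} {f' : S.Hom A' A''} {g : S.Hom B B'}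
    {g' : S.Hom B' B''} {Γ : S.Path A B} {Δ : S.Path A' B'} {Θ : S.Path A'' B''},
    S.Tower f f' g g' Γ Δ Θ → S.Row f' g' Δ Θ
  | _, _, _, _, _, _, _, _, _, _, _, _, _, nil _ f' => Row.nil f'
  | _, _, _, _, _, _, _, _, _, _, _, _, _, cons _ α T _ e' => Row.cons α T.bot e'

end Tower

end VDCSig

/-- The data of a virtual double category: identities and composites of arrows, identity 2-cells
and multi-composites `β(α₁, …, αₙ)` of 2-cells. -/
structure VDCData extends VDCSig.{u, v, p, c} where
  one : ∀ A : Obj, Hom A A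
  vcomp : ∀ {A B C : Obj}, Hom A B → Hom B C → Hom A C
  idCell : ∀ {A B : Obj} (J : Pro A B), Cell (one A) (one B) (ProPath.single J) J
  comp : ∀ {A B A' B' A'' B'' : Obj} {f : Hom A A'} {g : Hom B B'} {Γ : ProPath Pro A B}
    {Δ : ProPath Pro A' B'} {f' : Hom A' A''} {g' : Hom B' B''} {K : Pro A'' B''},
    toVDCSig.Row f g Γ Δ → Cell f' g' Δ K → Cell (vcomp f f') (vcomp g g') Γ K

namespace VDCData

variable (D : VDCData.{u, v, p, c})

/-- The row of identity 2-cells on a list of proarrows. -/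
def idRow : ∀ {A B : D.Obj} (Γ : D.Path A B), D.Row (D.one A) (D.one B) Γ Γ
  | _, _, ProPath.nil A => VDCSig.Row.nil (D.one A)
  | _, _, ProPath.cons J Γ => VDCSig.Row.cons (D.idCell J) (idRow Γ) rfl

variable {D}

/-- Multi-composition, with the composite vertical boundaries written as given arrows. -/
def compTo {A B A' B' A'' B'' : D.Obj} {f : D.Hom A A'} {g : D.Hom B B'} {Γ : D.Path A B}
    {Δ : D.Path A' B'} {f' : D.Hom A' A''} {g' : D.Hom B' B''} {K : D.Pro A'' B''}
    {f'' : D.Hom A A''} {g'' : D.Hom B B''} (R : D.Row f g Γ Δ) (β : D.Cell f' g' Δ K)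
    (hf : D.vcomp f f' = f'') (hg : D.vcomp g g' = g'') : D.Cell f'' g'' Γ K :=
  VDCSig.reframe hf hg (D.comp R β)

/-- Composing each column of a tower: the row of the cells `αᵢ(γᵢ₁, …, γᵢₖ)`. -/
def towerComp : ∀ {A B A' B' A'' B'' : D.Obj} {f : D.Hom A A'} {f' : D.Hom A' A''}
    {g : D.Hom B B'} {g' : D.Hom B' B''} {Γ : D.Path A B} {Δ : D.Path A' B'}
    {Θ : D.Path A'' B''}, D.Tower f f' g g' Γ Δ Θ → D.Row (D.vcomp f f') (D.vcomp g g') Γ Θ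
  | _, _, _, _, _, _, _, _, _, _, _, _, _, VDCSig.Tower.nil f f' =>
      VDCSig.Row.nil (D.vcomp f f')
  | _, _, _, _, _, _, _, _, _, _, _, _, _, VDCSig.Tower.cons R α T e _ =>
      VDCSig.Row.cons (D.comp R α) (towerComp T) e

variable (D)

/-- The axioms of a virtual double category. -/
structure IsLawful : Prop where
  one_vcomp : ∀ {A B : D.Obj} (f : D.Hom A B), D.vcomp (D.one A) f = f
  vcomp_one : ∀ {A B : D.Obj} (f : D.Hom A B), D.vcomp f (D.one B) = f
  vcomp_assoc : ∀ {A B C E : D.Obj} (f : D.Hom A B) (g : D.Hom B C) (h : D.Hom C E),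
    D.vcomp (D.vcomp f g) h = D.vcomp f (D.vcomp g h)
  /-- `β(id, …, id) = β` -/
  idRow_comp : ∀ {A B A' B' : D.Obj} {f : D.Hom A A'} {g : D.Hom B B'} {Γ : D.Path A B}
    {K : D.Pro A' B'} (β : D.Cell f g Γ K),
    compTo (D.idRow Γ) β (one_vcomp f) (one_vcomp g) = β
  /-- `id(α) = α` -/
  comp_idCell : ∀ {A B A' B' : D.Obj} {f : D.Hom A A'} {g : D.Hom B B'} {Γ : D.Path A B}
    {K : D.Pro A' B'} (α : D.Cell f g Γ K),
    compTo (VDCSig.Row.single α) (D.idCell K) (vcomp_one f) (vcomp_one g) = α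
  /-- `β(α₁(γ₁₁, …), …, αₖ(γₖ₁, …)) = β(α₁, …, αₖ)(γ₁₁, …)` -/
  comp_assoc : ∀ {A B A' B' A'' B'' A₃ B₃ : D.Obj} {f : D.Hom A A'} {f' : D.Hom A' A''}
    {g : D.Hom B B'} {g' : D.Hom B' B''} {Γ : D.Path A B} {Δ : D.Path A' B'}
    {Θ : D.Path A'' B''} {f'' : D.Hom A'' A₃} {g'' : D.Hom B'' B₃} {K : D.Pro A₃ B₃}
    (T : D.Tower f f' g g' Γ Δ Θ) (β : D.Cell f'' g'' Θ K),
    compTo (towerComp T) β (vcomp_assoc f f' f'') (vcomp_assoc g g' g'') =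
      D.comp T.top (D.comp T.bot β)

end VDCData

/-- A virtual double category. -/
structure VDC extends VDCData.{u, v, p, c} where
  lawful : toVDCData.IsLawful

namespace VDC

variable (E : VDC.{u, v, p, c})

/-- The category of objects and vertical arrows. -/
instance vertical : CategoryTheory.Category E.Obj where
  Hom := E.Hom
  id := E.one
  comp := E.vcomp
  id_comp := E.lawful.one_vcomp
  comp_id := E.lawful.vcomp_one
  assoc := E.lawful.vcomp_assoc

variable {E}

theorem one_one (A : E.Obj) : E.vcomp (E.one A) (E.one A) = E.one A :=
  E.lawful.one_vcomp (E.one A)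

theorem vcomp_one_eq {A B : E.Obj} (f : E.Hom A B) :
    E.vcomp f (E.one B) = E.vcomp (E.one A) f :=
  (E.lawful.vcomp_one f).trans (E.lawful.one_vcomp f).symm

/-- A 2-cell `w : Γ ⇒ J` with identity vertical boundary exhibits `J` as the composite of the list
`Γ` if every 2-cell out of `Γ₁, Γ, Γ₂` factors uniquely through it. -/
def IsComposite {A B : E.Obj} {Γ : E.Path A B} {J : E.Pro A B}
    (w : E.Cell (E.one A) (E.one B) Γ J) : Prop :=
  ∀ {Z W Y Y' : E.Obj} (Γ₁ : E.Path Z A) (Γ₂ : E.Path B W) {f : E.Hom Z Y} {g : E.Hom W Y'}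
    {K : E.Pro Y Y'} (φ : E.Cell f g (Γ₁.append (Γ.append Γ₂)) K),
    ∃! ψ : E.Cell f g (Γ₁.append (ProPath.cons J Γ₂)) K,
      VDCData.compTo ((E.idRow Γ₁).append (VDCSig.Row.cons w (E.idRow Γ₂) rfl) rfl) ψ
        (E.lawful.one_vcomp f) (E.lawful.one_vcomp g) = φ

/-- Cartesian 2-cells; such a cell exhibits `L` as the restriction of `K` along `f` and `g`. -/
def IsCartesian {A B A' B' : E.Obj} {f : E.Hom A A'} {g : E.Hom B B'} {L : E.Pro A B}
    {K : E.Pro A' B'} (κ : E.Cell f g (ProPath.single L) K) : Prop :=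
  ∀ {Z W : E.Obj} {Γ : E.Path Z W} {h : E.Hom Z A} {k : E.Hom W B}
    (φ : E.Cell (E.vcomp h f) (E.vcomp k g) Γ K),
    ∃! ψ : E.Cell h k Γ L, E.comp (VDCSig.Row.single ψ) κ = φ

variable (E)

/-- A virtual equipment is a virtual double category with all units (composites of empty lists)
and all restrictions. -/
structure IsVirtualEquipment : Prop where
  exists_unit : ∀ A : E.Obj, ∃ (U : E.Pro A A)
    (η : E.Cell (E.one A) (E.one A) (ProPath.nil A) U), IsComposite η
  exists_restr : ∀ {A B A' B' : E.Obj} (f : E.Hom A A') (g : E.Hom B B') (K : E.Pro A' B'),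
    ∃ (L : E.Pro A B) (κ : E.Cell f g (ProPath.single L) K), IsCartesian κ

/-- A choice of units and of restrictions `K(f, g)`, with their universal 2-cells. -/
structure EquipmentData where
  unit : ∀ A : E.Obj, E.Pro A A
  unitCell : ∀ A : E.Obj, E.Cell (E.one A) (E.one A) (ProPath.nil A) (unit A)
  isUnit : ∀ A : E.Obj, IsComposite (unitCell A)
  restr : ∀ {A B A' B' : E.Obj}, E.Hom A A' → E.Hom B B' → E.Pro A' B' → E.Pro A B
  restrCell : ∀ {A B A' B' : E.Obj} (f : E.Hom A A') (g : E.Hom B B') (K : E.Pro A' B'),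
    E.Cell f g (ProPath.single (restr f g K)) K
  isCartesian : ∀ {A B A' B' : E.Obj} (f : E.Hom A A') (g : E.Hom B B') (K : E.Pro A' B'),
    IsCartesian (restrCell f g K)

/-- Virtual equipments are exactly the virtual double categories for which units and restrictions
can be chosen. -/
theorem isVirtualEquipment_iff : E.IsVirtualEquipment ↔ Nonempty E.EquipmentData := by
  constructor
  · intro h
    exact ⟨{
      unit := fun A => (h.exists_unit A).choose
      unitCell := fun A => (h.exists_unit A).choose_spec.choose
      isUnit := fun A => (h.exists_unit A).choose_spec.choose_spec
      restr := fun f g K => (h.exists_restr f g K).choose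
      restrCell := fun f g K => (h.exists_restr f g K).choose_spec.choose
      isCartesian := fun f g K => (h.exists_restr f g K).choose_spec.choose_spec }⟩
  · rintro ⟨S⟩
    exact ⟨fun A => ⟨S.unit A, S.unitCell A, S.isUnit A⟩,
      fun f g K => ⟨S.restr f g K, S.restrCell f g K, S.isCartesian f g K⟩⟩

end VDC

/-! ## Functors of virtual double categories -/

/-- The data of a functor between virtual double categories. -/
structure VDCMap (S : VDCSig.{u, v, p, c}) (T : VDCSig) where
  obj : S.Obj → T.Obj
  hom : ∀ {A B : S.Obj}, S.Hom A B → T.Hom (obj A) (obj B)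
  pro : ∀ {A B : S.Obj}, S.Pro A B → T.Pro (obj A) (obj B)
  cell : ∀ {A B A' B' : S.Obj} {f : S.Hom A A'} {g : S.Hom B B'} {Γ : S.Path A B}
    {K : S.Pro A' B'}, S.Cell f g Γ K → T.Cell (hom f) (hom g) (Γ.map obj pro) (pro K)

namespace VDCMap

/-- The image of a row of 2-cells. -/
def row {S : VDCSig.{u, v, p, c}} {T : VDCSig} (Φ : VDCMap S T) :
    ∀ {A B A' B' : S.Obj} {f : S.Hom A A'} {g : S.Hom B B'} {Γ : S.Path A B} {Δ : S.Path A' B'},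
    S.Row f g Γ Δ → T.Row (Φ.hom f) (Φ.hom g) (Γ.map Φ.obj Φ.pro) (Δ.map Φ.obj Φ.pro)
  | _, _, _, _, _, _, _, _, VDCSig.Row.nil f => VDCSig.Row.nil (Φ.hom f)
  | _, _, _, _, _, _, _, _, VDCSig.Row.cons (Γ := Γ) (Γ' := Γ') α R e =>
      VDCSig.Row.cons (Φ.cell α) (row Φ R)
        ((ProPath.map_append Φ.obj Φ.pro Γ Γ').symm.trans
          (congrArg (fun Θ => ProPath.map Φ.obj Φ.pro Θ) e))

/-- Functoriality: arrows form a functor, and identity 2-cells and multi-composites of 2-cells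
are preserved. -/
structure IsFunctor {D : VDC.{u, v, p, c}} {D' : VDC} (Φ : VDCMap D.toVDCSig D'.toVDCSig) :
    Prop where
  map_one : ∀ A : D.Obj, Φ.hom (D.one A) = D'.one (Φ.obj A)
  map_vcomp : ∀ {A B C : D.Obj} (f : D.Hom A B) (g : D.Hom B C),
    Φ.hom (D.vcomp f g) = D'.vcomp (Φ.hom f) (Φ.hom g)
  map_idCell : ∀ {A B : D.Obj} (J : D.Pro A B),
    VDCSig.reframe (map_one A) (map_one B) (Φ.cell (D.idCell J)) = D'.idCell (Φ.pro J)
  map_comp : ∀ {A B A' B' A'' B'' : D.Obj} {f : D.Hom A A'} {g : D.Hom B B'} {Γ : D.Path A B}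
    {Δ : D.Path A' B'} {f' : D.Hom A' A''} {g' : D.Hom B' B''} {K : D.Pro A'' B''}
    (R : D.Row f g Γ Δ) (β : D.Cell f' g' Δ K),
    VDCSig.reframe (map_vcomp f f') (map_vcomp g g') (Φ.cell (D.comp R β)) =
      D'.comp (Φ.row R) (Φ.cell β)

end VDCMap

/-! ## Enriched categories, functors and profunctors -/

/-- Two 2-cells side by side. -/
def row₂ {S : VDCSig.{u, v, p, c}} {A B C A' B' C' : S.Obj} {f : S.Hom A A'} {g : S.Hom B B'}
    {h : S.Hom C C'} {Γ : S.Path A B} {Γ' : S.Path B C} {K : S.Pro A' B'} {K' : S.Pro B' C'}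
    (α : S.Cell f g Γ K) (β : S.Cell g h Γ' K') :
    S.Row f h (Γ.append Γ') (ProPath.cons K (ProPath.single K')) :=
  VDCSig.Row.cons α (VDCSig.Row.single β) rfl

/-- A list of two proarrows. -/
abbrev path₂ {Obj : Type u} {Pro : Obj → Obj → Type p} {A B C : Obj} (J : Pro A B) (K : Pro B C) :
    ProPath Pro A C := ProPath.cons J (ProPath.single K)

open VDCData (compTo)
open VDCSig (Row)

/-- The data of a category enriched in `E`. -/
structure EnrichedCatData (E : VDC.{u, v, p, c}) where
  Obj : Type w
  ext : Obj → E.Obj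
  hom : ∀ a b : Obj, E.Pro (ext a) (ext b)
  id : ∀ a : Obj, E.Cell (E.one (ext a)) (E.one (ext a)) (ProPath.nil (ext a)) (hom a a)
  comp : ∀ a b d : Obj,
    E.Cell (E.one (ext a)) (E.one (ext d)) (path₂ (hom a b) (hom b d)) (hom a d)

/-- The identity and associativity laws. -/
structure EnrichedCatData.IsLawful {E : VDC.{u, v, p, c}} (C : EnrichedCatData.{u, v, p, c, w} E) :
    Prop where
  id_comp : ∀ a b : C.Obj,
    compTo (row₂ (C.id a) (E.idCell (C.hom a b))) (C.comp a a b) (VDC.one_one _) (VDC.one_one _) =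
      E.idCell (C.hom a b)
  comp_id : ∀ a b : C.Obj,
    compTo (row₂ (E.idCell (C.hom a b)) (C.id b)) (C.comp a b b) (VDC.one_one _) (VDC.one_one _) =
      E.idCell (C.hom a b)
  assoc : ∀ a b d e : C.Obj,
    E.comp (row₂ (C.comp a b d) (E.idCell (C.hom d e))) (C.comp a d e) =
      E.comp (row₂ (E.idCell (C.hom a b)) (C.comp b d e)) (C.comp a b e)

/-- A category enriched in `E`. -/
structure EnrichedCat (E : VDC.{u, v, p, c}) extends EnrichedCatData.{u, v, p, c, w} E where
  lawful : toEnrichedCatData.IsLawful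

/-- The data of an enriched functor; `arr a` is the arrow between extents attached to `a`. -/
structure FunctorData {E : VDC.{u, v, p, c}} (C D : EnrichedCatData.{u, v, p, c, w} E) where
  obj : C.Obj → D.Obj
  arr : ∀ a : C.Obj, E.Hom (C.ext a) (D.ext (obj a))
  map : ∀ a b : C.Obj,
    E.Cell (arr a) (arr b) (ProPath.single (C.hom a b)) (D.hom (obj a) (obj b))

/-- The functor laws. -/
structure FunctorData.IsLawful {E : VDC.{u, v, p, c}} {C D : EnrichedCatData.{u, v, p, c, w} E}
    (F : FunctorData C D) : Prop where
  map_id : ∀ a : C.Obj,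
    E.comp (Row.single (C.id a)) (F.map a a) =
      compTo (Row.nil (F.arr a)) (D.id (F.obj a)) (VDC.vcomp_one_eq _) (VDC.vcomp_one_eq _)
  map_comp : ∀ a b d : C.Obj,
    E.comp (Row.single (C.comp a b d)) (F.map a d) =
      compTo (row₂ (F.map a b) (F.map b d)) (D.comp (F.obj a) (F.obj b) (F.obj d))
        (VDC.vcomp_one_eq _) (VDC.vcomp_one_eq _)

/-- An enriched functor. -/
structure EFunctor {E : VDC.{u, v, p, c}} (C D : EnrichedCat.{u, v, p, c, w} E) extends
    FunctorData C.toEnrichedCatData D.toEnrichedCatData where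
  lawful : toFunctorData.IsLawful

namespace FunctorData

variable {E : VDC.{u, v, p, c}}

/-- The identity functor. -/
def one (C : EnrichedCatData.{u, v, p, c, w} E) : FunctorData C C where
  obj a := a
  arr a := E.one (C.ext a)
  map a b := E.idCell (C.hom a b)

/-- Composition of functors. -/
def vcomp {C D B : EnrichedCatData.{u, v, p, c, w} E} (F : FunctorData C D) (G : FunctorData D B) :
    FunctorData C B where
  obj a := G.obj (F.obj a)
  arr a := E.vcomp (F.arr a) (G.arr (F.obj a))
  map a b := E.comp (Row.single (F.map a b)) (G.map (F.obj a) (F.obj b))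

end FunctorData

/-- The data of an enriched profunctor `C ⇸ D`. -/
structure ProfData {E : VDC.{u, v, p, c}} (C D : EnrichedCatData.{u, v, p, c, w} E) where
  pro : ∀ (a : C.Obj) (d : D.Obj), E.Pro (C.ext a) (D.ext d)
  actL : ∀ (a a' : C.Obj) (d : D.Obj),
    E.Cell (E.one (C.ext a)) (E.one (D.ext d)) (path₂ (C.hom a a') (pro a' d)) (pro a d)
  actR : ∀ (a : C.Obj) (d d' : D.Obj),
    E.Cell (E.one (C.ext a)) (E.one (D.ext d')) (path₂ (pro a d) (D.hom d d')) (pro a d')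

/-- The profunctor laws. -/
structure ProfData.IsLawful {E : VDC.{u, v, p, c}} {C D : EnrichedCatData.{u, v, p, c, w} E}
    (J : ProfData C D) : Prop where
  id_actL : ∀ (a : C.Obj) (d : D.Obj),
    compTo (row₂ (C.id a) (E.idCell (J.pro a d))) (J.actL a a d) (VDC.one_one _) (VDC.one_one _) =
      E.idCell (J.pro a d)
  actR_id : ∀ (a : C.Obj) (d : D.Obj),
    compTo (row₂ (E.idCell (J.pro a d)) (D.id d)) (J.actR a d d) (VDC.one_one _) (VDC.one_one _) =
      E.idCell (J.pro a d)
  comp_actL : ∀ (a a' a'' : C.Obj) (d : D.Obj),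
    E.comp (row₂ (C.comp a a' a'') (E.idCell (J.pro a'' d))) (J.actL a a'' d) =
      E.comp (row₂ (E.idCell (C.hom a a')) (J.actL a' a'' d)) (J.actL a a' d)
  actR_comp : ∀ (a : C.Obj) (d d' d'' : D.Obj),
    E.comp (row₂ (E.idCell (J.pro a d)) (D.comp d d' d'')) (J.actR a d d'') =
      E.comp (row₂ (J.actR a d d') (E.idCell (D.hom d' d''))) (J.actR a d' d'')
  exchange : ∀ (a a' : C.Obj) (d d' : D.Obj),
    E.comp (row₂ (J.actL a a' d) (E.idCell (D.hom d d'))) (J.actR a d d') =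
      E.comp (row₂ (E.idCell (C.hom a a')) (J.actR a' d d')) (J.actL a a' d')

/-- An enriched profunctor. -/
structure Prof {E : VDC.{u, v, p, c}} (C D : EnrichedCat.{u, v, p, c, w} E) extends
    ProfData C.toEnrichedCatData D.toEnrichedCatData where
  lawful : toProfData.IsLawful

/-! ## Morphisms of profunctors -/

/-- Composable lists of profunctors. -/
abbrev ProfPath {E : VDC.{u, v, p, c}} (C D : EnrichedCat.{u, v, p, c, w} E) :=
  ProPath (Obj := EnrichedCat.{u, v, p, c, w} E) (fun C D => Prof C D) C D

/-- For a list `Γ` of profunctors between `C₀, …, Cₖ`, a list of objects `c₀, …, cₖ`, with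
prescribed first and last object. -/
inductive Objs {E : VDC.{u, v, p, c}} : ∀ {C D : EnrichedCat.{u, v, p, c, w} E},
    ProfPath C D → C.Obj → D.Obj → Type (max (max u v p c) (w + 1))
  | nil {C : EnrichedCat.{u, v, p, c, w} E} (a : C.Obj) : Objs (ProPath.nil C) a a
  | cons {C M D : EnrichedCat.{u, v, p, c, w} E} {J : Prof C M} {Γ : ProfPath M D}
      (a : C.Obj) {b : M.Obj} {d : D.Obj} (x : Objs Γ b d) : Objs (ProPath.cons J Γ) a d

namespace Objs

variable {E : VDC.{u, v, p, c}}

/-- The list `J₁(c₀, c₁), …, Jₖ(cₖ₋₁, cₖ)` of proarrows of `E`. -/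
def path : ∀ {C D : EnrichedCat.{u, v, p, c, w} E} {Γ : ProfPath C D} {a : C.Obj} {d : D.Obj},
    Objs Γ a d → E.Path (C.ext a) (D.ext d)
  | _, _, _, _, _, nil a => ProPath.nil _
  | _, _, _, _, _, cons (J := J) (b := b) a x => ProPath.cons (J.pro a b) x.path

/-- Case analysis on a list of objects for the empty list of profunctors. -/
def casesNil {C : EnrichedCat.{u, v, p, c, w} E}
    {motive : ∀ {a d : C.Obj}, Objs (ProPath.nil C) a d → Sort*} (h : ∀ a, motive (nil a)) :
    ∀ {a d : C.Obj} (x : Objs (ProPath.nil C) a d), motive x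
  | _, _, nil a => h a

/-- Case analysis on a list of objects for a nonempty list of profunctors. -/
def casesCons {C M D : EnrichedCat.{u, v, p, c, w} E} {J : Prof C M} {Γ : ProfPath M D}
    {motive : ∀ {a : C.Obj} {d : D.Obj}, Objs (ProPath.cons J Γ) a d → Sort*}
    (h : ∀ (a : C.Obj) {b : M.Obj} {d : D.Obj} (x : Objs Γ b d), motive (cons (J := J) a x)) :
    ∀ {a : C.Obj} {d : D.Obj} (x : Objs (ProPath.cons J Γ) a d), motive x
  | _, _, cons a x => h a x

/-- A list of objects for a concatenation `Γ₁, Γ₂`, cut at the middle category. -/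
structure Split {C M D : EnrichedCat.{u, v, p, c, w} E} {Γ₁ : ProfPath C M} {Γ₂ : ProfPath M D}
    {a : C.Obj} {d : D.Obj} (x : Objs (Γ₁.append Γ₂) a d) where
  mid : M.Obj
  fst : Objs Γ₁ a mid
  snd : Objs Γ₂ mid d
  path_eq : fst.path.append snd.path = x.path

/-- Cutting a list of objects in two. -/
def split : ∀ {C M D : EnrichedCat.{u, v, p, c, w} E} (Γ₁ : ProfPath C M) {Γ₂ : ProfPath M D}
    {a : C.Obj} {d : D.Obj} (x : Objs (Γ₁.append Γ₂) a d), Split x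
  | _, _, _, ProPath.nil _, _, a, _, x => ⟨a, nil a, x, rfl⟩
  | _, _, _, ProPath.cons J Γ₁, Γ₂, a, d, x =>
      match (generalizing := false) (x : Objs (ProPath.cons J (Γ₁.append Γ₂)) a d) with
      | cons a x =>
        let s := split Γ₁ x
        ⟨s.mid, cons a s.fst, s.snd, congrArg (ProPath.cons _) s.path_eq⟩

end Objs

/-- The data of a morphism of profunctors: a family of 2-cells
`J₁(c₀, c₁), …, Jₖ(cₖ₋₁, cₖ) ⇒ K(F c₀, G cₖ)` of `E`. -/
@[ext]
structure MorData {E : VDC.{u, v, p, c}} {C D C' D' : EnrichedCat.{u, v, p, c, w} E}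
    (F : FunctorData C.toEnrichedCatData C'.toEnrichedCatData)
    (G : FunctorData D.toEnrichedCatData D'.toEnrichedCatData)
    (Γ : ProfPath C D) (K : ProfData C'.toEnrichedCatData D'.toEnrichedCatData) where
  app : ∀ {a : C.Obj} {d : D.Obj} (x : Objs Γ a d),
    E.Cell (F.arr a) (G.arr d) x.path (K.pro (F.obj a) (G.obj d))

section Actions

variable {E : VDC.{u, v, p, c}}

/-- A hom of the first category acts on the first profunctor: the row
`C₀(a, a'), J₁(a', c₁), J₂(c₁, c₂), … ⇒ J₁(a, c₁), J₂(c₁, c₂), …`. -/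
inductive LeftAct : ∀ {C D : EnrichedCat.{u, v, p, c, w} E} {Γ : ProfPath C D} {a a' : C.Obj}
    {d : D.Obj} (x' : Objs Γ a' d) (x : Objs Γ a d),
    E.Row (E.one (C.ext a)) (E.one (D.ext d)) (ProPath.cons (C.hom a a') x'.path) x.path → Prop
  | mk {C M D : EnrichedCat.{u, v, p, c, w} E} (J : Prof C M) {Γ : ProfPath M D} (a a' : C.Obj)
      {b : M.Obj} {d : D.Obj} (y : Objs Γ b d) :
      LeftAct (Objs.cons (J := J) a' y) (Objs.cons (J := J) a y)
        (Row.cons (J.actL a a' b) (E.idRow y.path) rfl)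

/-- A hom of the last category acts on the last profunctor: the row
`…, Jₖ(cₖ₋₁, d), Cₖ(d, d') ⇒ …, Jₖ(cₖ₋₁, d')`. -/
inductive RightAct : ∀ {C D : EnrichedCat.{u, v, p, c, w} E} {Γ : ProfPath C D} {a : C.Obj}
    {d d' : D.Obj} (x : Objs Γ a d) (x' : Objs Γ a d'),
    E.Row (E.one (C.ext a)) (E.one (D.ext d'))
      (x.path.append (ProPath.single (D.hom d d'))) x'.path → Prop
  | last {C D : EnrichedCat.{u, v, p, c, w} E} (J : Prof C D) (a : C.Obj) (d d' : D.Obj) :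
      RightAct (Objs.cons (J := J) a (Objs.nil d)) (Objs.cons (J := J) a (Objs.nil d'))
        (Row.single (J.actR a d d'))
  | there {C M D : EnrichedCat.{u, v, p, c, w} E} (J : Prof C M) {Γ : ProfPath M D} (a : C.Obj)
      {b : M.Obj} {d d' : D.Obj} {x : Objs Γ b d} {x' : Objs Γ b d'}
      {R : E.Row (E.one (M.ext b)) (E.one (D.ext d'))
        (x.path.append (ProPath.single (D.hom d d'))) x'.path} (h : RightAct x x' R) :
      RightAct (Objs.cons (J := J) a x) (Objs.cons (J := J) a x')
        (Row.cons (E.idCell (J.pro a b)) R rfl)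

/-- A hom `Cᵢ(b, b')` of an intermediate category is inserted into the list, and it acts either on
the profunctor before it (first row) or on the profunctor after it (second row). -/
inductive InnerAct : ∀ {C D : EnrichedCat.{u, v, p, c, w} E} {Γ : ProfPath C D} {a : C.Obj}
    {d : D.Obj} (x y : Objs Γ a d) {P : E.Path (C.ext a) (D.ext d)},
    E.Row (E.one (C.ext a)) (E.one (D.ext d)) P x.path →
    E.Row (E.one (C.ext a)) (E.one (D.ext d)) P y.path → Prop
  | here {C M N D : EnrichedCat.{u, v, p, c, w} E} (J : Prof C M) (J' : Prof M N)
      {Γ : ProfPath N D} (a : C.Obj) (b b' : M.Obj) {n : N.Obj} {d : D.Obj} (z : Objs Γ n d) :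
      InnerAct (Objs.cons (J := J) a (Objs.cons (J := J') b' z))
        (Objs.cons (J := J) a (Objs.cons (J := J') b z))
        (Row.cons (J.actR a b b') (Row.cons (E.idCell (J'.pro b' n)) (E.idRow z.path) rfl) rfl)
        (Row.cons (E.idCell (J.pro a b)) (Row.cons (J'.actL b b' n) (E.idRow z.path) rfl) rfl)
  | there {C M D : EnrichedCat.{u, v, p, c, w} E} (J : Prof C M) {Γ : ProfPath M D} (a : C.Obj)
      {b : M.Obj} {d : D.Obj} {x y : Objs Γ b d} {P : E.Path (M.ext b) (D.ext d)}
      {R : E.Row (E.one (M.ext b)) (E.one (D.ext d)) P x.path}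
      {R' : E.Row (E.one (M.ext b)) (E.one (D.ext d)) P y.path} (h : InnerAct x y R R') :
      InnerAct (Objs.cons (J := J) a x) (Objs.cons (J := J) a y)
        (Row.cons (E.idCell (J.pro a b)) R rfl) (Row.cons (E.idCell (J.pro a b)) R' rfl)

/-- For the empty list of profunctors on `C`: the two lists of objects `a` and `a'`, together with
the list `P = [C(a, a')]`. -/
inductive EmptyAct : ∀ {C D : EnrichedCat.{u, v, p, c, w} E} {Γ : ProfPath C D} {a a' : C.Obj}
    {d d' : D.Obj} (x : Objs Γ a d) (x' : Objs Γ a' d') (P : E.Path (C.ext a) (D.ext d')),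
    ProPath.cons (C.hom a a') x'.path = P → x.path.append (ProPath.single (D.hom d d')) = P → Prop
  | mk {C : EnrichedCat.{u, v, p, c, w} E} (a a' : C.Obj) :
      EmptyAct (Objs.nil a) (Objs.nil a') (ProPath.single (C.hom a a')) rfl rfl

end Actions

/-- The laws of a morphism of profunctors `α : J₁, …, Jₖ ⇒ K` along `F` and `G`. -/
structure MorData.IsLawful {E : VDC.{u, v, p, c}} {C D C' D' : EnrichedCat.{u, v, p, c, w} E}
    {F : FunctorData C.toEnrichedCatData C'.toEnrichedCatData}
    {G : FunctorData D.toEnrichedCatData D'.toEnrichedCatData}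
    {Γ : ProfPath C D} {K : ProfData C'.toEnrichedCatData D'.toEnrichedCatData}
    (α : MorData F G Γ K) : Prop where
  /-- The two actions of an intermediate category are equalized. -/
  inner : ∀ {a : C.Obj} {d : D.Obj} {x y : Objs Γ a d} {P : E.Path (C.ext a) (D.ext d)}
    {R : E.Row (E.one (C.ext a)) (E.one (D.ext d)) P x.path}
    {R' : E.Row (E.one (C.ext a)) (E.one (D.ext d)) P y.path}, InnerAct x y R R' →
    E.comp R (α.app x) = E.comp R' (α.app y)
  /-- Compatibility with the action of the first category and with `F`, for nonempty lists. -/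
  left : ∀ {a a' : C.Obj} {d : D.Obj} {x' : Objs Γ a' d} {x : Objs Γ a d}
    {R : E.Row (E.one (C.ext a)) (E.one (D.ext d)) (ProPath.cons (C.hom a a') x'.path) x.path},
    LeftAct x' x R →
    E.comp R (α.app x) =
      compTo (row₂ (F.map a a') (α.app x')) (K.actL (F.obj a) (F.obj a') (G.obj d))
        (VDC.vcomp_one_eq _) (VDC.vcomp_one_eq _)
  /-- Compatibility with the action of the last category and with `G`, for nonempty lists. -/
  right : ∀ {a : C.Obj} {d d' : D.Obj} {x : Objs Γ a d} {x' : Objs Γ a d'}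
    {R : E.Row (E.one (C.ext a)) (E.one (D.ext d'))
      (x.path.append (ProPath.single (D.hom d d'))) x'.path},
    RightAct x x' R →
    E.comp R (α.app x') =
      compTo (row₂ (α.app x) (G.map d d')) (K.actR (F.obj a) (G.obj d) (G.obj d'))
        (VDC.vcomp_one_eq _) (VDC.vcomp_one_eq _)
  /-- Naturality, for the empty list. -/
  empty : ∀ {a a' : C.Obj} {d d' : D.Obj} {x : Objs Γ a d} {x' : Objs Γ a' d'}
    {P : E.Path (C.ext a) (D.ext d')} {e : ProPath.cons (C.hom a a') x'.path = P}
    {e' : x.path.append (ProPath.single (D.hom d d')) = P},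
    EmptyAct x x' P e e' →
    E.comp (Row.cons (F.map a a') (Row.single (α.app x')) e)
        (K.actL (F.obj a) (F.obj a') (G.obj d')) =
      E.comp (Row.cons (α.app x) (Row.single (G.map d d')) e')
        (K.actR (F.obj a) (G.obj d) (G.obj d'))

/-- A morphism of profunctors. -/
structure Mor {E : VDC.{u, v, p, c}} {C D C' D' : EnrichedCat.{u, v, p, c, w} E}
    (F : EFunctor C C') (G : EFunctor D D') (Γ : ProfPath C D) (K : Prof C' D') extends
    MorData F.toFunctorData G.toFunctorData Γ K.toProfData where
  lawful : toMorData.IsLawful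

/-! ## The virtual double category of enriched categories -/

/-- Enriched categories, functors, profunctors and morphisms of profunctors. -/
abbrev VCatSig (E : VDC.{u, v, p, c}) : VDCSig where
  Obj := EnrichedCat.{u, v, p, c, w} E
  Hom C D := EFunctor C D
  Pro C D := Prof C D
  Cell F G Γ K := Mor F G Γ K

section Operations

variable {E : VDC.{u, v, p, c}}

/-- The components of the identity morphism of a profunctor are identities. -/
def MorData.one {C D : EnrichedCat.{u, v, p, c, w} E} (J : Prof C D) :
    MorData (FunctorData.one C.toEnrichedCatData) (FunctorData.one D.toEnrichedCatData)
      (ProPath.single J) J.toProfData where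
  app := fun
    | Objs.cons (b := b) a (Objs.nil _) => E.idCell (J.pro a b)

/-- A row of morphisms of profunctors, evaluated at a list of objects: the resulting list of
objects in the codomains, and the row of components. -/
def rowAt : ∀ {C D C' D' : EnrichedCat.{u, v, p, c, w} E} {F : EFunctor C C'} {G : EFunctor D D'}
    {Γ : ProfPath C D} {Δ : ProfPath C' D'},
    (VCatSig.{u, v, p, c, w} E).Row F G Γ Δ → ∀ {a : C.Obj} {d : D.Obj} (x : Objs Γ a d),
    (y : Objs Δ (F.obj a) (G.obj d)) × E.Row (F.arr a) (G.arr d) x.path y.path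
  | _, _, _, _, _, _, _, _, Row.nil F, _, _, Objs.nil a =>
      ⟨Objs.nil (F.obj a), Row.nil (F.arr a)⟩
  | _, _, _, _, F, _, _, _, Row.cons (Γ := Γ₁) (K := K) α R rfl, a, _, x =>
      let s := Objs.split Γ₁ x
      let r := rowAt R s.snd
      ⟨Objs.cons (J := K) (F.obj a) r.1,
        Row.cons (MorData.app (Mor.toMorData α) s.fst) r.2 s.path_eq⟩

/-- Composition of morphisms of profunctors is componentwise. -/
def MorData.comp {C D C' D' C'' D'' : EnrichedCat.{u, v, p, c, w} E} {F : EFunctor C C'}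
    {G : EFunctor D D'} {Γ : ProfPath C D} {Δ : ProfPath C' D'} {F' : EFunctor C' C''}
    {G' : EFunctor D' D''} {K : Prof C'' D''} (R : (VCatSig.{u, v, p, c, w} E).Row F G Γ Δ)
    (β : Mor F' G' Δ K) :
    MorData (F.toFunctorData.vcomp F'.toFunctorData) (G.toFunctorData.vcomp G'.toFunctorData)
      Γ K.toProfData where
  app x := E.comp (rowAt R x).2 (β.app (rowAt R x).1)

/-- The operations on enriched functors and morphisms of profunctors do produce enriched functors
and morphisms of profunctors. -/
structure VCatClosed (E : VDC.{u, v, p, c}) : Prop where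
  one : ∀ C : EnrichedCat.{u, v, p, c, w} E, (FunctorData.one C.toEnrichedCatData).IsLawful
  vcomp : ∀ {C D B : EnrichedCat.{u, v, p, c, w} E} (F : EFunctor C D) (G : EFunctor D B),
    (F.toFunctorData.vcomp G.toFunctorData).IsLawful
  idCell : ∀ {C D : EnrichedCat.{u, v, p, c, w} E} (J : Prof C D), (MorData.one J).IsLawful
  comp : ∀ {C D C' D' C'' D'' : EnrichedCat.{u, v, p, c, w} E} {F : EFunctor C C'}
    {G : EFunctor D D'} {Γ : ProfPath C D} {Δ : ProfPath C' D'} {F' : EFunctor C' C''}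
    {G' : EFunctor D' D''} {K : Prof C'' D''} (R : (VCatSig.{u, v, p, c, w} E).Row F G Γ Δ)
    (β : Mor F' G' Δ K), (MorData.comp R β).IsLawful

/-- The data of the virtual double category of categories enriched in `E`. -/
def VCatData (h : VCatClosed.{u, v, p, c, w} E) : VDCData where
  toVDCSig := VCatSig.{u, v, p, c, w} E
  one C := ⟨FunctorData.one C.toEnrichedCatData, h.one C⟩
  vcomp F G := ⟨F.toFunctorData.vcomp G.toFunctorData, h.vcomp F G⟩
  idCell J := ⟨MorData.one J, h.idCell J⟩
  comp R β := ⟨MorData.comp R β, h.comp R β⟩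

end Operations

/-! ## Units, companions and conjoints in a virtual equipment -/

namespace VDC.EquipmentData

variable {E : VDC.{u, v, p, c}} (S : E.EquipmentData)

/-- The unique factorization of a 2-cell through the cartesian cell of a restriction. -/
noncomputable def lift {A B A' B' Z W : E.Obj} {f : E.Hom A A'} {g : E.Hom B B'}
    {K : E.Pro A' B'} {Γ : E.Path Z W} {h : E.Hom Z A} {k : E.Hom W B}
    (φ : E.Cell (E.vcomp h f) (E.vcomp k g) Γ K) : E.Cell h k Γ (S.restr f g K) :=
  (S.isCartesian f g K φ).choose

/-- The unique factorization of a 2-cell through the insertion of a unit. -/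
noncomputable def insertUnit {Z A W Y Y' : E.Obj} (Γ₁ : E.Path Z A) (Γ₂ : E.Path A W)
    {f : E.Hom Z Y} {g : E.Hom W Y'} {K : E.Pro Y Y'} (φ : E.Cell f g (Γ₁.append Γ₂) K) :
    E.Cell f g (Γ₁.append (ProPath.cons (S.unit A) Γ₂)) K :=
  (S.isUnit A Γ₁ Γ₂ φ).choose

/-- The canonical 2-cell `U_A, J ⇒ J`. -/
noncomputable def unitL {A B : E.Obj} (J : E.Pro A B) :
    E.Cell (E.one A) (E.one B) (path₂ (S.unit A) J) J :=
  S.insertUnit (ProPath.nil A) (ProPath.single J) (E.idCell J)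

/-- The canonical 2-cell `J, U_B ⇒ J`. -/
noncomputable def unitR {A B : E.Obj} (J : E.Pro A B) :
    E.Cell (E.one A) (E.one B) (path₂ J (S.unit B)) J :=
  S.insertUnit (ProPath.single J) (ProPath.nil B) (E.idCell J)

/-- The canonical 2-cell `U_A ⇒ U_B` along an arrow `f : A ⟶ B`. -/
noncomputable def unitMap {A B : E.Obj} (f : E.Hom A B) :
    E.Cell f f (ProPath.single (S.unit A)) (S.unit B) :=
  S.insertUnit (ProPath.nil A) (ProPath.nil A)
    (compTo (Row.nil f) (S.unitCell B) (E.lawful.vcomp_one f) (E.lawful.vcomp_one f))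

/-- The companion `U_B(f, 1)` of an arrow. -/
def companion {A B : E.Obj} (f : E.Hom A B) : E.Pro A B := S.restr f (E.one B) (S.unit B)

/-- The conjoint `U_B(1, f)` of an arrow. -/
def conjoint {A B : E.Obj} (f : E.Hom A B) : E.Pro B A := S.restr (E.one B) f (S.unit B)

/-- The canonical 2-cell from a companion and a conjoint to the restriction of the unit. -/
noncomputable def homWitness {A B Y : E.Obj} (f : E.Hom A Y) (g : E.Hom B Y) :
    E.Cell (E.one A) (E.one B) (path₂ (S.companion f) (S.conjoint g))
      (S.restr f g (S.unit Y)) :=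
  S.lift (compTo
    (row₂ (S.restrCell f (E.one Y) (S.unit Y)) (S.restrCell (E.one Y) g (S.unit Y)))
    (S.unitL (S.unit Y)) (vcomp_one_eq f) (vcomp_one_eq g))

/-- The canonical 2-cell from a companion, a proarrow and a conjoint to the restriction of the
proarrow. -/
noncomputable def proWitness {A B Y Z : E.Obj} (f : E.Hom A Y) (g : E.Hom B Z) (J : E.Pro Y Z) :
    E.Cell (E.one A) (E.one B)
      (ProPath.cons (S.companion f) (path₂ J (S.conjoint g))) (S.restr f g J) :=
  S.lift (compTo
    (row₂ (E.comp (row₂ (S.restrCell f (E.one Y) (S.unit Y)) (E.idCell J)) (S.unitL J))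
      (compTo (Row.single (S.restrCell (E.one Z) g (S.unit Z))) (E.idCell (S.unit Z))
        rfl rfl))
    (S.unitR J)
    ((congrArg (fun k => E.vcomp k (E.one Y)) (E.lawful.vcomp_one f)).trans (vcomp_one_eq f))
    ((congrArg (fun k => E.vcomp k (E.one Z)) (E.lawful.vcomp_one g)).trans (vcomp_one_eq g)))

end VDC.EquipmentData

/-! ## Componentwise restrictions of enriched profunctors -/

section Restriction

variable {E : VDC.{u, v, p, c}} (S : E.EquipmentData)

/-- The componentwise restriction `K(F, G)`. -/
noncomputable def restrProf {C D C' D' : EnrichedCat.{u, v, p, c, w} E} (F : EFunctor C C')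
    (G : EFunctor D D') (K : Prof C' D') :
    ProfData C.toEnrichedCatData D.toEnrichedCatData where
  pro a d := S.restr (F.arr a) (G.arr d) (K.pro (F.obj a) (G.obj d))
  actL a a' d := S.lift (compTo
    (row₂ (F.map a a') (S.restrCell (F.arr a') (G.arr d) (K.pro (F.obj a') (G.obj d))))
    (K.actL (F.obj a) (F.obj a') (G.obj d)) (VDC.vcomp_one_eq _) (VDC.vcomp_one_eq _))
  actR a d d' := S.lift (compTo
    (row₂ (S.restrCell (F.arr a) (G.arr d) (K.pro (F.obj a) (G.obj d))) (G.map d d'))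
    (K.actR (F.obj a) (G.obj d) (G.obj d')) (VDC.vcomp_one_eq _) (VDC.vcomp_one_eq _))

/-- The cartesian cells of `E`, as the components of a morphism `K(F, G) ⇒ K`. -/
def restrMor {C D C' D' : EnrichedCat.{u, v, p, c, w} E} (F : EFunctor C C')
    (G : EFunctor D D') (K : Prof C' D') (h : (restrProf S F G K).IsLawful) :
    MorData F.toFunctorData G.toFunctorData
      (ProPath.single (⟨restrProf S F G K, h⟩ : Prof C D)) K.toProfData where
  app := fun
    | Objs.cons (b := d) a (Objs.nil _) =>
        S.restrCell (F.arr a) (G.arr d) (K.pro (F.obj a) (G.obj d))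

end Restriction

/-! ## Representatives -/

section Representatives

variable {E : VDC.{u, v, p, c}} (S : E.EquipmentData)

/-- The representative `|Y|` of an object: its objects are the arrows into `Y`, the extent of an
arrow is its domain, and the hom from `x` to `y` is the restriction `U_Y(x, y)`. -/
noncomputable def repCat (Y : E.Obj) : EnrichedCatData.{u, v, p, c, max u v} E where
  Obj := (B : E.Obj) × E.Hom B Y
  ext x := x.1
  hom x y := S.restr x.2 y.2 (S.unit Y)
  id x := S.lift (compTo (Row.nil x.2) (S.unitCell Y) (VDC.vcomp_one_eq _) (VDC.vcomp_one_eq _))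
  comp x y z := S.lift (compTo
    (row₂ (S.restrCell x.2 y.2 (S.unit Y)) (S.restrCell y.2 z.2 (S.unit Y)))
    (S.unitL (S.unit Y)) (VDC.vcomp_one_eq _) (VDC.vcomp_one_eq _))

/-- The representative `|f|` of an arrow: postcomposition with `f`, without change of extent. -/
noncomputable def repFunctor {Y Z : E.Obj} (f : E.Hom Y Z) :
    FunctorData (repCat S Y) (repCat S Z) where
  obj x := ⟨x.1, E.vcomp x.2 f⟩
  arr x := E.one x.1
  map x y := S.lift (compTo (Row.single (S.restrCell x.2 y.2 (S.unit Y))) (S.unitMap f)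
    (E.lawful.one_vcomp _).symm (E.lawful.one_vcomp _).symm)

/-- The representative `|J|` of a proarrow: the profunctor of restrictions `J(x, y)`. -/
noncomputable def repProf {Y Z : E.Obj} (J : E.Pro Y Z) : ProfData (repCat S Y) (repCat S Z) where
  pro x y := S.restr x.2 y.2 J
  actL x x' y := S.lift (compTo
    (row₂ (S.restrCell x.2 x'.2 (S.unit Y)) (S.restrCell x'.2 y.2 J))
    (S.unitL J) (VDC.vcomp_one_eq _) (VDC.vcomp_one_eq _))
  actR x y y' := S.lift (compTo
    (row₂ (S.restrCell x.2 y.2 J) (S.restrCell y.2 y'.2 (S.unit Z)))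
    (S.unitR J) (VDC.vcomp_one_eq _) (VDC.vcomp_one_eq _))

/-- Representatives of objects, arrows and proarrows are enriched categories, functors and
profunctors. -/
structure RepLawful : Prop where
  cat : ∀ Y : E.Obj, (repCat S Y).IsLawful
  functor : ∀ {Y Z : E.Obj} (f : E.Hom Y Z), (repFunctor S f).IsLawful
  prof : ∀ {Y Z : E.Obj} (J : E.Pro Y Z), (repProf S J).IsLawful

namespace RepLawful

variable {S} (H : RepLawful S)

/-- `|Y|` as an enriched category. -/
noncomputable def obj (Y : E.Obj) : EnrichedCat.{u, v, p, c, max u v} E := ⟨repCat S Y, H.cat Y⟩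

/-- `|f|` as an enriched functor. -/
noncomputable def hom {Y Z : E.Obj} (f : E.Hom Y Z) : EFunctor (H.obj Y) (H.obj Z) :=
  ⟨repFunctor S f, H.functor f⟩

/-- `|J|` as an enriched profunctor. -/
noncomputable def pro {Y Z : E.Obj} (J : E.Pro Y Z) : Prof (H.obj Y) (H.obj Z) :=
  ⟨repProf S J, H.prof J⟩

/-- The list `|J₁|, …, |Jₖ|`. -/
noncomputable def path {Y Z : E.Obj} (Γ : E.Path Y Z) : ProfPath (H.obj Y) (H.obj Z) :=
  Γ.map H.obj H.pro

/-- The row of cartesian cells `Jᵢ(xᵢ₋₁, xᵢ) ⇒ Jᵢ`. -/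
noncomputable def cartRow : ∀ {Y Z : E.Obj} (Γ : E.Path Y Z) {a : (H.obj Y).Obj} {d : (H.obj Z).Obj}
    (x : Objs (H.path Γ) a d), E.Row a.2 d.2 x.path Γ
  | Y, _, ProPath.nil _, _, _, x =>
      Objs.casesNil (C := H.obj Y) (motive := fun {a d} x => E.Row a.2 d.2 x.path (ProPath.nil Y))
        (fun a => Row.nil a.2) x
  | _, _, ProPath.cons J Γ, _, _, x =>
      Objs.casesCons (J := H.pro J) (Γ := H.path Γ)
        (motive := fun {a d} x => E.Row a.2 d.2 x.path (ProPath.cons J Γ))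
        (fun a {b} _ y => Row.cons (S.restrCell a.2 b.2 J) (cartRow Γ y) rfl) x

/-- The representative `|α|` of a 2-cell. Its component at `x₀, …, xₖ` is the unique 2-cell
`J₁(x₀, x₁), …, Jₖ(xₖ₋₁, xₖ) ⇒ K(x₀ f, xₖ g)` which, followed by the cartesian cell of its
codomain, is the composite of `α` with the cartesian cells of the `Jᵢ(xᵢ₋₁, xᵢ)`. -/
noncomputable def mor {Y Z Y' Z' : E.Obj} {f : E.Hom Y Y'} {g : E.Hom Z Z'} {Γ : E.Path Y Z}
    {K : E.Pro Y' Z'} (α : E.Cell f g Γ K) :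
    MorData (H.hom f).toFunctorData (H.hom g).toFunctorData (H.path Γ) (H.pro K).toProfData where
  app x := S.lift (compTo (H.cartRow Γ x) α
    (E.lawful.one_vcomp _).symm (E.lawful.one_vcomp _).symm)

/-- Representatives of 2-cells are morphisms of profunctors. -/
def MorLawful : Prop :=
  ∀ {Y Z Y' Z' : E.Obj} {f : E.Hom Y Y'} {g : E.Hom Z Z'} {Γ : E.Path Y Z}
    {K : E.Pro Y' Z'} (α : E.Cell f g Γ K), (H.mor α).IsLawful

/-- The embedding `|·|`. -/
noncomputable def embedding (H' : H.MorLawful) :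
    VDCMap E.toVDCSig (VCatSig.{u, v, p, c, max u v} E) where
  obj := H.obj
  hom := H.hom
  pro := H.pro
  cell α := ⟨H.mor α, H' α⟩

end RepLawful

end Representatives

end VirtualEquipments

/-! Composites in a virtual double category are multi-composites, and their boundaries agree only up
to equalities of arrows and of lists, so diagrams are awkward to chase directly. The argument works
with generalized elements instead. An element of a list of profunctors is a list of objects together
with a row of 2-cells of `E` into the resulting list of proarrows (`Elem`). Homs act on elements,
functors and morphisms of profunctors have values at them, and each axiom, being an equation of
2-cells, becomes an equation between values: precomposition with a row gives one direction, identity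
rows give the other (`MorData.isLawful_of_eval`, `ProfData.isLawful_of_elem`, `Mor.heq_of_eval`).

Enriched categories form a virtual double category because a row of morphisms sends elements to
elements (`Elem.Push`) and the value of a composite is the value at the image
(`Elem.Push.eval_comp`). A lawful morphism is constant on the equivalence relation `Elem.Rel`
generated by moving a hom from one component to the next. Hence a composite is lawful as soon as
acting before pushing forward agrees, up to `Rel`, with acting afterwards (`push_lact`, `push_ract`,
`push_iact`). The delicate 2-cells are those with empty domain: a hom has to slide across them, and
this is their naturality law (`push_eact`). The axioms for composition reduce to functoriality of
`Push`.

Restrictions are componentwise because composition with a cartesian 2-cell (`cart`) is injective and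
turns the actions of `K(F, G)` into those of `K`. The unit of an enriched category is its hom
profunctor. A factorization exists by letting an inserted hom act on a neighbouring profunctor or,
if there is none, on the codomain. It is unique because `σ = 1 · σ`: the factor `σ` can be moved
away, so only the values at inserted identities matter.

For representatives, the unit `U_Y` of `E` multiplies with itself and acts on every proarrow, and
every 2-cell respects these actions, since the two sides of each such law become equal after
inserting a unit (`UnitInsert.ext`). The operation `cart` translates the laws of `|Y|`, `|J|`, `|f|`
and `|α|` into these facts. The composite statements hold because the canonical 2-cells have a
one-sided inverse built from the unit 2-cells of companions and conjoints; in the other order one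
gets the identity row up to moving elements of units between components, which no 2-cell can detect
(`isComposite_of_split`). -/

namespace VirtualEquipments

open VDCData (compTo)
open VDCSig (Row reframe)

/-! ## Concatenation and vertical composition of rows, as relations -/

namespace VDCSig

variable {S : VDCSig.{u, v, p, c}}

/-- `T` is the concatenation of the rows `Q` and `R`. -/
inductive Row.IsAppend : ∀ {A B C A' B' C' : S.Obj} {f : S.Hom A A'} {g : S.Hom B B'}
    {h : S.Hom C C'} {Γ₁ : S.Path A B} {Γ₂ : S.Path B C} {Γ : S.Path A C} {Δ₁ : S.Path A' B'}
    {Δ₂ : S.Path B' C'} {Δ : S.Path A' C'},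
    S.Row f g Γ₁ Δ₁ → S.Row g h Γ₂ Δ₂ → S.Row f h Γ Δ → Prop
  | nil {A B A' B' : S.Obj} {f : S.Hom A A'} {g : S.Hom B B'} {Γ : S.Path A B}
      {Δ : S.Path A' B'} (R : S.Row f g Γ Δ) : IsAppend (Row.nil f) R R
  | cons {A B C D A' B' C' D' : S.Obj} {f : S.Hom A A'} {g : S.Hom B B'} {h : S.Hom C C'}
      {k : S.Hom D D'} {Γ₁ : S.Path A B} {Γ₂ : S.Path B C} {Γ₃ : S.Path C D} {Γ₁₂ : S.Path A C}
      {Γ₂₃ : S.Path B D} {Γ : S.Path A D} {K : S.Pro A' B'} {Δ₂ : S.Path B' C'}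
      {Δ₃ : S.Path C' D'} {Δ₂₃ : S.Path B' D'}
      (α : S.Cell f g Γ₁ K) {Q : S.Row g h Γ₂ Δ₂} {R : S.Row h k Γ₃ Δ₃} {T : S.Row g k Γ₂₃ Δ₂₃}
      (H : IsAppend Q R T) (e : Γ₁.append Γ₂ = Γ₁₂) (e' : Γ₁.append Γ₂₃ = Γ) :
      IsAppend (Row.cons α Q e) R (Row.cons α T e')

namespace Row

variable {A B C A' B' C' : S.Obj} {f : S.Hom A A'} {g : S.Hom B B'}
    {h : S.Hom C C'} {Γ₁ : S.Path A B} {Γ₂ : S.Path B C} {Γ : S.Path A C} {Δ₁ : S.Path A' B'}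
    {Δ₂ : S.Path B' C'} {Δ : S.Path A' C'}

theorem IsAppend.top_eq {Q : S.Row f g Γ₁ Δ₁} {R : S.Row g h Γ₂ Δ₂} {T : S.Row f h Γ Δ}
    (H : IsAppend Q R T) : Γ₁.append Γ₂ = Γ := by
  induction H with
  | nil R => rfl
  | cons α H e e' ih => subst e; subst e'; subst ih; exact ProPath.append_assoc _ _ _

theorem IsAppend.bot_eq {Q : S.Row f g Γ₁ Δ₁} {R : S.Row g h Γ₂ Δ₂} {T : S.Row f h Γ Δ}
    (H : IsAppend Q R T) : Δ₁.append Δ₂ = Δ := by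
  induction H with
  | nil R => rfl
  | cons α H e e' ih => subst ih; rfl

theorem cons_heq {D D' : S.Obj} {k : S.Hom D D'} {Γ₃ : S.Path D A} {K : S.Pro D' A'}
    (α : S.Cell k f Γ₃ K) (R : S.Row f g Γ₁ Δ₁)
    {Θ Θ' : S.Path D B} (e : Γ₃.append Γ₁ = Θ) (e' : Γ₃.append Γ₁ = Θ') :
    Row.cons α R e ≍ Row.cons α R e' := by
  subst e; subst e'; rfl

theorem IsAppend.heq {Q : S.Row f g Γ₁ Δ₁} {R : S.Row g h Γ₂ Δ₂} {T : S.Row f h Γ Δ}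
    (H : IsAppend Q R T) : Q.append R rfl ≍ T := by
  induction H with
  | nil R => rfl
  | @cons _ _ _ _ _ _ _ _ _ _ _ _ _ _ _ _ _ _ _ _ _ _ α Q R T H e e' ih =>
    obtain rfl := H.top_eq
    obtain rfl := H.bot_eq
    obtain rfl := eq_of_heq ih
    subst e; subst e'
    exact cons_heq α _ _ rfl

/-- The relation `IsAppend` carries its boundary equations implicitly, whereas `append` takes one as
an argument. The passage back is needed because `Tower.top` is defined by `append`. -/
theorem IsAppend.append_eq {Q : S.Row f g Γ₁ Δ₁} {R : S.Row g h Γ₂ Δ₂}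
    {T : S.Row f h Γ (Δ₁.append Δ₂)} (H : IsAppend Q R T) : Q.append R H.top_eq = T := by
  obtain rfl := H.top_eq
  exact eq_of_heq H.heq

theorem IsAppend.right_nil (R : S.Row f g Γ₁ Δ₁) : IsAppend R (Row.nil g) R := by
  induction R with
  | nil f => exact .nil _
  | cons α Q e ih => exact .cons α ih e e

theorem IsAppend.single (α : S.Cell f g Γ₁ K) (R : S.Row g h Γ₂ Δ₂) (e : Γ₁.append Γ₂ = Γ) :
    IsAppend (Row.single α) R (Row.cons α R e) :=
  .cons α (.nil R) _ e

theorem exists_cons {K : S.Pro A' B'} (R : S.Row f h Γ (ProPath.cons K Δ₂)) :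
    ∃ (B : S.Obj) (g : S.Hom B B') (Γ₁ : S.Path A B) (Γ₂ : S.Path B C) (α : S.Cell f g Γ₁ K)
      (R' : S.Row g h Γ₂ Δ₂) (e : Γ₁.append Γ₂ = Γ), R = Row.cons α R' e := by
  cases R with
  | cons α R e => exact ⟨_, _, _, _, α, R, e, rfl⟩

end Row

end VDCSig

/-! ## The calculus of composites -/

namespace VDC

variable {E : VDC.{u, v, p, c}}

section

variable {A B A' B' A'' B'' : E.Obj} {f : E.Hom A A'} {g : E.Hom B B'} {Γ : E.Path A B}
  {Δ : E.Path A' B'} {f' : E.Hom A' A''} {g' : E.Hom B' B''} {K : E.Pro A'' B''}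
  {f'' : E.Hom A A''} {g'' : E.Hom B B''}

theorem reframe_heq {f' : E.Hom A A'} {g' : E.Hom B B'} {K : E.Pro A' B'} (hf : f = f')
    (hg : g = g') (α : E.Cell f g Γ K) : reframe hf hg α ≍ α := by
  subst hf; subst hg; rfl

theorem compTo_heq (R : E.Row f g Γ Δ) (β : E.Cell f' g' Δ K) (hf : E.vcomp f f' = f'')
    (hg : E.vcomp g g' = g'') : compTo R β hf hg ≍ E.comp R β :=
  reframe_heq hf hg _

/-- A composite boundary can be written in many equal ways. An equation proved for one choice holds
for every other, since both sides are transported together. -/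
theorem compTo_frame {A₂ B₂ : E.Obj} {h : E.Hom A A₂} {k : E.Hom B B₂}
    {Δ' : E.Path A₂ B₂} {h' : E.Hom A₂ A''} {k' : E.Hom B₂ B''} {R : E.Row f g Γ Δ}
    {β : E.Cell f' g' Δ K} {R' : E.Row h k Γ Δ'} {β' : E.Cell h' k' Δ' K}
    {h₁ : E.vcomp f f' = f''} {h₂ : E.vcomp g g' = g''} {h₃ : E.vcomp h h' = f''}
    {h₄ : E.vcomp k k' = g''} (e : compTo R β h₁ h₂ = compTo R' β' h₃ h₄)
    {f₃ : E.Hom A A''} {g₃ : E.Hom B B''} (h₅ : E.vcomp f f' = f₃) (h₆ : E.vcomp g g' = g₃)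
    (h₇ : E.vcomp h h' = f₃) (h₈ : E.vcomp k k' = g₃) :
    compTo R β h₅ h₆ = compTo R' β' h₇ h₈ := by
  subst h₁; subst h₂; subst h₅; subst h₆; exact e

theorem compTo_idRow {K : E.Pro A' B'} (β : E.Cell f g Γ K) (hf : E.vcomp (E.one A) f = f)
    (hg : E.vcomp (E.one B) g = g) : compTo (E.idRow Γ) β hf hg = β :=
  E.lawful.idRow_comp β

theorem compTo_single_idCell {K : E.Pro A' B'} (α : E.Cell f g Γ K) (hf : E.vcomp f (E.one A') = f)
    (hg : E.vcomp g (E.one B') = g) : compTo (Row.single α) (E.idCell K) hf hg = α :=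
  E.lawful.comp_idCell α

end

/-- `T` is the vertical composite of the rows `R` and `R'`. -/
inductive VComp : ∀ {A B A' B' A'' B'' : E.Obj} {f : E.Hom A A'} {g : E.Hom B B'}
    {f' : E.Hom A' A''} {g' : E.Hom B' B''} {f'' : E.Hom A A''} {g'' : E.Hom B B''}
    {Γ : E.Path A B} {Δ : E.Path A' B'} {Θ : E.Path A'' B''},
    E.Row f g Γ Δ → E.Row f' g' Δ Θ → E.Row f'' g'' Γ Θ → Prop
  | nil {A A' A'' : E.Obj} (f : E.Hom A A') (f' : E.Hom A' A'') {f'' : E.Hom A A''}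
      (h : E.vcomp f f' = f'') : VComp (Row.nil f) (Row.nil f') (Row.nil f'')
  | cons {A B C A' B' C' A'' B'' C'' : E.Obj} {f : E.Hom A A'} {g : E.Hom B B'} {h : E.Hom C C'}
      {f' : E.Hom A' A''} {g' : E.Hom B' B''} {h' : E.Hom C' C''} {f'' : E.Hom A A''}
      {g'' : E.Hom B B''} {h'' : E.Hom C C''} {Γ₁ : E.Path A B} {Γ₂ : E.Path B C}
      {Γ : E.Path A C} {Δ₁ : E.Path A' B'} {Δ₂ : E.Path B' C'} {Δ : E.Path A' C'}
      {K : E.Pro A'' B''} {Θ : E.Path B'' C''} {R₁ : E.Row f g Γ₁ Δ₁} {R₂ : E.Row g h Γ₂ Δ₂}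
      {R : E.Row f h Γ Δ} (H : R₁.IsAppend R₂ R) (α : E.Cell f' g' Δ₁ K)
      {S : E.Row g' h' Δ₂ Θ} {T : E.Row g'' h'' Γ₂ Θ} (hf : E.vcomp f f' = f'')
      (hg : E.vcomp g g' = g'') (H' : VComp R₂ S T) (e : Δ₁.append Δ₂ = Δ)
      (e' : Γ₁.append Γ₂ = Γ) :
      VComp R (Row.cons α S e) (Row.cons (compTo R₁ α hf hg) T e')

namespace VComp

variable {A B A' B' A'' B'' : E.Obj} {f : E.Hom A A'} {g : E.Hom B B'}
    {f' : E.Hom A' A''} {g' : E.Hom B' B''} {f'' : E.Hom A A''} {g'' : E.Hom B B''}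
    {Γ : E.Path A B} {Δ : E.Path A' B'} {Θ : E.Path A'' B''}
    {R : E.Row f g Γ Δ} {S : E.Row f' g' Δ Θ} {T : E.Row f'' g'' Γ Θ}

theorem left_eq (H : VComp R S T) : E.vcomp f f' = f'' := by
  cases H <;> assumption

theorem right_eq (H : VComp R S T) : E.vcomp g g' = g'' := by
  induction H with
  | nil => assumption
  | cons => assumption

/-- This connects the relation with the towers in which associativity is formulated. The boundary of
`T` is only propositionally the composite boundary, hence the heterogeneous equality. -/
theorem exists_tower (H : VComp R S T) : ∃ τ : E.Tower f f' g g' Γ Δ Θ,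
    τ.top = R ∧ τ.bot = S ∧ VDCData.towerComp τ ≍ T := by
  induction H with
  | nil f f' h => subst h; exact ⟨.nil f f', rfl, rfl, HEq.rfl⟩
  | @cons _ _ _ _ _ _ _ _ _ _ _ _ _ _ _ _ _ _ _ _ _ _ _ _ _ _ R₁ R₂ R H α S T hf hg H' e e' ih =>
    obtain ⟨τ, rfl, rfl, hT⟩ := ih
    obtain rfl := H'.left_eq
    obtain rfl := H'.right_eq
    subst hf
    subst e
    obtain rfl := eq_of_heq hT
    refine ⟨.cons R₁ α τ e' rfl, ?_, rfl, HEq.rfl⟩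
    exact H.append_eq

/-- The associativity axiom, with each boundary arrow a variable constrained by an equation. In this
form it applies without any transport. -/
theorem comp_eq (H : VComp R S T) {A₃ B₃ : E.Obj} {k : E.Hom A'' A₃} {l : E.Hom B'' B₃}
    {K : E.Pro A₃ B₃} (β : E.Cell k l Θ K) {m : E.Hom A' A₃} {n : E.Hom B' B₃}
    {m' : E.Hom A A₃} {n' : E.Hom B B₃}
    (h₁ : E.vcomp f' k = m) (h₂ : E.vcomp g' l = n) (h₃ : E.vcomp f m = m')
    (h₄ : E.vcomp g n = n') (h₅ : E.vcomp f'' k = m') (h₆ : E.vcomp g'' l = n') :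
    compTo R (compTo S β h₁ h₂) h₃ h₄ = compTo T β h₅ h₆ := by
  obtain ⟨τ, rfl, rfl, hT⟩ := H.exists_tower
  obtain rfl := H.left_eq
  obtain rfl := H.right_eq
  obtain rfl := eq_of_heq hT
  subst h₁; subst h₂; subst h₃; subst h₄
  exact (E.lawful.comp_assoc τ β).symm

/-- Precomposing an equation between composites with a row. -/
theorem congr {A₁ B₁ : E.Obj} {k : E.Hom A' A₁} {l : E.Hom B' B₁} {k' : E.Hom A A₁}
    {l' : E.Hom B B₁} {Θ' : E.Path A₁ B₁} {S' : E.Row k l Δ Θ'} {T' : E.Row k' l' Γ Θ'}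
    (H : VComp R S T) (H' : VComp R S' T') {A₂ B₂ : E.Obj} {K : E.Pro A₂ B₂}
    {m : E.Hom A'' A₂} {n : E.Hom B'' B₂} {β : E.Cell m n Θ K} {m' : E.Hom A₁ A₂}
    {n' : E.Hom B₁ B₂} {β' : E.Cell m' n' Θ' K} {x : E.Hom A' A₂} {y : E.Hom B' B₂}
    {h₁ : E.vcomp f' m = x} {h₂ : E.vcomp g' n = y} {h₃ : E.vcomp k m' = x}
    {h₄ : E.vcomp l n' = y} (e : compTo S β h₁ h₂ = compTo S' β' h₃ h₄)
    {x' : E.Hom A A₂} {y' : E.Hom B B₂} (h₅ : E.vcomp f'' m = x') (h₆ : E.vcomp g'' n = y')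
    (h₇ : E.vcomp k' m' = x') (h₈ : E.vcomp l' n' = y') :
    compTo T β h₅ h₆ = compTo T' β' h₇ h₈ := by
  have e₁ : E.vcomp f x = x' := by rw [← h₅, ← H.left_eq, ← h₁, E.lawful.vcomp_assoc]
  have e₂ : E.vcomp g y = y' := by rw [← h₆, ← H.right_eq, ← h₂, E.lawful.vcomp_assoc]
  rw [← H.comp_eq β h₁ h₂ e₁ e₂, e, H'.comp_eq β' h₃ h₄ e₁ e₂]

/-- This lemma and the following ones build vertical composites column by column. The subscript
counts the upper 2-cells of the column; the variants with `id` or `one` in their names normalize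
identities away. -/
theorem cons₁ {C C' C'' : E.Obj} {k : E.Hom C C'} {k' : E.Hom C' C''} {k'' : E.Hom C C''}
    {Γ₀ : E.Path C A} {Γ₁ : E.Path C B} {J : E.Pro C' A'}
    {K : E.Pro C'' A''} (ρ : E.Cell k f Γ₀ J) (α : E.Cell k' f' (ProPath.single J) K)
    (hk : E.vcomp k k' = k'') (hf : E.vcomp f f' = f'') (H : VComp R S T)
    (e : Γ₀.append Γ = Γ₁) (e' : (ProPath.single J).append Δ = ProPath.cons J Δ) :
    VComp (Row.cons ρ R e) (Row.cons α S e')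
      (Row.cons (compTo (Row.single ρ) α hk hf) T e) :=
  .cons (.single ρ R e) α hk hf H e' e

theorem cons_id {C C' : E.Obj} {k : E.Hom C C'} {Γ₀ : E.Path C A} {Γ₁ : E.Path C B}
    {J : E.Pro C' A'} {Θ : E.Path A' B''} {S : E.Row (E.one A') g' Δ Θ} {T : E.Row f g'' Γ Θ}
    (ρ : E.Cell k f Γ₀ J) (H : VComp R S T)
    (e : Γ₀.append Γ = Γ₁) (e' : (ProPath.single J).append Δ = ProPath.cons J Δ) :
    VComp (Row.cons ρ R e) (Row.cons (E.idCell J) S e') (Row.cons ρ T e) := by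
  have := cons₁ ρ (E.idCell J) (E.lawful.vcomp_one k) (E.lawful.vcomp_one f) H e e'
  rwa [compTo_single_idCell] at this

theorem id_cons {C C' : E.Obj} {f : E.Hom A A''} {k : E.Hom C C'} {Γ₁ : E.Path C B}
    {J : E.Pro C A} {K : E.Pro C' A''} {Δ : E.Path A B'} {R : E.Row (E.one A) g Γ Δ}
    {S : E.Row f g' Δ Θ} {T : E.Row f g'' Γ Θ}
    (α : E.Cell k f (ProPath.single J) K) (H : VComp R S T)
    (e : (ProPath.single J).append Γ = Γ₁)
    (e' : (ProPath.single J).append Δ = ProPath.cons J Δ) :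
    VComp (Row.cons (E.idCell J) R e) (Row.cons α S e') (Row.cons α T e) := by
  have := cons₁ (E.idCell J) α (E.lawful.one_vcomp k) (E.lawful.one_vcomp f) H e e'
  rwa [show compTo (Row.single (E.idCell J)) α _ _ = α from compTo_idRow α _ _] at this

theorem cons₂ {C C' C'' D D' : E.Obj} {k : E.Hom C C'} {k' : E.Hom C' C''} {k'' : E.Hom C C''}
    {l : E.Hom D D'} {Γ₀ : E.Path C D} {Γ₁ : E.Path D A} {Γ₂ : E.Path D B} {Γ₃ : E.Path C B}
    {Γ₄ : E.Path C A} {J : E.Pro C' D'} {J' : E.Pro D' A'}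
    {K : E.Pro C'' A''} (ρ : E.Cell k l Γ₀ J) (ρ' : E.Cell l f Γ₁ J')
    (α : E.Cell k' f' (path₂ J J') K)
    (hk : E.vcomp k k' = k'') (hf : E.vcomp f f' = f'') (H : VComp R S T)
    (e₁ : Γ₁.append Γ = Γ₂) (e₂ : Γ₀.append Γ₂ = Γ₃)
    (e₃ : (path₂ J J').append Δ = ProPath.cons J (ProPath.cons J' Δ))
    (e₄ : Γ₄.append Γ = Γ₃) (e₅ : Γ₀.append Γ₁ = Γ₄) :
    VComp (Row.cons ρ (Row.cons ρ' R e₁) e₂) (Row.cons α S e₃)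
      (Row.cons (compTo (Row.cons ρ (Row.single ρ') e₅) α hk hf) T e₄) :=
  .cons (.cons ρ (.single ρ' R e₁) _ _) α hk hf H e₃ e₄

theorem cons₀ {C'' : E.Obj} {k' : E.Hom A' C''} {k'' : E.Hom A C''} {K : E.Pro C'' A''}
    (α : E.Cell k' f' (ProPath.nil A') K) (hk : E.vcomp f k' = k'') (hf : E.vcomp f f' = f'')
    (H : VComp R S T) (e : (ProPath.nil A').append Δ = Δ) (e' : (ProPath.nil A).append Γ = Γ) :
    VComp R (Row.cons α S e) (Row.cons (compTo (Row.nil f) α hk hf) T e') :=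
  .cons (.nil R) α hk hf H e e'

/-- The empty row on an identity arrow is the identity row of the empty list, so a nullary 2-cell
below it is unchanged. -/
theorem cons₀_one {C'' : E.Obj} {f : E.Hom A A''} {k : E.Hom A C''} {K : E.Pro C'' A''}
    {Δ : E.Path A B'} {R : E.Row (E.one A) g Γ Δ} {S : E.Row f g' Δ Θ} {T : E.Row f g'' Γ Θ}
    (α : E.Cell k f (ProPath.nil A) K)
    (H : VComp R S T) (e : (ProPath.nil A).append Δ = Δ) (e' : (ProPath.nil A).append Γ = Γ) :
    VComp R (Row.cons α S e) (Row.cons α T e') := by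
  have := cons₀ α (E.lawful.one_vcomp _) (E.lawful.one_vcomp _) H e e'
  rwa [show compTo (Row.nil (E.one A)) α _ _ = α from compTo_idRow α _ _] at this

theorem idRow_isAppend {A B C : E.Obj} (Γ₁ : E.Path A B) (Γ₂ : E.Path B C) :
    (E.idRow Γ₁).IsAppend (E.idRow Γ₂) (E.idRow (Γ₁.append Γ₂)) := by
  induction Γ₁ with
  | nil A => exact .nil _
  | cons J Γ₁ ih => exact .cons _ (ih Γ₂) rfl rfl

theorem idRow_left (S : E.Row f' g' Δ Θ) : VComp (E.idRow Δ) S S := by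
  induction S with
  | nil f => exact .nil _ _ (E.lawful.one_vcomp f)
  | cons α S e ih =>
    subst e
    have := VComp.cons (idRow_isAppend _ _) α (E.lawful.one_vcomp _) (E.lawful.one_vcomp _) ih
      rfl rfl
    rwa [compTo_idRow] at this

theorem idRow_right (R : E.Row f g Γ Δ) : VComp R (E.idRow Δ) R := by
  induction R with
  | nil f => exact .nil _ _ (E.lawful.vcomp_one f)
  | cons α R e ih => exact cons_id α ih e rfl

theorem single (R : E.Row f g Γ Δ) {K : E.Pro A'' B''} (α : E.Cell f' g' Δ K)
    (hf : E.vcomp f f' = f'') (hg : E.vcomp g g' = g'') :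
    VComp R (Row.single α) (Row.single (compTo R α hf hg)) :=
  .cons (.right_nil R) α hf hg (.nil g g' hg) _ _

end VComp

end VDC

open VDC (VComp)

variable {E : VDC.{u, v, p, c}}

/-! ## Enriched functors compose -/

section

variable {C D : EnrichedCatData.{u, v, p, c, w} E} {F : FunctorData C D}

theorem FunctorData.IsLawful.compTo_map_id (hF : F.IsLawful) (a : C.Obj)
    {f g : E.Hom (C.ext a) (D.ext (F.obj a))}
    (h₁ : E.vcomp (E.one _) (F.arr a) = f) (h₂ : E.vcomp (E.one _) (F.arr a) = g)
    (h₃ : E.vcomp (F.arr a) (E.one _) = f) (h₄ : E.vcomp (F.arr a) (E.one _) = g) :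
    compTo (Row.single (C.id a)) (F.map a a) h₁ h₂ =
      compTo (Row.nil (F.arr a)) (D.id (F.obj a)) h₃ h₄ := by
  subst h₁; subst h₂; exact hF.map_id a

theorem FunctorData.IsLawful.compTo_map_comp (hF : F.IsLawful) (a b d : C.Obj)
    {f : E.Hom (C.ext a) (D.ext (F.obj a))} {g : E.Hom (C.ext d) (D.ext (F.obj d))}
    (h₁ : E.vcomp (E.one _) (F.arr a) = f) (h₂ : E.vcomp (E.one _) (F.arr d) = g)
    (h₃ : E.vcomp (F.arr a) (E.one _) = f) (h₄ : E.vcomp (F.arr d) (E.one _) = g) :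
    compTo (Row.single (C.comp a b d)) (F.map a d) h₁ h₂ =
      compTo (row₂ (F.map a b) (F.map b d)) (D.comp (F.obj a) (F.obj b) (F.obj d)) h₃ h₄ := by
  subst h₁; subst h₂; exact hF.map_comp a b d

theorem FunctorData.one_isLawful (C : EnrichedCatData.{u, v, p, c, w} E) :
    (FunctorData.one C).IsLawful where
  map_id a := VDC.compTo_frame
    ((VDC.compTo_single_idCell (C.id a) (VDC.one_one _) (VDC.one_one _)).trans
      (VDC.compTo_idRow (C.id a) (VDC.one_one _) (VDC.one_one _)).symm) rfl rfl _ _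
  map_comp a b d := VDC.compTo_frame
    ((VDC.compTo_single_idCell (C.comp a b d) (VDC.one_one _) (VDC.one_one _)).trans
      (VDC.compTo_idRow (C.comp a b d) (VDC.one_one _) (VDC.one_one _)).symm) rfl rfl _ _

/-- The law of `F` moves the identity or the composition of `C` below `F`, then the law of `G` moves
it below `G`; associativity regroups in between. -/
theorem FunctorData.vcomp_isLawful {B : EnrichedCatData.{u, v, p, c, w} E} {G : FunctorData D B}
    (hF : F.IsLawful) (hG : G.IsLawful) : (F.vcomp G).IsLawful where
  map_id a := by
    have h := E.lawful.vcomp_one (E.vcomp (F.arr a) (G.arr (F.obj a)))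
    have h' := E.lawful.one_vcomp (E.vcomp (F.arr a) (G.arr (F.obj a)))
    suffices key : compTo (Row.single (C.id a)) (E.comp (Row.single (F.map a a)) (G.map _ _))
        h' h' = compTo (Row.nil (E.vcomp (F.arr a) (G.arr (F.obj a)))) (B.id _) h h from
      VDC.compTo_frame key rfl rfl _ _
    refine ((VComp.single (Row.single (C.id a)) (F.map a a) (E.lawful.one_vcomp _)
      (E.lawful.one_vcomp _)).comp_eq (G.map _ _) rfl rfl h' h' rfl rfl).trans ?_
    rw [hF.compTo_map_id a _ _ (E.lawful.vcomp_one _) (E.lawful.vcomp_one _)]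
    refine ((VComp.single (Row.nil (F.arr a)) (D.id (F.obj a)) (E.lawful.vcomp_one _)
      (E.lawful.vcomp_one _)).comp_eq (G.map _ _) (E.lawful.one_vcomp _) (E.lawful.one_vcomp _)
        rfl rfl rfl rfl).symm.trans ?_
    rw [hG.compTo_map_id (F.obj a) _ _ (E.lawful.vcomp_one _) (E.lawful.vcomp_one _)]
    exact (VComp.nil (F.arr a) (G.arr (F.obj a)) rfl).comp_eq _ _ _ _ _ _ _
  map_comp a b d := by
    suffices key : compTo (Row.single (C.comp a b d))
          (E.comp (Row.single (F.map a d)) (G.map _ _)) (E.lawful.one_vcomp _)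
          (E.lawful.one_vcomp _) =
        compTo (row₂ (E.comp (Row.single (F.map a b)) (G.map _ _))
          (E.comp (Row.single (F.map b d)) (G.map _ _))) (B.comp _ _ _) (E.lawful.vcomp_one _)
          (E.lawful.vcomp_one _) from VDC.compTo_frame key rfl rfl _ _
    refine ((VComp.single (Row.single (C.comp a b d)) (F.map a d) (E.lawful.one_vcomp _)
      (E.lawful.one_vcomp _)).comp_eq (G.map _ _) rfl rfl _ _ rfl rfl).trans ?_
    rw [hF.compTo_map_comp a b d _ _ (E.lawful.vcomp_one _) (E.lawful.vcomp_one _)]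
    refine ((VComp.single (row₂ (F.map a b) (F.map b d)) (D.comp _ _ _) (E.lawful.vcomp_one _)
      (E.lawful.vcomp_one _)).comp_eq (G.map _ _) (E.lawful.one_vcomp _) (E.lawful.one_vcomp _)
        rfl rfl rfl rfl).symm.trans ?_
    rw [hG.compTo_map_comp _ (F.obj b) _ _ _ (E.lawful.vcomp_one _) (E.lawful.vcomp_one _)]
    exact (VComp.cons₁ _ _ rfl rfl (VComp.single _ _ rfl rfl) _ _).comp_eq _ _ _ _ _ _ _

end

/-! ## Generalized elements of lists of profunctors -/

section

/-- A list of objects for a list `Γ` of profunctors, together with a row of 2-cells into the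
resulting list of proarrows. -/
inductive Elem : ∀ {C D : EnrichedCat.{u, v, p, c, w} E} (_ : ProfPath C D) (a : C.Obj)
    (d : D.Obj) {A B : E.Obj} (_ : E.Hom A (C.ext a)) (_ : E.Hom B (D.ext d))
    (_ : E.Path A B), Type (max (max u v p c) (w + 1))
  | nil {C : EnrichedCat.{u, v, p, c, w} E} (a : C.Obj) {A : E.Obj} (f : E.Hom A (C.ext a)) :
      Elem (ProPath.nil C) a a f f (ProPath.nil A)
  | cons {C M D : EnrichedCat.{u, v, p, c, w} E} {J : Prof C M} {Γ : ProfPath M D} (a : C.Obj)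
      {b : M.Obj} {d : D.Obj} {A B Z : E.Obj} {f : E.Hom A (C.ext a)} {g : E.Hom B (M.ext b)}
      {h : E.Hom Z (D.ext d)} {P₁ : E.Path A B} {P₂ : E.Path B Z} {P : E.Path A Z}
      (τ : E.Cell f g P₁ (J.pro a b)) (ω : Elem Γ b d g h P₂) (e : P₁.append P₂ = P) :
      Elem (ProPath.cons J Γ) a d f h P

namespace Elem

variable {C D : EnrichedCat.{u, v, p, c, w} E} {Γ : ProfPath C D} {a : C.Obj} {d : D.Obj}
  {A B : E.Obj} {f : E.Hom A (C.ext a)} {g : E.Hom B (D.ext d)} {P : E.Path A B}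

/-- The list of objects of a generalized element. -/
def objs : ∀ {C D : EnrichedCat.{u, v, p, c, w} E} {Γ : ProfPath C D} {a : C.Obj} {d : D.Obj}
    {A B : E.Obj} {f : E.Hom A (C.ext a)} {g : E.Hom B (D.ext d)} {P : E.Path A B},
    Elem Γ a d f g P → Objs Γ a d
  | _, _, _, _, _, _, _, _, _, _, nil a _ => Objs.nil a
  | _, _, _, _, _, _, _, _, _, _, cons a _ ω _ => Objs.cons a ω.objs

/-- The row of 2-cells of a generalized element. -/
def row : ∀ {C D : EnrichedCat.{u, v, p, c, w} E} {Γ : ProfPath C D} {a : C.Obj} {d : D.Obj}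
    {A B : E.Obj} {f : E.Hom A (C.ext a)} {g : E.Hom B (D.ext d)} {P : E.Path A B}
    (ω : Elem Γ a d f g P), E.Row f g P ω.objs.path
  | _, _, _, _, _, _, _, _, _, _, nil _ f => Row.nil f
  | _, _, _, _, _, _, _, _, _, _, cons _ τ ω e => Row.cons τ ω.row e

/-- Elements present rows by recursion along the list of profunctors, and nothing is lost. Objects
and row are compared as one pair because the type of the row depends on the objects. -/
theorem exists_of_row (x : Objs Γ a d) (ρ : E.Row f g P x.path) :
    ∃ ω : Elem Γ a d f g P,
      (⟨ω.objs, ω.row⟩ : (y : Objs Γ a d) × E.Row f g P y.path) = ⟨x, ρ⟩ := by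
  induction x generalizing A with
  | nil a => cases ρ; exact ⟨nil a _, rfl⟩
  | cons a x ih =>
    obtain ⟨_, _, _, _, α, R, e, rfl⟩ := Row.exists_cons ρ
    obtain ⟨ω, hω⟩ := ih R
    refine ⟨cons a α ω e, ?_⟩
    obtain ⟨rfl, h⟩ := Sigma.mk.inj hω
    obtain rfl := eq_of_heq h
    rfl

/-- `ω` is the concatenation of `ω₁` and `ω₂`. -/
inductive IsAppend : ∀ {C M D : EnrichedCat.{u, v, p, c, w} E} {Γ₁ : ProfPath C M}
    {Γ₂ : ProfPath M D} {Γ : ProfPath C D} {a : C.Obj} {b : M.Obj} {d : D.Obj} {A B Z : E.Obj}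
    {f : E.Hom A (C.ext a)} {g : E.Hom B (M.ext b)} {h : E.Hom Z (D.ext d)}
    {P₁ : E.Path A B} {P₂ : E.Path B Z} {P : E.Path A Z},
    Elem Γ₁ a b f g P₁ → Elem Γ₂ b d g h P₂ → Elem Γ a d f h P → Prop
  | nil {C D : EnrichedCat.{u, v, p, c, w} E} {Γ : ProfPath C D} {a : C.Obj} {d : D.Obj}
      {A B : E.Obj} {f : E.Hom A (C.ext a)} {g : E.Hom B (D.ext d)} {P : E.Path A B}
      (ω : Elem Γ a d f g P) : IsAppend (nil a f) ω ω
  | cons {C N M D : EnrichedCat.{u, v, p, c, w} E} {J : Prof C N} {Γ₁ : ProfPath N M}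
      {Γ₂ : ProfPath M D} {Γ : ProfPath N D} (a : C.Obj) {n : N.Obj} {b : M.Obj} {d : D.Obj}
      {A Y B Z : E.Obj} {f : E.Hom A (C.ext a)} {k : E.Hom Y (N.ext n)} {g : E.Hom B (M.ext b)}
      {h : E.Hom Z (D.ext d)} {P₀ : E.Path A Y} {P₁ : E.Path Y B} {P₂ : E.Path B Z}
      {P : E.Path Y Z} {P₀₁ : E.Path A B} {Q : E.Path A Z}
      (τ : E.Cell f k P₀ (J.pro a n)) {ω₁ : Elem Γ₁ n b k g P₁} {ω₂ : Elem Γ₂ b d g h P₂}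
      {ω : Elem Γ n d k h P} (H : IsAppend ω₁ ω₂ ω) (e : P₀.append P₁ = P₀₁)
      (e' : P₀.append P = Q) :
      IsAppend (cons (J := J) a τ ω₁ e) ω₂ (cons (J := J) a τ ω e')

/-- Each 2-cell of a row has a single proarrow as codomain, so a row into a concatenation can always
be cut; the place of the cut in the domain is part of the result. -/
theorem exists_isAppend {C M D : EnrichedCat.{u, v, p, c, w} E} (Γ₁ : ProfPath C M)
    {Γ₂ : ProfPath M D} {a : C.Obj} {d : D.Obj} {f : E.Hom A (C.ext a)} {g : E.Hom B (D.ext d)}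
    (ω : Elem (Γ₁.append Γ₂) a d f g P) :
    ∃ (b : M.Obj) (Z : E.Obj) (h : E.Hom Z (M.ext b)) (P₁ : E.Path A Z) (P₂ : E.Path Z B)
      (ω₁ : Elem Γ₁ a b f h P₁) (ω₂ : Elem Γ₂ b d h g P₂), IsAppend ω₁ ω₂ ω := by
  induction Γ₁ generalizing A with
  | nil C => exact ⟨a, A, f, _, P, nil a f, ω, .nil ω⟩
  | cons J Γ₁ ih =>
    change Elem (ProPath.cons J (Γ₁.append Γ₂)) a d f g P at ω
    cases ω with
    | cons _ τ ω e =>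
      obtain ⟨b, Z, h, P₁, P₂, ω₁, ω₂, H⟩ := ih ω
      exact ⟨b, Z, h, _, P₂, cons a τ ω₁ rfl, ω₂, .cons a τ H rfl e⟩

theorem IsAppend.top_eq {C M D : EnrichedCat.{u, v, p, c, w} E} {Γ₁ : ProfPath C M}
    {Γ₂ : ProfPath M D} {Γ : ProfPath C D} {a : C.Obj} {b : M.Obj} {d : D.Obj} {A B Z : E.Obj}
    {f : E.Hom A (C.ext a)} {g : E.Hom B (M.ext b)} {h : E.Hom Z (D.ext d)}
    {P₁ : E.Path A B} {P₂ : E.Path B Z} {P : E.Path A Z} {ω₁ : Elem Γ₁ a b f g P₁}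
    {ω₂ : Elem Γ₂ b d g h P₂} {ω : Elem Γ a d f h P} (H : IsAppend ω₁ ω₂ ω) :
    P₁.append P₂ = P := by
  induction H with
  | nil => rfl
  | cons a τ H e e' ih => subst e; subst e'; subst ih; exact ProPath.append_assoc _ _ _

theorem IsAppend.row {C M D : EnrichedCat.{u, v, p, c, w} E} {Γ₁ : ProfPath C M}
    {Γ₂ : ProfPath M D} {Γ : ProfPath C D} {a : C.Obj} {b : M.Obj} {d : D.Obj} {A B Z : E.Obj}
    {f : E.Hom A (C.ext a)} {g : E.Hom B (M.ext b)} {h : E.Hom Z (D.ext d)}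
    {P₁ : E.Path A B} {P₂ : E.Path B Z} {P : E.Path A Z} {ω₁ : Elem Γ₁ a b f g P₁}
    {ω₂ : Elem Γ₂ b d g h P₂} {ω : Elem Γ a d f h P} (H : IsAppend ω₁ ω₂ ω) :
    ω₁.row.IsAppend ω₂.row ω.row := by
  induction H with
  | nil => exact .nil _
  | cons a τ H e e' ih => exact .cons τ ih e e'

end Elem

end

/-! ## Actions on generalized elements -/

/-- The action of a generalized element of a hom on a generalized element of a profunctor. -/
abbrev ProfData.lact {C D : EnrichedCatData.{u, v, p, c, w} E} (J : ProfData C D) {a a' : C.Obj}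
    {d : D.Obj} {A B Z : E.Obj} {f : E.Hom A (C.ext a)} {g : E.Hom B (C.ext a')}
    {h : E.Hom Z (D.ext d)} {P : E.Path A B} {Q : E.Path B Z} {R : E.Path A Z}
    (σ : E.Cell f g P (C.hom a a')) (τ : E.Cell g h Q (J.pro a' d)) (e : P.append Q = R) :
    E.Cell f h R (J.pro a d) :=
  compTo (Row.cons σ (Row.single τ) e) (J.actL a a' d) (E.lawful.vcomp_one f)
    (E.lawful.vcomp_one h)

/-- The action of a generalized element of a hom on a generalized element of a profunctor. -/
abbrev ProfData.ract {C D : EnrichedCatData.{u, v, p, c, w} E} (J : ProfData C D) {a : C.Obj}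
    {d d' : D.Obj} {A B Z : E.Obj} {f : E.Hom A (C.ext a)} {g : E.Hom B (D.ext d)}
    {h : E.Hom Z (D.ext d')} {P : E.Path A B} {Q : E.Path B Z} {R : E.Path A Z}
    (τ : E.Cell f g P (J.pro a d)) (σ : E.Cell g h Q (D.hom d d')) (e : P.append Q = R) :
    E.Cell f h R (J.pro a d') :=
  compTo (Row.cons τ (Row.single σ) e) (J.actR a d d') (E.lawful.vcomp_one f)
    (E.lawful.vcomp_one h)

/-- The image of a generalized element of a hom under a functor. -/
abbrev FunctorData.on {C D : EnrichedCatData.{u, v, p, c, w} E} (F : FunctorData C D)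
    {a a' : C.Obj} {A B : E.Obj} {f : E.Hom A (C.ext a)} {g : E.Hom B (C.ext a')}
    {P : E.Path A B} (σ : E.Cell f g P (C.hom a a')) :
    E.Cell (E.vcomp f (F.arr a)) (E.vcomp g (F.arr a')) P (D.hom (F.obj a) (F.obj a')) :=
  E.comp (Row.single σ) (F.map a a')

/-- The value of a family of 2-cells at a generalized element. -/
abbrev MorData.eval {C D C' D' : EnrichedCat.{u, v, p, c, w} E}
    {F : FunctorData C.toEnrichedCatData C'.toEnrichedCatData}
    {G : FunctorData D.toEnrichedCatData D'.toEnrichedCatData}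
    {Γ : ProfPath C D} {K : ProfData C'.toEnrichedCatData D'.toEnrichedCatData}
    (α : MorData F G Γ K) {a : C.Obj} {d : D.Obj} {A B : E.Obj} {f : E.Hom A (C.ext a)}
    {g : E.Hom B (D.ext d)} {P : E.Path A B} (ω : Elem Γ a d f g P) :
    E.Cell (E.vcomp f (F.arr a)) (E.vcomp g (G.arr d)) P (K.pro (F.obj a) (G.obj d)) :=
  E.comp ω.row (α.app ω.objs)

namespace Elem

/-- A generalized element of a hom of the first category acts on the first component. -/
inductive LAct : ∀ {C D : EnrichedCat.{u, v, p, c, w} E} {Γ : ProfPath C D} {a a' : C.Obj}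
    {d : D.Obj} {A B Z : E.Obj} {f : E.Hom A (C.ext a)} {g : E.Hom B (C.ext a')}
    {h : E.Hom Z (D.ext d)} {P : E.Path A B} {Q : E.Path B Z} {R : E.Path A Z}
    (_ : E.Cell f g P (C.hom a a')) (_ : Elem Γ a' d g h Q) (_ : Elem Γ a d f h R), Prop
  | mk {C M D : EnrichedCat.{u, v, p, c, w} E} {J : Prof C M} {Γ : ProfPath M D} {a a' : C.Obj}
      {b : M.Obj} {d : D.Obj} {A B X Z : E.Obj} {f : E.Hom A (C.ext a)}
      {g : E.Hom B (C.ext a')} {k : E.Hom X (M.ext b)} {h : E.Hom Z (D.ext d)} {P : E.Path A B}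
      {P₁ : E.Path B X} {P₂ : E.Path X Z} {P₁₂ : E.Path B Z} {Q : E.Path A X} {R : E.Path A Z}
      (σ : E.Cell f g P (C.hom a a')) (τ : E.Cell g k P₁ (J.pro a' b))
      (ω : Elem Γ b d k h P₂) (e : P₁.append P₂ = P₁₂) (e' : P.append P₁ = Q)
      (e'' : Q.append P₂ = R) :
      LAct σ (cons (J := J) a' τ ω e) (cons (J := J) a (J.lact σ τ e') ω e'')

/-- A generalized element of a hom of the last category acts on the last component. -/
inductive RAct : ∀ {C D : EnrichedCat.{u, v, p, c, w} E} {Γ : ProfPath C D} {a : C.Obj}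
    {d d' : D.Obj} {A B Z : E.Obj} {f : E.Hom A (C.ext a)} {g : E.Hom B (D.ext d)}
    {h : E.Hom Z (D.ext d')} {P : E.Path A B} {Q : E.Path B Z} {R : E.Path A Z}
    (_ : Elem Γ a d f g P) (_ : E.Cell g h Q (D.hom d d')) (_ : Elem Γ a d' f h R), Prop
  | last {C D : EnrichedCat.{u, v, p, c, w} E} {J : Prof C D} {a : C.Obj} {d d' : D.Obj}
      {A B Z : E.Obj} {f : E.Hom A (C.ext a)} {g : E.Hom B (D.ext d)}
      {h : E.Hom Z (D.ext d')} {P P' : E.Path A B} {Q : E.Path B Z} {R R' : E.Path A Z}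
      (τ : E.Cell f g P (J.pro a d)) (σ : E.Cell g h Q (D.hom d d'))
      (e : P.append (ProPath.nil B) = P') (e' : P.append Q = R)
      (e'' : R.append (ProPath.nil Z) = R') :
      RAct (cons (J := J) a τ (nil d g) e) σ (cons (J := J) a (J.ract τ σ e') (nil d' h) e'')
  | there {C M D : EnrichedCat.{u, v, p, c, w} E} {J : Prof C M} {Γ : ProfPath M D} {a : C.Obj}
      {b : M.Obj} {d d' : D.Obj} {A B X Z : E.Obj} {f : E.Hom A (C.ext a)}
      {g : E.Hom B (M.ext b)} {k : E.Hom X (D.ext d)} {h : E.Hom Z (D.ext d')} {P : E.Path A B}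
      {P₁ : E.Path B X} {Q : E.Path X Z} {P₂ : E.Path B Z} {R : E.Path A X} {R' : E.Path A Z}
      (τ : E.Cell f g P (J.pro a b)) {ω : Elem Γ b d g k P₁} {σ : E.Cell k h Q (D.hom d d')}
      {ω' : Elem Γ b d' g h P₂} (H : RAct ω σ ω') (e : P.append P₁ = R)
      (e' : P.append P₂ = R') :
      RAct (cons (J := J) a τ ω e) σ (cons (J := J) a τ ω' e')

/-- A generalized element of a hom of an intermediate category is moved from the component before
it to the component after it. -/
inductive IAct : ∀ {C D : EnrichedCat.{u, v, p, c, w} E} {Γ : ProfPath C D} {a : C.Obj}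
    {d : D.Obj} {A B : E.Obj} {f : E.Hom A (C.ext a)} {g : E.Hom B (D.ext d)}
    {P : E.Path A B} (_ : Elem Γ a d f g P) (_ : Elem Γ a d f g P), Prop
  | here {C M N D : EnrichedCat.{u, v, p, c, w} E} {J : Prof C M} {J' : Prof M N}
      {Γ : ProfPath N D} {a : C.Obj} {b b' : M.Obj} {n : N.Obj} {d : D.Obj} {A B X Y Z : E.Obj}
      {f : E.Hom A (C.ext a)} {g : E.Hom B (M.ext b)} {h : E.Hom X (M.ext b')}
      {k : E.Hom Y (N.ext n)} {l : E.Hom Z (D.ext d)} {P₁ : E.Path A B} {P₂ : E.Path B X}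
      {P₃ : E.Path X Y} {P₄ : E.Path Y Z} {P₁₂ : E.Path A X} {P₂₃ : E.Path B Y}
      {P₃₄ : E.Path X Z} {Q : E.Path B Z} {P : E.Path A Z}
      (τ : E.Cell f g P₁ (J.pro a b)) (σ : E.Cell g h P₂ (M.hom b b'))
      (τ' : E.Cell h k P₃ (J'.pro b' n)) (ω : Elem Γ n d k l P₄) (e₁ : P₁.append P₂ = P₁₂)
      (e₂ : P₃.append P₄ = P₃₄) (e₃ : P₁₂.append P₃₄ = P) (e₄ : P₂.append P₃ = P₂₃)
      (e₅ : P₂₃.append P₄ = Q) (e₆ : P₁.append Q = P) :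
      IAct (cons (J := J) a (J.ract τ σ e₁) (cons (J := J') b' τ' ω e₂) e₃)
        (cons (J := J) a τ (cons (J := J') b (J'.lact σ τ' e₄) ω e₅) e₆)
  | there {C M D : EnrichedCat.{u, v, p, c, w} E} {J : Prof C M} {Γ : ProfPath M D} {a : C.Obj}
      {b : M.Obj} {d : D.Obj} {A B Z : E.Obj} {f : E.Hom A (C.ext a)} {g : E.Hom B (M.ext b)}
      {h : E.Hom Z (D.ext d)} {P : E.Path A B} {Q : E.Path B Z} {R : E.Path A Z}
      (τ : E.Cell f g P (J.pro a b)) {ω ω' : Elem Γ b d g h Q} (H : IAct ω ω')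
      (e : P.append Q = R) : IAct (cons (J := J) a τ ω e) (cons (J := J) a τ ω' e)

/-- The equivalence relation generated by the actions of the intermediate categories. -/
abbrev Rel {C D : EnrichedCat.{u, v, p, c, w} E} {Γ : ProfPath C D} {a : C.Obj}
    {d : D.Obj} {A B : E.Obj} {f : E.Hom A (C.ext a)} {g : E.Hom B (D.ext d)}
    {P : E.Path A B} : Elem Γ a d f g P → Elem Γ a d f g P → Prop :=
  Relation.EqvGen IAct

theorem Rel.cons {C M D : EnrichedCat.{u, v, p, c, w} E} {J : Prof C M} {Γ : ProfPath M D}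
    {a : C.Obj} {b : M.Obj} {d : D.Obj} {A B Z : E.Obj} {f : E.Hom A (C.ext a)}
    {g : E.Hom B (M.ext b)} {h : E.Hom Z (D.ext d)} {P : E.Path A B} {Q : E.Path B Z}
    {R : E.Path A Z} (τ : E.Cell f g P (J.pro a b)) {ω ω' : Elem Γ b d g h Q} (H : Rel ω ω')
    (e : P.append Q = R) : Rel (Elem.cons (J := J) a τ ω e) (Elem.cons (J := J) a τ ω' e) := by
  induction H with
  | rel _ _ H => exact .rel _ _ (.there τ H e)
  | refl => exact .refl _
  | symm _ _ _ ih => exact .symm _ _ ih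
  | trans _ _ _ _ _ ih ih' => exact .trans _ _ _ ih ih'

section Inversion

variable {C M D : EnrichedCat.{u, v, p, c, w} E} {Γ₁ : ProfPath C M}
    {Γ₂ : ProfPath M D} {Γ : ProfPath C D} {a : C.Obj} {b : M.Obj} {d : D.Obj} {A B Z : E.Obj}
    {f : E.Hom A (C.ext a)} {g : E.Hom B (M.ext b)} {h : E.Hom Z (D.ext d)}
    {P₁ : E.Path A B} {P₂ : E.Path B Z} {P : E.Path A Z} {ω₁ : Elem Γ₁ a b f g P₁}
    {ω₂ : Elem Γ₂ b d g h P₂} {ω : Elem Γ a d f h P}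

theorem LAct.top_eq {C D : EnrichedCat.{u, v, p, c, w} E} {Γ : ProfPath C D} {a a' : C.Obj}
    {d : D.Obj} {A B Z : E.Obj} {f : E.Hom A (C.ext a)} {g : E.Hom B (C.ext a')}
    {h : E.Hom Z (D.ext d)} {P : E.Path A B} {Q : E.Path B Z} {R : E.Path A Z}
    {σ : E.Cell f g P (C.hom a a')} {ω : Elem Γ a' d g h Q} {ω' : Elem Γ a d f h R}
    (H : LAct σ ω ω') : P.append Q = R := by
  cases H with
  | mk σ τ ω e e' e'' => subst e; subst e'; subst e''; exact (ProPath.append_assoc _ _ _).symm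

theorem RAct.top_eq {C D : EnrichedCat.{u, v, p, c, w} E} {Γ : ProfPath C D} {a : C.Obj}
    {d d' : D.Obj} {A B Z : E.Obj} {f : E.Hom A (C.ext a)} {g : E.Hom B (D.ext d)}
    {h : E.Hom Z (D.ext d')} {P : E.Path A B} {Q : E.Path B Z} {R : E.Path A Z}
    {ω : Elem Γ a d f g P} {σ : E.Cell g h Q (D.hom d d')} {ω' : Elem Γ a d' f h R}
    (H : RAct ω σ ω') : P.append Q = R := by
  induction H with
  | last τ σ e e' e'' =>
    subst e; subst e'; subst e''; rw [ProPath.append_nil, ProPath.append_nil]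
  | there τ H e e' ih => subst e; subst ih; subst e'; exact ProPath.append_assoc _ _ _

/-- A move involves two adjacent components: both before the cut, both after it, or one on each
side. In the last case `ω₁` is `ω₁'` acted on by `σ` and `ω₂'` is `σ` acting on `ω₂`, so that the
cut itself moves from `b` to `b'`. -/
theorem IAct.of_isAppend (H : IsAppend ω₁ ω₂ ω) {ω' : Elem Γ a d f h P} (H' : IAct ω ω') :
    (∃ ω₁' : Elem Γ₁ a b f g P₁, IAct ω₁ ω₁' ∧ IsAppend ω₁' ω₂ ω') ∨
    (∃ ω₂' : Elem Γ₂ b d g h P₂, IAct ω₂ ω₂' ∧ IsAppend ω₁ ω₂' ω') ∨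
    (∃ (b' : M.Obj) (X : E.Obj) (k : E.Hom X (M.ext b')) (Q₁ : E.Path A X) (Q : E.Path X B)
      (Q₂ : E.Path X Z) (ω₁' : Elem Γ₁ a b' f k Q₁) (σ : E.Cell k g Q (M.hom b' b))
      (ω₂' : Elem Γ₂ b' d k h Q₂), RAct ω₁' σ ω₁ ∧ LAct σ ω₂ ω₂' ∧ IsAppend ω₁' ω₂' ω') := by
  induction H with
  | nil ω => exact .inr (.inl ⟨ω', H', .nil _⟩)
  | cons a τ H e e' ih =>
    cases H' with
    | there τ H' =>
      rcases ih H' with ⟨ω₁', h₁, h₂⟩ | ⟨ω₂', h₁, h₂⟩ | ⟨b', X, k, Q₁, Q, Q₂, ω₁', σ, ω₂', h₁, h₂, h₃⟩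
      · exact .inl ⟨_, .there τ h₁ e, .cons a τ h₂ e e'⟩
      · exact .inr (.inl ⟨_, h₁, .cons a τ h₂ e e'⟩)
      · exact .inr (.inr ⟨b', X, k, _, Q, Q₂, _, σ, ω₂', .there τ h₁ rfl e, h₂,
          .cons a τ h₃ rfl _⟩)
    | here τ σ τ' ω e₁ e₂ e₃ e₄ e₅ e₆ =>
      cases H with
      | nil =>
        exact .inr (.inr ⟨_, _, _, _, _, _, _, σ, _, .last τ σ rfl e₁ e, .mk σ τ' ω e₂ e₄ e₅,
          .cons a τ (.nil _) _ _⟩)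
      | cons b τ' H e₇ e₈ =>
        refine .inl ⟨_, .here τ σ τ' _ e₁ e₇ e e₄ rfl ?_, .cons a τ (.cons _ _ H _ _) _ _⟩
        subst e₁; subst e₄; subst e₇; subst e
        rw [ProPath.append_assoc, ProPath.append_assoc]

theorem LAct.of_isAppend_cons {N : EnrichedCat.{u, v, p, c, w} E} {J : Prof C N}
    {Γ₁ : ProfPath N M} {ω₁ : Elem (ProPath.cons J Γ₁) a b f g P₁} (H : IsAppend ω₁ ω₂ ω)
    {a' : C.Obj} {X : E.Obj} {k : E.Hom X (C.ext a')} {Q : E.Path A X} {R : E.Path X Z}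
    {σ : E.Cell f k Q (C.hom a a')} {ω' : Elem Γ a' d k h R} (H' : LAct σ ω' ω) :
    ∃ (R₁ : E.Path X B) (ω₁' : Elem (ProPath.cons J Γ₁) a' b k g R₁),
      LAct σ ω₁' ω₁ ∧ IsAppend ω₁' ω₂ ω' := by
  cases H with
  | cons a τ H e e' =>
    cases H' with
    | mk σ τ ω e₁ e₂ e₃ =>
      refine ⟨_, _, .mk σ τ _ rfl e₂ e, .cons a' τ H _ _⟩

/-- The case of `RAct.of_isAppend` in which the second list is empty. -/
inductive RAct.OfNil : ∀ {C M D : EnrichedCat.{u, v, p, c, w} E} {Γ₁ : ProfPath C M}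
    {Γ₂ : ProfPath M D} {Γ : ProfPath C D} {a : C.Obj} {b : M.Obj} {d d' : D.Obj}
    {A B X Z : E.Obj} {f : E.Hom A (C.ext a)} {g : E.Hom B (M.ext b)} {h : E.Hom Z (D.ext d)}
    {k : E.Hom X (D.ext d')} {P₁ : E.Path A B} {P₂ : E.Path B Z} {Q : E.Path X Z}
    {R : E.Path A X} (_ : Elem Γ₁ a b f g P₁) (_ : Elem Γ₂ b d g h P₂)
    (_ : E.Cell k h Q (D.hom d' d)) (_ : Elem Γ a d' f k R), Prop
  | mk {C D : EnrichedCat.{u, v, p, c, w} E} {Γ₁ Γ : ProfPath C D} {a : C.Obj} {d d' : D.Obj}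
      {A X Z : E.Obj} {f : E.Hom A (C.ext a)} {h : E.Hom Z (D.ext d)} {k : E.Hom X (D.ext d')}
      {P₁ : E.Path A Z} {Q : E.Path X Z} {R R₁ : E.Path A X} {ω₁ : Elem Γ₁ a d f h P₁}
      {ω₁' : Elem Γ₁ a d' f k R₁} {σ : E.Cell k h Q (D.hom d' d)} {ω' : Elem Γ a d' f k R}
      (H : RAct ω₁' σ ω₁) (H' : IsAppend ω₁' (nil d' k) ω') : OfNil ω₁ (nil d h) σ ω'

/-- The last component lies in the second part unless that part is empty. Then the categories and
objects at the cut and at the end coincide, which `OfNil` records through its indices rather than by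
casts. -/
theorem RAct.of_isAppend (H : IsAppend ω₁ ω₂ ω)
    {d' : D.Obj} {X : E.Obj} {k : E.Hom X (D.ext d')} {Q : E.Path X Z} {R : E.Path A X}
    {σ : E.Cell k h Q (D.hom d' d)} {ω' : Elem Γ a d' f k R} (H' : RAct ω' σ ω) :
    (∃ (R₂ : E.Path B X) (ω₂' : Elem Γ₂ b d' g k R₂), RAct ω₂' σ ω₂ ∧ IsAppend ω₁ ω₂' ω') ∨
      RAct.OfNil ω₁ ω₂ σ ω' := by
  induction H with
  | nil ω => exact .inl ⟨_, _, H', .nil _⟩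
  | cons a τ H e e' ih =>
    cases H' with
    | there τ H' =>
      rcases ih H' with ⟨R₂, ω₂', h₁, h₂⟩ | ⟨h₁, h₂⟩
      · exact .inl ⟨R₂, ω₂', h₁, .cons a τ h₂ e _⟩
      · exact .inr ⟨.there τ h₁ rfl e, .cons _ τ h₂ rfl _⟩
    | last τ σ e₁ e₂ e₃ =>
      cases H
      exact .inr ⟨.last τ σ e₁ e₂ _, .cons a τ (.nil _) _ _⟩

end Inversion

end Elem

/-! ## The laws of a morphism of profunctors, on generalized elements -/

/-- Before `σ` has acted on anything there is one common row, with `τ`, `σ` and `τ'` side by side.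
Composing it with the two action rows of `InnerAct` gives the two elements. -/
theorem Elem.IAct.exists_innerAct {C D : EnrichedCat.{u, v, p, c, w} E} {Γ : ProfPath C D}
    {a : C.Obj} {d : D.Obj} {A B : E.Obj} {f : E.Hom A (C.ext a)} {g : E.Hom B (D.ext d)}
    {P : E.Path A B} {ω ω' : Elem Γ a d f g P} (H : ω.IAct ω') :
    ∃ (Q : E.Path (C.ext a) (D.ext d)) (π : E.Row f g P Q)
      (R : E.Row (E.one (C.ext a)) (E.one (D.ext d)) Q ω.objs.path)
      (R' : E.Row (E.one (C.ext a)) (E.one (D.ext d)) Q ω'.objs.path),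
      InnerAct ω.objs ω'.objs R R' ∧ VComp π R ω.row ∧ VComp π R' ω'.row := by
  induction H with
  | @here C M N D J J' Γ a b b' n d _ _ _ _ _ _ _ _ _ _ P₁ P₂ P₃ P₄ P₁₂ P₂₃ P₃₄ Q P τ σ τ' ω e₁ e₂ e₃ e₄ e₅ e₆ =>
    have e : P₁.append (P₂.append P₃₄) = P := by
      subst e₁; subst e₂; subst e₃; rw [ProPath.append_assoc]
    refine ⟨_, Row.cons τ (Row.cons σ (Row.cons τ' ω.row e₂) rfl) e, _, _,
      .here J J' a b b' ω.objs, ?_, ?_⟩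
    · exact VComp.cons₂ τ σ _ _ _ (VComp.cons_id τ' (VComp.idRow_right _) _ _) _ _ _ _ _
    · have h : VComp (Row.cons σ (Row.cons τ' ω.row e₂) rfl)
          (Row.cons (J'.actL b b' n) (E.idRow ω.objs.path) rfl)
          (Row.cons (J'.lact σ τ' e₄) ω.row (e₅.trans (by
            subst e₂; subst e₄; subst e₅; rw [ProPath.append_assoc]))) :=
        VComp.cons₂ σ τ' _ _ _ (VComp.idRow_right _) _ _ _ _ _
      have e₇ : Q = P₂.append P₃₄ := by
        subst e₂; subst e₄; subst e₅; rw [ProPath.append_assoc]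
      subst e₇
      exact VComp.cons_id τ h _ _
  | there τ H e ih =>
    obtain ⟨Q, π, R, R', h, h₁, h₂⟩ := ih
    exact ⟨_, Row.cons τ π e, _, _, .there _ _ h, VComp.cons_id τ h₁ _ _, VComp.cons_id τ h₂ _ _⟩

theorem Elem.RAct.exists_rightAct {C D : EnrichedCat.{u, v, p, c, w} E} {Γ : ProfPath C D}
    {a : C.Obj} {d d' : D.Obj} {A B Z : E.Obj} {f : E.Hom A (C.ext a)} {g : E.Hom B (D.ext d)}
    {h : E.Hom Z (D.ext d')} {P : E.Path A B} {Q : E.Path B Z} {R : E.Path A Z}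
    {ω : Elem Γ a d f g P} {σ : E.Cell g h Q (D.hom d d')} {ω' : Elem Γ a d' f h R}
    (H : ω.RAct σ ω') :
    ∃ (π : E.Row f h R (ω.objs.path.append (ProPath.single (D.hom d d'))))
      (S : E.Row (E.one (C.ext a)) (E.one (D.ext d'))
        (ω.objs.path.append (ProPath.single (D.hom d d'))) ω'.objs.path),
      ω.row.IsAppend (Row.single σ) π ∧ RightAct ω.objs ω'.objs S ∧ VComp π S ω'.row := by
  induction H with
  | @last _ _ J a d d' _ _ _ _ _ _ _ _ _ _ _ τ σ e e' e'' =>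
    rw [ProPath.append_nil] at e''; subst e''
    refine ⟨Row.cons τ (Row.single σ) e', Row.single (J.actR a d d'), .cons τ (.nil _) _ _,
      .last J a d d', VComp.single _ _ _ _⟩
  | there τ H e e' ih =>
    obtain ⟨π, S, h₁, h₂, h₃⟩ := ih
    exact ⟨_, _, .cons τ h₁ _ e', .there _ _ h₂, VComp.cons_id τ h₃ _ _⟩

namespace MorData.IsLawful

variable {C D C' D' : EnrichedCat.{u, v, p, c, w} E}
    {F : FunctorData C.toEnrichedCatData C'.toEnrichedCatData}
    {G : FunctorData D.toEnrichedCatData D'.toEnrichedCatData}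
    {Γ : ProfPath C D} {K : ProfData C'.toEnrichedCatData D'.toEnrichedCatData}
    {α : MorData F G Γ K}

/-- Here and in the next lemmas, a law of `α` is precomposed with the row of 2-cells that underlies
the given elements. -/
theorem eval_iact (hα : α.IsLawful) {a : C.Obj} {d : D.Obj} {A B : E.Obj} {f : E.Hom A (C.ext a)}
    {g : E.Hom B (D.ext d)} {P : E.Path A B} {ω ω' : Elem Γ a d f g P} (H : ω.IAct ω') :
    α.eval ω = α.eval ω' := by
  obtain ⟨Q, π, R, R', h, h₁, h₂⟩ := H.exists_innerAct
  exact h₁.congr h₂ (β := α.app _) (β' := α.app _) (h₁ := rfl) (h₂ := rfl) (h₃ := rfl)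
    (h₄ := rfl) (hα.inner h) rfl rfl rfl rfl

theorem eval_rel (hα : α.IsLawful) {a : C.Obj} {d : D.Obj} {A B : E.Obj} {f : E.Hom A (C.ext a)}
    {g : E.Hom B (D.ext d)} {P : E.Path A B} {ω ω' : Elem Γ a d f g P} (H : ω.Rel ω') :
    α.eval ω = α.eval ω' := by
  induction H with
  | rel _ _ H => exact hα.eval_iact H
  | refl => rfl
  | symm _ _ _ ih => exact ih.symm
  | trans _ _ _ _ _ ih ih' => exact ih.trans ih'

theorem eval_lact (hα : α.IsLawful) {a a' : C.Obj}
    {d : D.Obj} {A B Z : E.Obj} {f : E.Hom A (C.ext a)} {g : E.Hom B (C.ext a')}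
    {h : E.Hom Z (D.ext d)} {P : E.Path A B} {Q : E.Path B Z} {R : E.Path A Z}
    {σ : E.Cell f g P (C.hom a a')} {ω : Elem Γ a' d g h Q} {ω' : Elem Γ a d f h R}
    (H : ω.LAct σ ω') (e : P.append Q = R) :
    α.eval ω' = K.lact (F.on σ) (α.eval ω) e := by
  cases H with
  | @mk _ M J Γ _ _ b _ _ _ _ _ _ _ _ _ _ _ _ _ _ _ σ τ ω e₁ e₂ e₃ =>
    have law := hα.left (LeftAct.mk J a a' ω.objs)
    have h₁ : VComp (Row.cons σ (Row.cons τ ω.row e₁) e)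
        (Row.cons (J.actL a a' b) (E.idRow ω.objs.path) rfl)
        (Row.cons (J.lact σ τ e₂) ω.row e₃) :=
      VComp.cons₂ _ _ _ _ _ (VComp.idRow_right _) _ _ _ _ _
    have h₂ : VComp (Row.cons σ (Row.cons τ ω.row e₁) e)
        (row₂ (F.map a a') (α.app (Objs.cons (J := J) a' ω.objs)))
        (Row.cons (F.on σ) (Row.single (α.eval (.cons (J := J) a' τ ω e₁))) e) :=
      VComp.cons₁ _ _ rfl rfl (VComp.single _ _ rfl rfl) _ _
    exact h₁.congr h₂ (β := α.app (Objs.cons (J := J) a ω.objs)) (h₁ := rfl) (h₂ := rfl) law rfl rfl _ _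

theorem eval_ract (hα : α.IsLawful) {a : C.Obj}
    {d d' : D.Obj} {A B Z : E.Obj} {f : E.Hom A (C.ext a)} {g : E.Hom B (D.ext d)}
    {h : E.Hom Z (D.ext d')} {P : E.Path A B} {Q : E.Path B Z} {R : E.Path A Z}
    {ω : Elem Γ a d f g P} {σ : E.Cell g h Q (D.hom d d')} {ω' : Elem Γ a d' f h R}
    (H : ω.RAct σ ω') (e : P.append Q = R) :
    α.eval ω' = K.ract (α.eval ω) (G.on σ) e := by
  obtain ⟨π, S, h₀, h₁, h₂⟩ := H.exists_rightAct
  have law := hα.right h₁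
  have h₃ : VComp π (row₂ (α.app ω.objs) (G.map d d'))
      (Row.cons (α.eval ω) (Row.single (G.on σ)) e) :=
    .cons h₀ _ rfl rfl (VComp.single _ _ rfl rfl) _ _
  exact h₂.congr h₃ (β := α.app _) (h₁ := rfl) (h₂ := rfl) law rfl rfl _ _

theorem eval_empty {C C' D' : EnrichedCat.{u, v, p, c, w} E}
    {F : FunctorData C.toEnrichedCatData C'.toEnrichedCatData}
    {G : FunctorData C.toEnrichedCatData D'.toEnrichedCatData}
    {K : ProfData C'.toEnrichedCatData D'.toEnrichedCatData}
    {α : MorData F G (ProPath.nil C) K} (hα : α.IsLawful) {a a' : C.Obj}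
    {A B : E.Obj} {f : E.Hom A (C.ext a)} {g : E.Hom B (C.ext a')} {P : E.Path A B}
    (σ : E.Cell f g P (C.hom a a')) (e : P.append (ProPath.nil B) = P)
    (e' : (ProPath.nil A).append P = P) :
    K.lact (F.on σ) (α.eval (.nil a' g)) e = K.ract (α.eval (.nil a f)) (G.on σ) e' := by
  have law := hα.empty (EmptyAct.mk a a')
  have h₁ : VComp (Row.single σ)
      (Row.cons (F.map a a') (Row.single (α.app (Objs.nil a'))) rfl)
      (Row.cons (F.on σ) (Row.single (α.eval (.nil a' g))) e) :=
    VComp.cons₁ _ _ rfl rfl (VComp.single _ _ rfl rfl) _ _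
  have h₂ : VComp (Row.single σ)
      (Row.cons (α.app (Objs.nil a)) (Row.single (G.map a a')) rfl)
      (Row.cons (α.eval (.nil a f)) (Row.single (G.on σ)) e') :=
    VComp.cons₀ _ rfl rfl (VComp.single _ _ rfl rfl) _ _
  exact h₁.congr h₂ (β := K.actL _ _ _) (β' := K.actR _ _ _) (h₁ := rfl) (h₂ := rfl)
    (h₃ := rfl) (h₄ := rfl) law _ _ _ _

end MorData.IsLawful

/-! ## Morphisms of profunctors compose -/

namespace Elem

/-- `T` is the image of the generalized element `ω` under a row of morphisms of profunctors. -/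
inductive Push : ∀ {C D C' D' : EnrichedCat.{u, v, p, c, w} E} {F : EFunctor C C'}
    {G : EFunctor D D'} {Γ : ProfPath C D} {Δ : ProfPath C' D'}
    (_ : (VCatSig.{u, v, p, c, w} E).Row F G Γ Δ) {a : C.Obj} {d : D.Obj} {A B : E.Obj}
    {f : E.Hom A (C.ext a)} {g : E.Hom B (D.ext d)} {P : E.Path A B} (_ : Elem Γ a d f g P)
    (_ : Elem Δ (F.obj a) (G.obj d) (E.vcomp f (F.arr a)) (E.vcomp g (G.arr d)) P), Prop
  | nil {C C' : EnrichedCat.{u, v, p, c, w} E} (F : EFunctor C C') (a : C.Obj) {A : E.Obj}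
      (f : E.Hom A (C.ext a)) :
      Push (Row.nil F) (Elem.nil a f) (Elem.nil (F.obj a) (E.vcomp f (F.arr a)))
  | cons {C M D C' M' D' : EnrichedCat.{u, v, p, c, w} E} {F : EFunctor C C'}
      {H : EFunctor M M'} {G : EFunctor D D'} {Γ₁ : ProfPath C M} {Γ₂ : ProfPath M D}
      {Γ : ProfPath C D} {K : Prof C' M'} {Δ : ProfPath M' D'} (α : Mor F H Γ₁ K)
      {R : (VCatSig.{u, v, p, c, w} E).Row H G Γ₂ Δ} (e : Γ₁.append Γ₂ = Γ) {a : C.Obj}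
      {b : M.Obj} {d : D.Obj} {A B Z : E.Obj} {f : E.Hom A (C.ext a)} {h : E.Hom B (M.ext b)}
      {g : E.Hom Z (D.ext d)} {P₁ : E.Path A B} {P₂ : E.Path B Z} {P : E.Path A Z}
      {ω₁ : Elem Γ₁ a b f h P₁} {ω₂ : Elem Γ₂ b d h g P₂} {ω : Elem Γ a d f g P}
      (hω : IsAppend ω₁ ω₂ ω)
      {T : Elem Δ (H.obj b) (G.obj d) (E.vcomp h (H.arr b)) (E.vcomp g (G.arr d)) P₂}
      (hT : Push R ω₂ T) (e' : P₁.append P₂ = P) :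
      Push (Row.cons α R e) ω (Elem.cons (J := K) (F.obj a) (α.toMorData.eval ω₁) T e')

/-- The element is cut according to the domains of the 2-cells in the row. `Push` is a relation so
that the cut may be chosen in whatever form the situation provides. -/
theorem exists_push : ∀ {C D C' D' : EnrichedCat.{u, v, p, c, w} E} {F : EFunctor C C'}
    {G : EFunctor D D'} {Γ : ProfPath C D} {Δ : ProfPath C' D'}
    (R : (VCatSig.{u, v, p, c, w} E).Row F G Γ Δ) {a : C.Obj} {d : D.Obj} {A B : E.Obj}
    {f : E.Hom A (C.ext a)} {g : E.Hom B (D.ext d)} {P : E.Path A B} (ω : Elem Γ a d f g P),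
    ∃ T, Push R ω T
  | _, _, _, _, _, _, _, _, Row.nil F, _, _, _, _, _, _, _, ω => by
    cases ω; exact ⟨_, .nil F _ _⟩
  | _, _, _, _, _, _, _, _, Row.cons α R e, _, _, _, _, _, _, _, ω => by
    subst e
    obtain ⟨b, Z, h, P₁, P₂, ω₁, ω₂, H⟩ := exists_isAppend _ ω
    obtain ⟨T, hT⟩ := exists_push R ω₂
    exact ⟨_, .cons α rfl H hT H.top_eq⟩

theorem IsAppend.path_eq {C M D : EnrichedCat.{u, v, p, c, w} E} {Γ₁ : ProfPath C M}
    {Γ₂ : ProfPath M D} {Γ : ProfPath C D} {a : C.Obj} {b : M.Obj} {d : D.Obj} {A B Z : E.Obj}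
    {f : E.Hom A (C.ext a)} {g : E.Hom B (M.ext b)} {h : E.Hom Z (D.ext d)}
    {P₁ : E.Path A B} {P₂ : E.Path B Z} {P : E.Path A Z} {ω₁ : Elem Γ₁ a b f g P₁}
    {ω₂ : Elem Γ₂ b d g h P₂} {ω : Elem Γ a d f h P} (H : IsAppend ω₁ ω₂ ω) :
    Γ₁.append Γ₂ = Γ := by
  induction H with
  | nil => rfl
  | cons a τ H e e' ih => subst ih; rfl

/-- This compares the relational cut with the function `Objs.split` that enters the definition of
composition. The list `Γ` is only propositionally a concatenation, so the objects `x` are given up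
to heterogeneous equality. -/
theorem IsAppend.split_objs {C M D : EnrichedCat.{u, v, p, c, w} E} {Γ₁ : ProfPath C M}
    {Γ₂ : ProfPath M D} {Γ : ProfPath C D} {a : C.Obj} {b : M.Obj} {d : D.Obj} {A B Z : E.Obj}
    {f : E.Hom A (C.ext a)} {g : E.Hom B (M.ext b)} {h : E.Hom Z (D.ext d)}
    {P₁ : E.Path A B} {P₂ : E.Path B Z} {P : E.Path A Z} {ω₁ : Elem Γ₁ a b f g P₁}
    {ω₂ : Elem Γ₂ b d g h P₂} {ω : Elem Γ a d f h P} (H : IsAppend ω₁ ω₂ ω)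
    (x : Objs (Γ₁.append Γ₂) a d) (hx : x ≍ ω.objs) :
    ∃ e, Objs.split Γ₁ x = ⟨b, ω₁.objs, ω₂.objs, e⟩ := by
  induction H with
  | nil => obtain rfl := eq_of_heq hx; exact ⟨rfl, rfl⟩
  | @cons C N M D J Γ₁ Γ₂ Γ a _ _ _ _ _ _ _ _ _ _ _ _ _ _ _ _ _ τ ω₁ ω₂ ω H e e' ih =>
    obtain rfl := H.path_eq
    obtain rfl := eq_of_heq hx
    obtain ⟨e, he⟩ := ih ω.objs HEq.rfl
    refine ⟨congrArg (ProPath.cons _) e, ?_⟩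
    -- Unfolding one step of `Objs.split` exposes the recursive call, to which the induction
    -- hypothesis applies.
    change (let s := Objs.split Γ₁ ω.objs
      (⟨s.mid, Objs.cons a s.fst, s.snd, congrArg (ProPath.cons _) s.path_eq⟩ :
        Objs.Split (Γ₁ := ProPath.cons J Γ₁) (Γ₂ := Γ₂) (Objs.cons (J := J) a ω.objs))) = _
    rw [he]
    rfl

theorem Push.rowAt_eq {C D C' D' : EnrichedCat.{u, v, p, c, w} E} {F : EFunctor C C'}
    {G : EFunctor D D'} {Γ : ProfPath C D} {Δ : ProfPath C' D'}
    {R : (VCatSig.{u, v, p, c, w} E).Row F G Γ Δ} {a : C.Obj} {d : D.Obj} {A B : E.Obj}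
    {f : E.Hom A (C.ext a)} {g : E.Hom B (D.ext d)} {P : E.Path A B} {ω : Elem Γ a d f g P}
    {T : Elem Δ (F.obj a) (G.obj d) (E.vcomp f (F.arr a)) (E.vcomp g (G.arr d)) P}
    (H : Push R ω T) :
    ∃ ρ : E.Row (F.arr a) (G.arr d) ω.objs.path T.objs.path,
      rowAt R ω.objs = ⟨T.objs, ρ⟩ ∧ VComp ω.row ρ T.row := by
  induction H with
  | nil F a f => exact ⟨_, rfl, .nil _ _ rfl⟩
  | @cons _ _ _ _ _ _ F H G Γ₁ Γ₂ Γ K Δ α R e a _ _ _ _ _ _ _ _ _ _ _ ω₁ ω₂ ω hω T hT e' ih =>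
    obtain ⟨ρ, h₁, h₂⟩ := ih
    subst e
    obtain ⟨e, he⟩ := hω.split_objs ω.objs HEq.rfl
    refine ⟨Row.cons (α.app ω₁.objs) ρ e, ?_, ?_⟩
    · change (let s := Objs.split Γ₁ ω.objs
        let r := rowAt R s.snd
        (⟨Objs.cons (J := K) (F.obj a) r.1, Row.cons (α.app s.fst) r.2 s.path_eq⟩ :
          (y : Objs (ProPath.cons K Δ) (F.obj a) (G.obj _)) ×
            E.Row (F.arr a) (G.arr _) ω.objs.path y.path)) = _
      rw [he]
      change (⟨Objs.cons (J := K) (F.obj a) (rowAt R ω₂.objs).1, Row.cons (α.app ω₁.objs)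
          (rowAt R ω₂.objs).2 e⟩ : (y : Objs (ProPath.cons K Δ) (F.obj a) (G.obj _)) ×
            E.Row (F.arr a) (G.arr _) ω.objs.path y.path) = _
      rw [h₁]
      rfl
    · exact .cons hω.row _ rfl rfl h₂ _ _

/-- Composition of morphisms is evaluation at the image. The only discrepancy is the bracketing of
the vertical boundary. -/
theorem Push.eval_comp {C D C' D' : EnrichedCat.{u, v, p, c, w} E} {F : EFunctor C C'}
    {G : EFunctor D D'} {Γ : ProfPath C D} {Δ : ProfPath C' D'}
    {R : (VCatSig.{u, v, p, c, w} E).Row F G Γ Δ} {a : C.Obj} {d : D.Obj} {A B : E.Obj}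
    {f : E.Hom A (C.ext a)} {g : E.Hom B (D.ext d)} {P : E.Path A B} {ω : Elem Γ a d f g P}
    {T : Elem Δ (F.obj a) (G.obj d) (E.vcomp f (F.arr a)) (E.vcomp g (G.arr d)) P}
    (H : Push R ω T) {C'' D'' : EnrichedCat.{u, v, p, c, w} E} {F' : EFunctor C' C''}
    {G' : EFunctor D' D''} {K : Prof C'' D''} (β : Mor F' G' Δ K) :
    (MorData.comp R β).eval ω =
      reframe (E.lawful.vcomp_assoc _ _ _) (E.lawful.vcomp_assoc _ _ _)
        (β.toMorData.eval T) := by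
  obtain ⟨ρ, h₁, h₂⟩ := H.rowAt_eq
  have e : (MorData.comp R β).app ω.objs = E.comp ρ (β.app T.objs) := by
    change E.comp (rowAt R ω.objs).2 (β.app (rowAt R ω.objs).1) = _
    rw [h₁]
  change E.comp ω.row ((MorData.comp R β).app ω.objs) = _
  rw [e]
  exact h₂.comp_eq (β.app T.objs) rfl rfl rfl rfl _ _

end Elem

/-- Induction on rows of morphisms of profunctors. -/
theorem vcatRow_induction {motive : ∀ {C D C' D' : EnrichedCat.{u, v, p, c, w} E}
    {F : EFunctor C C'} {G : EFunctor D D'} {Γ : ProfPath C D} {Δ : ProfPath C' D'},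
    (VCatSig.{u, v, p, c, w} E).Row F G Γ Δ → Prop}
    (nil : ∀ {C C' : EnrichedCat.{u, v, p, c, w} E} (F : EFunctor C C'), motive (Row.nil F))
    (cons : ∀ {C M D C' M' D' : EnrichedCat.{u, v, p, c, w} E} {F : EFunctor C C'}
      {H : EFunctor M M'} {G : EFunctor D D'} {Γ₁ : ProfPath C M} {Γ₂ : ProfPath M D}
      {Γ : ProfPath C D} {K : Prof C' M'} {Δ : ProfPath M' D'} (α : Mor F H Γ₁ K)
      (R : (VCatSig.{u, v, p, c, w} E).Row H G Γ₂ Δ) (e : Γ₁.append Γ₂ = Γ), motive R →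
      motive (Row.cons (S := VCatSig.{u, v, p, c, w} E) (K := K) α R e))
    {C D C' D' : EnrichedCat.{u, v, p, c, w} E} {F : EFunctor C C'} {G : EFunctor D D'}
    {Γ : ProfPath C D} {Δ : ProfPath C' D'} (R : (VCatSig.{u, v, p, c, w} E).Row F G Γ Δ) :
    motive R :=
  VDCSig.Row.rec (S := VCatSig.{u, v, p, c, w} E) (motive := fun _ _ _ _ R => motive R)
    (fun F => nil F) (fun α R e ih => cons α R e ih) R

namespace Elem

/-- The action of a hom on either side of an empty list of profunctors. -/
inductive EAct : ∀ {C D : EnrichedCat.{u, v, p, c, w} E} {Γ : ProfPath C D} {a a' : C.Obj}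
    {d d' : D.Obj} {A A' B B' : E.Obj} {f : E.Hom A (C.ext a)} {f' : E.Hom A' (C.ext a')}
    {g : E.Hom B (D.ext d)} {g' : E.Hom B' (D.ext d')} {P : E.Path A A'} {P' : E.Path B B'}
    {Q : E.Path A B} {Q' : E.Path A' B'} (_ : E.Cell f f' P (C.hom a a'))
    (_ : Elem Γ a' d' f' g' Q') (_ : Elem Γ a d f g Q) (_ : E.Cell g g' P' (D.hom d d')), Prop
  | mk {C : EnrichedCat.{u, v, p, c, w} E} {a a' : C.Obj} {A A' : E.Obj} {f : E.Hom A (C.ext a)}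
      {f' : E.Hom A' (C.ext a')} {P : E.Path A A'} (σ : E.Cell f f' P (C.hom a a')) :
      EAct σ (nil a' f') (nil a f) σ

/-- All 2-cells of the row have empty domain here. Naturality of the first turns the left action of
`σ` on its value into a right action, a move hands the hom to the next component, and induction
carries it to the end of the row. -/
theorem push_eact {C M D C' M' D' : EnrichedCat.{u, v, p, c, w} E} {F : EFunctor C C'}
    {H : EFunctor M M'} {G : EFunctor D D'} {Γ₁ : ProfPath C M} {Γ₂ : ProfPath M D}
    {Γ : ProfPath C D} {K : Prof C' M'} {Δ : ProfPath M' D'} (α : Mor F H Γ₁ K)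
    (R : (VCatSig.{u, v, p, c, w} E).Row H G Γ₂ Δ) (e : Γ₁.append Γ₂ = Γ) {a a' : C.Obj}
    {d d' : D.Obj} {A A' B B' : E.Obj} {f : E.Hom A (C.ext a)} {f' : E.Hom A' (C.ext a')}
    {g : E.Hom B (D.ext d)} {g' : E.Hom B' (D.ext d')} {P : E.Path A A'} {P' : E.Path B B'}
    {Q : E.Path A B} {Q' : E.Path A' B'} {σ : E.Cell f f' P (C.hom a a')}
    {ω' : Elem Γ a' d' f' g' Q'} {ω : Elem Γ a d f g Q} {σ' : E.Cell g g' P' (D.hom d d')}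
    (hσ : EAct σ ω' ω σ') {T' T}
    (h' : Push (Row.cons (K := K) α R e) ω' T') (h : Push (Row.cons (K := K) α R e) ω T) :
    ∃ (X : E.Path A B') (S S' : Elem (ProPath.cons K Δ) (F.obj a) (G.obj d')
      (E.vcomp f (F.arr a)) (E.vcomp g' (G.arr d')) X),
      LAct (F.on σ) T' S ∧ RAct T (G.on σ') S' ∧ Rel S S' := by
  induction R using vcatRow_induction generalizing C C' with
  | nil H =>
    cases h' with
    | cons _ _ hω' hT' e' =>
    cases h with
    | cons _ _ hω hT e'' =>
    cases hT'
    cases hT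
    cases hσ with
    | mk σ =>
    cases hω'
    cases hω
    refine ⟨_, _, _, .mk _ _ _ _ (ProPath.append_nil _) (ProPath.append_nil _), .last _ _ _ rfl (ProPath.append_nil _), ?_⟩
    rw [α.lawful.eval_empty σ (ProPath.append_nil _) rfl]
    exact .refl _
  | cons β R e₀ ih =>
    cases h' with
    | cons _ _ hω' hT' e' =>
    cases h with
    | cons _ _ hω hT e'' =>
    cases hσ with
    | mk σ =>
    cases hω'
    cases hω
    obtain ⟨X, S, S', h₁, h₂, h₃⟩ := ih β e₀ (.mk σ) hT' hT
    cases h₁ with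
    | mk σ₀ τ ω e₁ e₂ e₃ =>
    refine ⟨_, _, _, .mk _ _ _ _ (ProPath.append_nil _) ?_, .there _ h₂ _ rfl, ?_⟩
    · rw [← e₁, ← ProPath.append_assoc, e₂]; exact e₃
    -- After naturality of `α`, one move brings the hom to the first component of the remaining row,
    -- where `h₃` takes over.
    · rw [α.lawful.eval_empty σ (ProPath.append_nil _) rfl]
      refine .trans _ _ _ (.rel _ _ (.here _ _ τ ω rfl e₁ _ e₂ e₃ rfl)) (Rel.cons _ h₃ _)

/-- If the first 2-cell has a nonempty domain, its left law absorbs the hom and the two elements are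
equal. Nullary 2-cells in front are the reason why only equivalence can be claimed. -/
theorem push_lact {C D C' D' : EnrichedCat.{u, v, p, c, w} E} {F : EFunctor C C'}
    {G : EFunctor D D'} {Γ : ProfPath C D} {Δ : ProfPath C' D'}
    (R : (VCatSig.{u, v, p, c, w} E).Row F G Γ Δ) {a a' : C.Obj}
    {d : D.Obj} {A B Z : E.Obj} {f : E.Hom A (C.ext a)} {g : E.Hom B (C.ext a')}
    {h : E.Hom Z (D.ext d)} {P : E.Path A B} {Q : E.Path B Z} {X : E.Path A Z}
    {σ : E.Cell f g P (C.hom a a')} {ω' : Elem Γ a' d g h Q} {ω : Elem Γ a d f h X}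
    (hσ : LAct σ ω' ω) {T} (hT : Push R ω T) :
    ∃ T' S, Push R ω' T' ∧ LAct (F.on σ) T' S ∧ Rel T S := by
  induction R using vcatRow_induction with
  | nil H =>
    cases hT
    cases hσ
  | cons α R e ih =>
    cases hT with
    | cons _ _ hω hT e' =>
    cases hω with
    -- `α` is nullary: the hom acts within the rest of the row and is brought back across `α` by a
    -- move and naturality.
    | nil =>
      obtain ⟨T', S, h₁, h₂, h₃⟩ := ih hσ hT
      have e₀ := hσ.top_eq
      refine ⟨_, _, .cons α e (.nil _) h₁ rfl, .mk _ _ _ _ (ProPath.append_nil _) e₀, ?_⟩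
      cases h₂ with
      | mk σ₀ τ ω e₁ e₂ e₃ =>
      rw [α.lawful.eval_empty _ (ProPath.append_nil _) rfl]
      exact .trans _ _ _ (Rel.cons _ h₃ _) (.symm _ _ (.rel _ _ (.here _ _ τ ω rfl e₁ _ e₂ e₃ _)))
    | cons _ τ hω e₁ e₂ =>
      obtain ⟨R₁, ω₁', h₁, h₂⟩ := LAct.of_isAppend_cons (.cons _ τ hω e₁ e₂) hσ
      refine ⟨_, _, .cons α e h₂ hT h₂.top_eq, .mk _ _ _ _ h₁.top_eq e', ?_⟩
      rw [α.lawful.eval_lact h₁ h₁.top_eq]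
      exact .refl _

/-- The hom acts in the domain of the last 2-cell that has a nonempty domain; nullary 2-cells may
still follow it. -/
theorem push_ract {C D C' D' : EnrichedCat.{u, v, p, c, w} E} {F : EFunctor C C'}
    {G : EFunctor D D'} {Γ : ProfPath C D} {Δ : ProfPath C' D'}
    (R : (VCatSig.{u, v, p, c, w} E).Row F G Γ Δ) {a : C.Obj}
    {d d' : D.Obj} {A B Z : E.Obj} {f : E.Hom A (C.ext a)} {g : E.Hom B (D.ext d)}
    {h : E.Hom Z (D.ext d')} {P : E.Path A B} {Q : E.Path B Z} {X : E.Path A Z}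
    {ω' : Elem Γ a d f g P} {σ : E.Cell g h Q (D.hom d d')} {ω : Elem Γ a d' f h X}
    (hσ : RAct ω' σ ω) {T} (hT : Push R ω T) :
    ∃ T' S, Push R ω' T' ∧ RAct T' (G.on σ) S ∧ Rel T S := by
  induction R using vcatRow_induction generalizing A with
  | nil H =>
    cases hT
    cases hσ
  | @cons _ _ _ _ _ _ F H G Γ₁ Γ₂ Γ K Δ α R e ih =>
    cases hT with
    | cons _ _ hω hT e' =>
    rcases hσ.of_isAppend hω with ⟨R₂, ω₂', h₁, h₂⟩ | ⟨h₁, h₂⟩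
    · obtain ⟨T', S, h₃, h₄, h₅⟩ := ih h₁ hT
      exact ⟨_, _, .cons α e h₂ h₃ h₂.top_eq, .there _ h₄ _ e', Rel.cons _ h₅ _⟩
    · cases hT with
      | nil =>
        refine ⟨_, _, .cons α e h₂ (.nil _ _ _) h₂.top_eq,
          .last (J := K) (α.toMorData.eval _) (H.on σ) _ h₁.top_eq e', ?_⟩
        rw [α.lawful.eval_ract h₁ h₁.top_eq]
        exact .refl _
      -- The rest of the row is nonempty but has empty domain. The right law of `α` and one move
      -- start the hom on its way, and `push_eact` carries it past these 2-cells.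
      | cons β e₀ hω₂ hT e'' =>
        obtain ⟨T', hT'⟩ := exists_push (Row.cons β _ e₀) (nil _ _)
        obtain ⟨Y, S, S', h₃, h₄, h₅⟩ := push_eact β _ e₀ (.mk σ) (.cons β e₀ hω₂ hT e'') hT'
        cases h₃ with
        | mk σ₀ τ ω e₁ e₂ e₃ =>
        have e₄ := h₁.top_eq
        refine ⟨_, _, .cons α e h₂ hT' h₂.top_eq, .there _ h₄ _ ?_, ?_⟩
        · rw [← e₃, ← e₂, ProPath.append_assoc, e₁, ← ProPath.append_assoc, e₄, e']
        · rw [α.lawful.eval_ract h₁ h₁.top_eq]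
          exact .trans _ _ _ (.rel _ _ (.here (J := K) (α.toMorData.eval _) (H.on σ) _ _ e₄ e₁ _
            e₂ e₃ _)) (Rel.cons _ h₅ _)

/-- A move within the domain of one 2-cell disappears by its inner law, and a move within the rest
is handled by induction. There remains a move across the boundary of two adjacent domains. -/
theorem push_iact {C D C' D' : EnrichedCat.{u, v, p, c, w} E} {F : EFunctor C C'}
    {G : EFunctor D D'} {Γ : ProfPath C D} {Δ : ProfPath C' D'}
    (R : (VCatSig.{u, v, p, c, w} E).Row F G Γ Δ) {a : C.Obj}
    {d : D.Obj} {A B : E.Obj} {f : E.Hom A (C.ext a)} {g : E.Hom B (D.ext d)}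
    {P : E.Path A B} {ω ω' : Elem Γ a d f g P} (hσ : IAct ω ω') :
    ∃ T T', Push R ω T ∧ Push R ω' T' ∧ Rel T T' := by
  induction R using vcatRow_induction generalizing A with
  | nil H => cases hσ
  | cons α R e ih =>
    subst e
    obtain ⟨b, Z, h, P₁, P₂, ω₁, ω₂, hω⟩ := exists_isAppend _ ω
    rcases hσ.of_isAppend hω with ⟨ω₁', h₁, h₂⟩ | ⟨ω₂', h₁, h₂⟩ |
      ⟨b', X, k, Q₁, Q, Q₂, ω₁', σ, ω₂', h₁, h₂, h₃⟩
    · obtain ⟨T, hT⟩ := exists_push R ω₂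
      refine ⟨_, _, .cons α rfl hω hT hω.top_eq, .cons α rfl h₂ hT hω.top_eq, ?_⟩
      rw [α.lawful.eval_iact h₁]
      exact .refl _
    · obtain ⟨T, T', h₃, h₄, h₅⟩ := ih h₁
      exact ⟨_, _, .cons α rfl hω h₃ hω.top_eq, .cons α rfl h₂ h₄ hω.top_eq, Rel.cons _ h₅ _⟩
    -- The hom leaves `α` as a right action on its value and enters the rest of the row through
    -- `push_lact`; on images this is again a move, followed by `h₆`.
    · obtain ⟨T', hT'⟩ := exists_push R ω₂'
      obtain ⟨T, S, h₄, h₅, h₆⟩ := push_lact R h₂ hT'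
      refine ⟨_, _, .cons α rfl hω h₄ hω.top_eq, .cons α rfl h₃ hT' h₃.top_eq, ?_⟩
      rw [α.lawful.eval_ract h₁ h₁.top_eq]
      cases h₅ with
      | mk σ₀ τ ω e₁ e₂ e₃ =>
      exact .trans _ _ _ (.rel _ _ (.here _ _ τ ω h₁.top_eq e₁ _ e₂ e₃ _))
        (.symm _ _ (Rel.cons _ h₆ _))

end Elem

/-! ### From generalized elements back to components -/

section

variable {C D : EnrichedCat.{u, v, p, c, w} E} {Γ : ProfPath C D} {A B : E.Obj} {P : E.Path A B}

theorem Elem.cons_sigma_eq {C M D : EnrichedCat.{u, v, p, c, w} E} {J : Prof C M}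
    {Γ : ProfPath M D} {a : C.Obj} {b : M.Obj} {d : D.Obj} {A B Z : E.Obj} {f : E.Hom A (C.ext a)}
    {g : E.Hom B (M.ext b)} {h : E.Hom Z (D.ext d)} {P : E.Path A B} {Q : E.Path B Z}
    {R : E.Path A Z} (τ : E.Cell f g P (J.pro a b)) {ω : Elem Γ b d g h Q} {x : Objs Γ b d}
    {ρ : E.Row g h Q x.path}
    (H : (⟨ω.objs, ω.row⟩ : (y : Objs Γ b d) × E.Row g h Q y.path) = ⟨x, ρ⟩)
    (e : P.append Q = R) :
    (⟨(Elem.cons (J := J) a τ ω e).objs, (Elem.cons (J := J) a τ ω e).row⟩ :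
      (y : Objs (ProPath.cons J Γ) a d) × E.Row f h R y.path) =
      ⟨Objs.cons a x, Row.cons τ ρ e⟩ :=
  congrArg (fun s : (y : Objs Γ b d) × E.Row g h Q y.path =>
    (⟨Objs.cons a s.1, Row.cons τ s.2 e⟩ :
      (y : Objs (ProPath.cons J Γ) a d) × E.Row f h R y.path)) H

/-- The action rows are themselves moved elements: take identity 2-cells for all components and for
the hom. This is the universal instance of a move. -/
theorem InnerAct.exists_elem {a : C.Obj} {d : D.Obj} {x y : Objs Γ a d}
    {P : E.Path (C.ext a) (D.ext d)}
    {R : E.Row (E.one (C.ext a)) (E.one (D.ext d)) P x.path}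
    {R' : E.Row (E.one (C.ext a)) (E.one (D.ext d)) P y.path} (H : InnerAct x y R R') :
    ∃ ω ω' : Elem Γ a d (E.one (C.ext a)) (E.one (D.ext d)) P,
      (⟨ω.objs, ω.row⟩ : (y : Objs Γ a d) × E.Row _ _ P y.path) = ⟨x, R⟩ ∧
      (⟨ω'.objs, ω'.row⟩ : (y : Objs Γ a d) × E.Row _ _ P y.path) = ⟨y, R'⟩ ∧ ω.IAct ω' := by
  induction H with
  | @here _ _ _ _ J J' _ a b b' n _ z =>
    obtain ⟨ω, hω⟩ := Elem.exists_of_row z (E.idRow z.path)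
    have := Elem.IAct.here (J := J) (J' := J') (E.idCell (J.pro a b)) (E.idCell _)
      (E.idCell (J'.pro b' n)) ω rfl rfl rfl rfl rfl rfl
    have e₁ : J.ract (E.idCell (J.pro a b)) (E.idCell _) rfl = J.actR a b b' :=
      VDC.compTo_idRow _ _ _
    have e₂ : J'.lact (E.idCell _) (E.idCell (J'.pro b' n)) rfl = J'.actL b b' n :=
      VDC.compTo_idRow _ _ _
    erw [e₁, e₂] at this
    exact ⟨_, _, Elem.cons_sigma_eq _ (Elem.cons_sigma_eq _ hω _) _,
      Elem.cons_sigma_eq _ (Elem.cons_sigma_eq _ hω _) _, this⟩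
  | there J a H ih =>
    obtain ⟨ω, ω', hω, hω', h⟩ := ih
    exact ⟨_, _, Elem.cons_sigma_eq _ hω _, Elem.cons_sigma_eq _ hω' _,
      .there (J := J) (a := a) (E.idCell _) h rfl⟩

theorem LeftAct.exists_elem {a a' : C.Obj} {d : D.Obj} {x' : Objs Γ a' d} {x : Objs Γ a d}
    {R : E.Row (E.one (C.ext a)) (E.one (D.ext d)) (ProPath.cons (C.hom a a') x'.path) x.path}
    (H : LeftAct x' x R) :
    ∃ (ω' : Elem Γ a' d (E.one (C.ext a')) (E.one (D.ext d)) x'.path) (ω : Elem Γ a d _ _ _),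
      (⟨ω'.objs, ω'.row⟩ : (y : Objs Γ a' d) × E.Row _ _ x'.path y.path) = ⟨x', E.idRow _⟩ ∧
      (⟨ω.objs, ω.row⟩ : (y : Objs Γ a d) × E.Row _ _ _ y.path) = ⟨x, R⟩ ∧
      ω'.LAct (E.idCell (C.hom a a')) ω := by
  cases H with
  | @mk _ _ J _ _ _ b _ y =>
    obtain ⟨ω, hω⟩ := Elem.exists_of_row y (E.idRow y.path)
    have := Elem.LAct.mk (J := J) (E.idCell (C.hom a a')) (E.idCell (J.pro a' b)) ω rfl rfl rfl
    have e₂ : J.lact (E.idCell _) (E.idCell (J.pro a' b)) rfl = J.actL a a' _ :=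
      VDC.compTo_idRow _ _ _
    erw [e₂] at this
    exact ⟨_, _, Elem.cons_sigma_eq _ hω _, Elem.cons_sigma_eq _ hω _, this⟩

theorem RightAct.exists_elem {a : C.Obj} {d d' : D.Obj} {x : Objs Γ a d} {x' : Objs Γ a d'}
    {R : E.Row (E.one (C.ext a)) (E.one (D.ext d'))
      (x.path.append (ProPath.single (D.hom d d'))) x'.path} (H : RightAct x x' R) :
    ∃ (ω : Elem Γ a d (E.one (C.ext a)) (E.one (D.ext d)) x.path) (ω' : Elem Γ a d' _ _ _),
      (⟨ω.objs, ω.row⟩ : (y : Objs Γ a d) × E.Row _ _ x.path y.path) = ⟨x, E.idRow _⟩ ∧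
      (⟨ω'.objs, ω'.row⟩ : (y : Objs Γ a d') × E.Row _ _ _ y.path) = ⟨x', R⟩ ∧
      ω.RAct (E.idCell (D.hom d d')) ω' := by
  induction H with
  | @last C D J a d d' =>
    have := Elem.RAct.last (J := J) (E.idCell (J.pro a d)) (E.idCell (D.hom d d')) rfl rfl rfl
    have e₁ : J.ract (E.idCell (J.pro a d)) (E.idCell _) rfl = J.actR a d d' :=
      VDC.compTo_idRow _ _ _
    erw [e₁] at this
    exact ⟨_, _, rfl, rfl, this⟩
  | there J a H ih =>
    obtain ⟨ω, ω', hω, hω', h⟩ := ih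
    exact ⟨_, _, Elem.cons_sigma_eq _ hω _, Elem.cons_sigma_eq _ hω' _,
      .there (J := J) (a := a) (E.idCell _) h rfl rfl⟩

theorem MorData.eval_of_eq {C' D' : EnrichedCat.{u, v, p, c, w} E}
    {F : FunctorData C.toEnrichedCatData C'.toEnrichedCatData}
    {G : FunctorData D.toEnrichedCatData D'.toEnrichedCatData}
    {K : ProfData C'.toEnrichedCatData D'.toEnrichedCatData} (α : MorData F G Γ K) {a : C.Obj}
    {d : D.Obj} {f : E.Hom A (C.ext a)} {g : E.Hom B (D.ext d)} {ω : Elem Γ a d f g P}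
    {x : Objs Γ a d} {R : E.Row f g P x.path}
    (h : (⟨ω.objs, ω.row⟩ : (y : Objs Γ a d) × E.Row f g P y.path) = ⟨x, R⟩) :
    α.eval ω = E.comp R (α.app x) :=
  congrArg (fun s : (y : Objs Γ a d) × E.Row f g P y.path => E.comp s.2 (α.app s.1)) h

/-- The converse of the `eval` lemmas, in the manner of the Yoneda lemma: each law is recovered from
its instance at identity 2-cells. -/
theorem MorData.isLawful_of_eval {C' D' : EnrichedCat.{u, v, p, c, w} E}
    {F : FunctorData C.toEnrichedCatData C'.toEnrichedCatData}
    {G : FunctorData D.toEnrichedCatData D'.toEnrichedCatData}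
    {K : ProfData C'.toEnrichedCatData D'.toEnrichedCatData} (α : MorData F G Γ K)
    (inner : ∀ {a : C.Obj} {d : D.Obj} {A B : E.Obj} {f : E.Hom A (C.ext a)}
      {g : E.Hom B (D.ext d)} {P : E.Path A B} {ω ω' : Elem Γ a d f g P}, ω.IAct ω' →
      α.eval ω = α.eval ω')
    (left : ∀ {a a' : C.Obj} {d : D.Obj} {A B Z : E.Obj} {f : E.Hom A (C.ext a)}
      {g : E.Hom B (C.ext a')} {h : E.Hom Z (D.ext d)} {P : E.Path A B} {Q : E.Path B Z}
      {R : E.Path A Z} {σ : E.Cell f g P (C.hom a a')} {ω : Elem Γ a' d g h Q}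
      {ω' : Elem Γ a d f h R} (_ : ω.LAct σ ω') (e : P.append Q = R),
      α.eval ω' = K.lact (F.on σ) (α.eval ω) e)
    (right : ∀ {a : C.Obj} {d d' : D.Obj} {A B Z : E.Obj} {f : E.Hom A (C.ext a)}
      {g : E.Hom B (D.ext d)} {h : E.Hom Z (D.ext d')} {P : E.Path A B} {Q : E.Path B Z}
      {R : E.Path A Z} {ω : Elem Γ a d f g P} {σ : E.Cell g h Q (D.hom d d')}
      {ω' : Elem Γ a d' f h R} (_ : ω.RAct σ ω') (e : P.append Q = R),
      α.eval ω' = K.ract (α.eval ω) (G.on σ) e)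
    (empty : ∀ {a a' : C.Obj} {d d' : D.Obj} {A A' B B' : E.Obj} {f : E.Hom A (C.ext a)}
      {f' : E.Hom A' (C.ext a')} {g : E.Hom B (D.ext d)} {g' : E.Hom B' (D.ext d')}
      {P : E.Path A A'} {P' : E.Path B B'} {Q : E.Path A B} {Q' : E.Path A' B'}
      {σ : E.Cell f f' P (C.hom a a')} {ω' : Elem Γ a' d' f' g' Q'} {ω : Elem Γ a d f g Q}
      {σ' : E.Cell g g' P' (D.hom d d')} (_ : Elem.EAct σ ω' ω σ') {R : E.Path A B'}
      (e : P.append Q' = R) (e' : Q.append P' = R),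
      K.lact (F.on σ) (α.eval ω') e = K.ract (α.eval ω) (G.on σ') e') :
    α.IsLawful where
  inner H := by
    obtain ⟨ω, ω', h₁, h₂, h⟩ := H.exists_elem
    rw [← α.eval_of_eq h₁, ← α.eval_of_eq h₂, inner h]
  left {a a' d x' x R} H := by
    obtain ⟨ω, ω', h₁, h₂, h⟩ := H.exists_elem
    rw [← α.eval_of_eq h₂, left h rfl, α.eval_of_eq h₁]
    -- The instance at identity 2-cells differs from the law by identity rows above `F.map` and
    -- `α.app`; associativity pulls them out as one identity row on top.
    have h₃ : VComp (E.idRow (ProPath.cons (C.hom a a') x'.path))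
        (row₂ (F.map a a') (α.app x'))
        (row₂ (F.on (E.idCell _)) (E.comp (E.idRow _) (α.app x'))) :=
      VComp.cons₁ _ _ rfl rfl (VComp.single _ _ rfl rfl) _ _
    exact (h₃.comp_eq (K.actL _ _ _) (VDC.vcomp_one_eq _) (VDC.vcomp_one_eq _)
      (by rw [E.lawful.one_vcomp]) (by rw [E.lawful.one_vcomp]) _ _).symm.trans
      (VDC.compTo_idRow _ _ _)
  right {a d d' x x' R} H := by
    obtain ⟨ω, ω', h₁, h₂, h⟩ := H.exists_elem
    rw [← α.eval_of_eq h₂, right h rfl, α.eval_of_eq h₁]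
    have h₃ : VComp (E.idRow (x.path.append (ProPath.single (D.hom d d'))))
        (row₂ (α.app x) (G.map d d'))
        (row₂ (E.comp (E.idRow _) (α.app x)) (G.on (E.idCell _))) :=
      VComp.cons (VComp.idRow_isAppend _ _) _ rfl rfl (VComp.single _ _ rfl rfl) _ _
    exact (h₃.comp_eq (K.actR _ _ _) (VDC.vcomp_one_eq _) (VDC.vcomp_one_eq _)
      (by rw [E.lawful.one_vcomp]) (by rw [E.lawful.one_vcomp]) _ _).symm.trans
      (VDC.compTo_idRow _ _ _)
  empty {a a' d d' x x' P e e'} H := by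
    cases H with
    | mk a a' =>
    have h := empty (.mk (E.idCell (C.hom a a'))) (R := ProPath.single (C.hom a a')) rfl rfl
    have h₁ : VComp (E.idRow (ProPath.single (C.hom a a')))
        (row₂ (F.map a a') (α.app (Objs.nil a')))
        (row₂ (F.on (E.idCell _)) (α.eval (Elem.nil a' (E.one _)))) :=
      VComp.cons₁ _ _ rfl rfl (VComp.single _ _ rfl rfl) _ _
    have h₂ : VComp (E.idRow (ProPath.single (C.hom a a')))
        (row₂ (α.app (Objs.nil a)) (G.map a a'))
        (row₂ (α.eval (Elem.nil a (E.one _))) (G.on (E.idCell _))) :=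
      VComp.cons₀ _ rfl rfl (VComp.single _ _ rfl rfl) _ _
    have e₁ := h₁.comp_eq (K.actL _ _ _) rfl rfl (E.lawful.one_vcomp _) (E.lawful.one_vcomp _)
      (by rw [E.lawful.one_vcomp, E.lawful.vcomp_one])
      (by rw [E.lawful.one_vcomp, E.lawful.vcomp_one])
    have e₂ := h₂.comp_eq (K.actR _ _ _) rfl rfl (E.lawful.one_vcomp _) (E.lawful.one_vcomp _)
      (by rw [E.lawful.one_vcomp, E.lawful.vcomp_one])
      (by rw [E.lawful.one_vcomp, E.lawful.vcomp_one])
    rw [VDC.compTo_idRow] at e₁ e₂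
    exact e₁.trans ((VDC.compTo_frame h _ _ _ _).trans e₂.symm)

end

/-! ### Changes of boundary in the actions -/

section

variable {C D : EnrichedCatData.{u, v, p, c, w} E} {A B Z : E.Obj}

theorem ProfData.lact_reframe (J : ProfData C D) {a a' : C.Obj} {d : D.Obj}
    {f f' : E.Hom A (C.ext a)} {g g' : E.Hom B (C.ext a')} {h h' : E.Hom Z (D.ext d)}
    {P : E.Path A B} {Q : E.Path B Z} {R : E.Path A Z} (σ : E.Cell f g P (C.hom a a'))
    (τ : E.Cell g h Q (J.pro a' d)) (e : P.append Q = R) (hf : f = f') (hg : g = g')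
    (hh : h = h') : J.lact (reframe hf hg σ) (reframe hg hh τ) e = reframe hf hh (J.lact σ τ e) := by
  subst hf; subst hg; subst hh; rfl

theorem ProfData.ract_reframe (J : ProfData C D) {a : C.Obj} {d d' : D.Obj}
    {f f' : E.Hom A (C.ext a)} {g g' : E.Hom B (D.ext d)} {h h' : E.Hom Z (D.ext d')}
    {P : E.Path A B} {Q : E.Path B Z} {R : E.Path A Z} (τ : E.Cell f g P (J.pro a d))
    (σ : E.Cell g h Q (D.hom d d')) (e : P.append Q = R) (hf : f = f') (hg : g = g')
    (hh : h = h') : J.ract (reframe hf hg τ) (reframe hg hh σ) e = reframe hf hh (J.ract τ σ e) := by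
  subst hf; subst hg; subst hh; rfl

theorem FunctorData.vcomp_on {B' : EnrichedCatData.{u, v, p, c, w} E} (F : FunctorData C D)
    (G : FunctorData D B') {a a' : C.Obj} {f : E.Hom A (C.ext a)} {g : E.Hom B (C.ext a')}
    {P : E.Path A B} (σ : E.Cell f g P (C.hom a a')) :
    (F.vcomp G).on σ = reframe (E.lawful.vcomp_assoc _ _ _) (E.lawful.vcomp_assoc _ _ _)
      (G.on (F.on σ)) :=
  (VComp.single (Row.single σ) (F.map a a') rfl rfl).comp_eq (G.map _ _) rfl rfl rfl rfl _ _

end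

/-- Elements are pushed through `R`, where the actions are respected up to `Rel`; the values of `β`
are constant on `Rel` and satisfy the laws of `β`. -/
theorem MorData.comp_isLawful {C D C' D' C'' D'' : EnrichedCat.{u, v, p, c, w} E}
    {F : EFunctor C C'} {G : EFunctor D D'} {Γ : ProfPath C D} {Δ : ProfPath C' D'}
    {F' : EFunctor C' C''} {G' : EFunctor D' D''} {K : Prof C'' D''}
    (R : (VCatSig.{u, v, p, c, w} E).Row F G Γ Δ) (β : Mor F' G' Δ K) :
    (MorData.comp R β).IsLawful := by
  refine MorData.isLawful_of_eval _ ?_ ?_ ?_ ?_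
  · intro a d A B f g P ω ω' H
    obtain ⟨T, T', h₁, h₂, h⟩ := Elem.push_iact R H
    rw [h₁.eval_comp β, h₂.eval_comp β, β.lawful.eval_rel h]
  · intro a a' d A B Z f g h P Q X σ ω ω' H e
    obtain ⟨T, hT⟩ := Elem.exists_push R ω'
    obtain ⟨T', S, h₁, h₂, h₃⟩ := Elem.push_lact R H hT
    rw [hT.eval_comp β, h₁.eval_comp β, β.lawful.eval_rel h₃, β.lawful.eval_lact h₂ e,
      FunctorData.vcomp_on]
    exact (ProfData.lact_reframe _ _ _ _ _ _ _).symm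
  · intro a d d' A B Z f g h P Q X ω σ ω' H e
    obtain ⟨T, hT⟩ := Elem.exists_push R ω'
    obtain ⟨T', S, h₁, h₂, h₃⟩ := Elem.push_ract R H hT
    rw [hT.eval_comp β, h₁.eval_comp β, β.lawful.eval_rel h₃, β.lawful.eval_ract h₂ e,
      FunctorData.vcomp_on]
    exact (ProfData.ract_reframe _ _ _ _ _ _ _).symm
  · intro a a' d d' A A' B B' f f' g g' P P' Q Q' σ ω' ω σ' H X e e'
    obtain ⟨T, hT⟩ := Elem.exists_push R ω
    obtain ⟨T', hT'⟩ := Elem.exists_push R ω'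
    rw [hT.eval_comp β, hT'.eval_comp β, FunctorData.vcomp_on, FunctorData.vcomp_on]
    refine (ProfData.lact_reframe _ _ _ _ _ _ _).trans (.trans ?_
      (ProfData.ract_reframe _ _ _ _ _ _ _).symm)
    congr 1
    -- For the empty list either the row is empty and `β` is itself nullary, so that its naturality
    -- applies, or every 2-cell of the row is nullary and `push_eact` reduces the claim to the left
    -- and right laws of `β`.
    cases H with
    | mk σ =>
    cases hT' with
    | nil =>
      cases hT
      rw [ProPath.append_nil] at e
      subst e
      exact β.lawful.eval_empty (F.on σ) _ _
    | cons α e₀ hω hT₂ e'' =>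
      obtain ⟨Y, S, S', h₁, h₂, h₃⟩ := Elem.push_eact α _ e₀ (.mk σ) (.cons α e₀ hω hT₂ e'') hT
      obtain rfl : X = Y := e.symm.trans h₁.top_eq
      exact (β.lawful.eval_lact h₁ e).symm.trans ((β.lawful.eval_rel h₃).trans
        (β.lawful.eval_ract h₂ e'))

/-! ## The virtual double category of enriched categories -/

section

variable {C D : EnrichedCat.{u, v, p, c, w} E} {A B : E.Obj}

theorem MorData.eval_one (J : Prof C D) {a : C.Obj} {d : D.Obj} {f : E.Hom A (C.ext a)}
    {g : E.Hom B (D.ext d)} {P : E.Path A B} (τ : E.Cell f g P (J.pro a d))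
    (e : P.append (ProPath.nil B) = P) :
    (MorData.one J).eval (.cons (J := J) a τ (.nil d g) e) =
      reframe (E.lawful.vcomp_one f).symm (E.lawful.vcomp_one g).symm τ := by
  have h := VDC.compTo_single_idCell τ (E.lawful.vcomp_one f) (E.lawful.vcomp_one g)
  refine eq_of_heq (.trans ?_ (VDC.reframe_heq _ _ _).symm)
  exact (VDC.compTo_heq _ _ _ _).symm.trans (heq_of_eq h)

/-- The value at a single component is that component, up to its boundary, so both action laws are
tautologies; there is no intermediate category. -/
theorem MorData.one_isLawful (J : Prof C D) : (MorData.one J).IsLawful := by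
  refine MorData.isLawful_of_eval _ ?_ ?_ ?_ ?_
  · intro a d A B f g P ω ω' H
    rcases H with _ | ⟨_, ⟨⟩, _⟩
  · intro a a' d A B Z f g h P Q X σ ω ω' H e
    cases H with
    | mk σ τ ω e₁ e₂ e₃ =>
    cases ω with
    | nil a f =>
    obtain rfl := (ProPath.append_nil _).symm.trans e₁
    obtain rfl := (ProPath.append_nil _).symm.trans e₃
    rw [MorData.eval_one, MorData.eval_one]
    have h : (FunctorData.one C.toEnrichedCatData).on σ =
      reframe (E.lawful.vcomp_one _).symm (E.lawful.vcomp_one _).symm σ :=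
      eq_of_heq (((VDC.compTo_heq _ _ (E.lawful.vcomp_one _) (E.lawful.vcomp_one _)).symm.trans
        (heq_of_eq (VDC.compTo_single_idCell σ _ _))).trans (VDC.reframe_heq _ _ _).symm)
    rw [h]
    exact (J.lact_reframe _ _ _ _ _ _).symm
  · intro a d d' A B Z f g h P Q X ω σ ω' H e
    cases H with
    | there τ H => cases H
    | last τ σ e₁ e₂ e₃ =>
    obtain rfl := (ProPath.append_nil _).symm.trans e₁
    obtain rfl := (ProPath.append_nil _).symm.trans e₃
    rw [MorData.eval_one, MorData.eval_one]
    have h : (FunctorData.one D.toEnrichedCatData).on σ =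
      reframe (E.lawful.vcomp_one _).symm (E.lawful.vcomp_one _).symm σ :=
      eq_of_heq (((VDC.compTo_heq _ _ (E.lawful.vcomp_one _) (E.lawful.vcomp_one _)).symm.trans
        (heq_of_eq (VDC.compTo_single_idCell σ _ _))).trans (VDC.reframe_heq _ _ _).symm)
    rw [h]
    exact (J.ract_reframe _ _ _ _ _ _).symm
  · intro a a' d d' A A' B B' f f' g g' P P' Q Q' σ ω' ω σ' H X e e'
    cases H

end

theorem vcatClosed (E : VDC.{u, v, p, c}) : VCatClosed.{u, v, p, c, w} E where
  one _ := FunctorData.one_isLawful _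
  vcomp F G := FunctorData.vcomp_isLawful F.lawful G.lawful
  idCell := MorData.one_isLawful
  comp := MorData.comp_isLawful

/-- The arrows and 2-cells of a functor have types that depend on its object map. For
representatives the object maps to be compared are only propositionally equal. -/
theorem EFunctor.ext_of_obj {C D : EnrichedCat.{u, v, p, c, w} E} {F G : EFunctor C D}
    (obj : F.obj = G.obj) (arr : ∀ a, F.arr a ≍ G.arr a) (map : ∀ a b, F.map a b ≍ G.map a b) :
    F = G := by
  obtain ⟨⟨o, r, m⟩, hF⟩ := F
  obtain ⟨⟨o', r', m'⟩, hG⟩ := G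
  obtain rfl : o = o' := obj
  obtain rfl : r = r' := funext fun a => eq_of_heq (arr a)
  obtain rfl : m = m' := funext fun a => funext fun b => eq_of_heq (map a b)
  rfl

section

variable {C D C' D' : EnrichedCat.{u, v, p, c, w} E}
  {F F' : EFunctor C C'} {G G' : EFunctor D D'} {Γ : ProfPath C D} {K : Prof C' D'}
  {A B : E.Obj}

theorem Mor.ext_of_app {α β : Mor F G Γ K} (h : ∀ {a : C.Obj} {d : D.Obj} (x : Objs Γ a d),
    α.app x = β.app x) : α = β := by
  obtain ⟨⟨x⟩, hα⟩ := α
  obtain ⟨⟨y⟩, hβ⟩ := β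
  obtain rfl : @x = @y := by funext a d z; exact h z
  rfl

/-- Evaluation at the identity row of a list of objects returns the component there. The boundary
functors may differ by a propositional equality, as in the axioms of a virtual double category. -/
theorem Mor.heq_of_eval (hF : F = F') (hG : G = G') {α : Mor F G Γ K} {β : Mor F' G' Γ K}
    (h : ∀ {a : C.Obj} {d : D.Obj} {A B : E.Obj} {f : E.Hom A (C.ext a)} {g : E.Hom B (D.ext d)}
      {P : E.Path A B} (ω : Elem Γ a d f g P), α.toMorData.eval ω ≍ β.toMorData.eval ω) :
    α ≍ β := by
  subst hF; subst hG
  refine heq_of_eq (Mor.ext_of_app fun x => ?_)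
  obtain ⟨ω, hω⟩ := Elem.exists_of_row x (E.idRow x.path)
  have h := h ω
  rw [MorData.eval_of_eq _ hω, MorData.eval_of_eq _ hω] at h
  rw [← VDC.compTo_idRow (α.app x) (E.lawful.one_vcomp _) (E.lawful.one_vcomp _),
    ← VDC.compTo_idRow (β.app x) (E.lawful.one_vcomp _) (E.lawful.one_vcomp _)]
  exact congrArg _ (eq_of_heq h)

theorem Mor.reframe_heq (hF : F = F') (hG : G = G') (α : Mor F G Γ K) :
    reframe (S := VCatSig.{u, v, p, c, w} E) hF hG α ≍ α := by
  subst hF; subst hG; rfl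

theorem MorData.eval_heq (α : MorData F.toFunctorData G.toFunctorData Γ K.toProfData)
    {a : C.Obj} {d : D.Obj} {f f' : E.Hom A (C.ext a)} {g g' : E.Hom B (D.ext d)}
    {P : E.Path A B} {ω : Elem Γ a d f g P} {ω' : Elem Γ a d f' g' P} (hf : f = f')
    (hg : g = g') (h : ω ≍ ω') : α.eval ω ≍ α.eval ω' := by
  subst hf; subst hg; obtain rfl := eq_of_heq h; rfl

end

namespace Elem

theorem cons_congr {C M D : EnrichedCat.{u, v, p, c, w} E} {J : Prof C M} {Γ : ProfPath M D}
    {a : C.Obj} {b : M.Obj} {d : D.Obj} {A B Z : E.Obj} {f f' : E.Hom A (C.ext a)}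
    {g g' : E.Hom B (M.ext b)} {h h' : E.Hom Z (D.ext d)} {P P' : E.Path A B} {Q : E.Path B Z}
    {R : E.Path A Z} {τ : E.Cell f g P (J.pro a b)} {τ' : E.Cell f' g' P' (J.pro a b)}
    {ω : Elem Γ b d g h Q} {ω' : Elem Γ b d g' h' Q} (hf : f = f') (hg : g = g') (hh : h = h')
    (hP : P = P') (hτ : τ ≍ τ') (hω : ω ≍ ω') (e : P.append Q = R) (e' : P'.append Q = R) :
    cons (J := J) a τ ω e ≍ cons (J := J) a τ' ω' e' := by
  subst hf; subst hg; subst hh; subst hP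
  obtain rfl := eq_of_heq hτ
  obtain rfl := eq_of_heq hω
  rfl

theorem nil_congr {C : EnrichedCat.{u, v, p, c, w} E} {a : C.Obj} {A : E.Obj}
    {f f' : E.Hom A (C.ext a)} (h : f = f') : nil a f ≍ nil a f' := by
  subst h; rfl

theorem IsAppend.heq_of_nil {C D : EnrichedCat.{u, v, p, c, w} E} {Γ₁ Γ : ProfPath C D}
    {a : C.Obj} {d : D.Obj} {A B : E.Obj} {f : E.Hom A (C.ext a)} {g : E.Hom B (D.ext d)}
    {P₁ P : E.Path A B} {ω₁ : Elem Γ₁ a d f g P₁} {ω : Elem Γ a d f g P}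
    (H : IsAppend ω₁ (Elem.nil d g) ω) : ω₁ ≍ ω := by
  induction ω₁ with
  | nil a f => cases H; rfl
  | cons a τ ω₁ e ih =>
    cases H with
    | cons _ _ H _ e' =>
    have h₁ := H.path_eq
    have h₂ := H.top_eq
    rw [ProPath.append_nil] at h₁ h₂
    subst h₁; subst h₂; subst e; subst e'
    exact cons_congr rfl rfl rfl rfl HEq.rfl (ih H) _ _

theorem IsAppend.assoc {C N M D : EnrichedCat.{u, v, p, c, w} E} {Γ₁ : ProfPath C N}
    {Γ₂ : ProfPath N M} {Γ₃ : ProfPath M D} {Γ₁₂ : ProfPath C M} {Γ : ProfPath C D} {a : C.Obj}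
    {n : N.Obj} {b : M.Obj} {d : D.Obj} {A Y B Z : E.Obj} {f : E.Hom A (C.ext a)}
    {k : E.Hom Y (N.ext n)} {g : E.Hom B (M.ext b)} {h : E.Hom Z (D.ext d)} {P₁ : E.Path A Y}
    {P₂ : E.Path Y B} {P₃ : E.Path B Z} {P₁₂ : E.Path A B} {P : E.Path A Z}
    {ω₁ : Elem Γ₁ a n f k P₁} {ω₂ : Elem Γ₂ n b k g P₂} {ω₃ : Elem Γ₃ b d g h P₃}
    {ω₁₂ : Elem Γ₁₂ a b f g P₁₂} {ω : Elem Γ a d f h P} (H₁ : IsAppend ω₁ ω₂ ω₁₂)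
    (H₂ : IsAppend ω₁₂ ω₃ ω) :
    ∃ ω₂₃ : Elem (Γ₂.append Γ₃) n d k h (P₂.append P₃), IsAppend ω₂ ω₃ ω₂₃ ∧
      IsAppend ω₁ ω₂₃ ω := by
  induction H₁ generalizing D with
  | nil ω' =>
    obtain rfl := H₂.path_eq
    obtain rfl := H₂.top_eq
    exact ⟨_, H₂, .nil _⟩
  | cons a τ H e e' ih =>
    cases H₂ with
    | cons _ _ H₂ e₂ e₃ =>
    obtain ⟨ω₂₃, h₁, h₂⟩ := ih H₂
    exact ⟨ω₂₃, h₁, .cons a τ h₂ e e₃⟩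

/-- Rows are concatenated by a function and elements by a relation. Reassociating the cut of `ω` at
each 2-cell of `R` reconciles the two. -/
theorem Push.append {C M D C' M' D' : EnrichedCat.{u, v, p, c, w} E} {F : EFunctor C C'}
    {H : EFunctor M M'} {G : EFunctor D D'} {Γ₁ : ProfPath C M} {Γ₂ : ProfPath M D}
    {Γ : ProfPath C D} {Δ₁ : ProfPath C' M'} {Δ₂ : ProfPath M' D'}
    {R : (VCatSig.{u, v, p, c, w} E).Row F H Γ₁ Δ₁} {S : (VCatSig.{u, v, p, c, w} E).Row H G Γ₂ Δ₂}
    (e : Γ₁.append Γ₂ = Γ) {a : C.Obj} {b : M.Obj} {d : D.Obj} {A B Z : E.Obj}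
    {f : E.Hom A (C.ext a)} {g : E.Hom B (M.ext b)} {h : E.Hom Z (D.ext d)}
    {P₁ : E.Path A B} {P₂ : E.Path B Z} {P : E.Path A Z} {ω₁ : Elem Γ₁ a b f g P₁}
    {ω₂ : Elem Γ₂ b d g h P₂} {ω : Elem Γ a d f h P} (Hω : IsAppend ω₁ ω₂ ω)
    {X₁} {X₂} (h₁ : Push R ω₁ X₁) (h₂ : Push S ω₂ X₂) :
    ∃ X, IsAppend X₁ X₂ X ∧ Push (R.append S e) ω X := by
  induction h₁ generalizing D D' with
  | nil F a f => subst e; cases Hω; exact ⟨_, .nil _, h₂⟩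
  | cons α e₁ hω hT e' ih =>
    subst e₁
    obtain ⟨ω', h₃, h₄⟩ := hω.assoc Hω
    obtain ⟨X, h₅, h₆⟩ := ih rfl h₃ h₂
    exact ⟨_, .cons _ _ h₅ e' h₄.top_eq, .cons α _ h₄ h₆ h₄.top_eq⟩

/-- The images of a generalized element under the rows of a tower. -/
theorem exists_push_tower (h : VCatClosed.{u, v, p, c, w} E) :
    ∀ {C D C' D' C'' D'' : EnrichedCat.{u, v, p, c, w} E}
    {F : EFunctor C C'} {F' : EFunctor C' C''} {G : EFunctor D D'} {G' : EFunctor D' D''}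
    {Γ : ProfPath C D} {Δ : ProfPath C' D'} {Θ : ProfPath C'' D''}
    (T : (VCatSig.{u, v, p, c, w} E).Tower F F' G G' Γ Δ Θ) {a : C.Obj} {d : D.Obj} {A B : E.Obj}
    {f : E.Hom A (C.ext a)} {g : E.Hom B (D.ext d)} {P : E.Path A B} (ω : Elem Γ a d f g P),
    ∃ X Y Y', Push T.top ω X ∧ Push T.bot X Y ∧
      Push (VDCData.towerComp (D := VCatData h) T) ω Y' ∧ Y' ≍ Y
  | _, _, _, _, _, _, _, _, _, _, _, _, _, .nil F F', _, _, _, _, _, _, _, ω => by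
    cases ω
    exact ⟨_, _, _, .nil _ _ _, .nil _ _ _, .nil _ _ _, nil_congr (E.lawful.vcomp_assoc _ _ _).symm⟩
  | _, _, _, _, _, _, _, _, _, _, _, _, _, .cons R α T e e', _, _, _, _, _, _, _, ω => by
    subst e; subst e'
    obtain ⟨b, Z, k, P₁, P₂, ω₁, ω₂, H⟩ := exists_isAppend _ ω
    obtain ⟨X₁, h₁⟩ := exists_push R ω₁
    obtain ⟨X₂, Y, Y', h₂, h₃, h₄, h₅⟩ := exists_push_tower h T ω₂
    obtain ⟨X, h₆, h₇⟩ := Push.append rfl H h₁ h₂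
    refine ⟨X, _, _, h₇, .cons α rfl h₆ h₃ H.top_eq, .cons _ rfl H h₄ H.top_eq, ?_⟩
    refine cons_congr (E.lawful.vcomp_assoc _ _ _).symm (E.lawful.vcomp_assoc _ _ _).symm
      (E.lawful.vcomp_assoc _ _ _).symm rfl ?_ h₅ _ _
    exact (heq_of_eq (h₁.eval_comp α)).trans (VDC.reframe_heq _ _ _)

theorem Push.of_idRow (h : VCatClosed.{u, v, p, c, w} E) {C D : EnrichedCat.{u, v, p, c, w} E}
    {Γ : ProfPath C D} {a : C.Obj} {d : D.Obj} {A B : E.Obj}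
    {f : E.Hom A (C.ext a)} {g : E.Hom B (D.ext d)} {P : E.Path A B} (ω : Elem Γ a d f g P) :
    ∃ X, Push ((VCatData h).idRow Γ) ω X ∧ X ≍ ω := by
  induction ω with
  | nil a f => exact ⟨_, .nil _ _ _, nil_congr (E.lawful.vcomp_one _)⟩
  | @cons _ _ _ J _ a _ _ _ _ _ _ _ _ P₁ _ _ τ ω e ih =>
    obtain ⟨X, h₁, h₂⟩ := ih
    refine ⟨_, .cons (K := J) _ rfl (.cons (J := J) a τ (.nil ω) (ProPath.append_nil P₁) e) h₁ e, ?_⟩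
    refine cons_congr (E.lawful.vcomp_one _) (E.lawful.vcomp_one _) (E.lawful.vcomp_one _) rfl ?_
      h₂ _ _
    exact (heq_of_eq (MorData.eval_one J τ _)).trans (VDC.reframe_heq _ _ _)

end Elem

theorem EFunctor.one_vcomp (h : VCatClosed.{u, v, p, c, w} E) {C D : EnrichedCat.{u, v, p, c, w} E}
    (F : EFunctor C D) : (VCatData h).vcomp ((VCatData h).one C) F = F :=
  EFunctor.ext_of_obj rfl (fun _ => heq_of_eq (E.lawful.one_vcomp _)) fun _ _ =>
    (VDC.compTo_heq _ _ (E.lawful.one_vcomp _) (E.lawful.one_vcomp _)).symm.trans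
      (heq_of_eq (VDC.compTo_idRow _ _ _))

theorem EFunctor.vcomp_one (h : VCatClosed.{u, v, p, c, w} E) {C D : EnrichedCat.{u, v, p, c, w} E}
    (F : EFunctor C D) : (VCatData h).vcomp F ((VCatData h).one D) = F :=
  EFunctor.ext_of_obj rfl (fun _ => heq_of_eq (E.lawful.vcomp_one _)) fun _ _ =>
    (VDC.compTo_heq _ _ (E.lawful.vcomp_one _) (E.lawful.vcomp_one _)).symm.trans
      (heq_of_eq (VDC.compTo_single_idCell _ _ _))

theorem EFunctor.vcomp_assoc (h : VCatClosed.{u, v, p, c, w} E)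
    {C D C' D' : EnrichedCat.{u, v, p, c, w} E} (F : EFunctor C D) (G : EFunctor D C')
    (H : EFunctor C' D') : (VCatData h).vcomp ((VCatData h).vcomp F G) H =
      (VCatData h).vcomp F ((VCatData h).vcomp G H) :=
  EFunctor.ext_of_obj rfl (fun _ => heq_of_eq (E.lawful.vcomp_assoc _ _ _)) fun _ _ =>
    (VDC.compTo_heq _ _ (E.lawful.vcomp_assoc _ _ _) (E.lawful.vcomp_assoc _ _ _)).symm.trans
      (heq_of_eq ((VComp.single _ _ rfl rfl).comp_eq _ rfl rfl rfl rfl _ _).symm)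

/-- Both sides of each axiom are compared by their values, and `Push.eval_comp` reduces the
comparison to images of elements under identity rows, single 2-cells and towers. -/
theorem vcatData_isLawful (h : VCatClosed.{u, v, p, c, w} E) : (VCatData h).IsLawful where
  one_vcomp := EFunctor.one_vcomp h
  vcomp_one := EFunctor.vcomp_one h
  vcomp_assoc := EFunctor.vcomp_assoc h
  idRow_comp {C D C' D' F G Γ K} β := by
    refine eq_of_heq ((Mor.reframe_heq _ _ _).trans (Mor.heq_of_eval (EFunctor.one_vcomp h F)
      (EFunctor.one_vcomp h G) fun ω => ?_))
    obtain ⟨X, h₁, h₂⟩ := Elem.Push.of_idRow h ω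
    refine (heq_of_eq (h₁.eval_comp β)).trans ((VDC.reframe_heq _ _ _).trans ?_)
    exact MorData.eval_heq _ (E.lawful.vcomp_one _) (E.lawful.vcomp_one _) h₂
  comp_idCell {C D C' D' F G Γ K} β := by
    refine eq_of_heq ((Mor.reframe_heq _ _ _).trans (Mor.heq_of_eval (EFunctor.vcomp_one h F)
      (EFunctor.vcomp_one h G) fun ω => ?_))
    obtain ⟨X, h₁⟩ := Elem.exists_push (Row.single (S := VCatSig.{u, v, p, c, w} E) β) ω
    refine (heq_of_eq (h₁.eval_comp _)).trans ((VDC.reframe_heq _ _ _).trans ?_)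
    cases h₁ with
    | cons _ e hω hT e' =>
    cases hT
    obtain rfl := (ProPath.append_nil _).symm.trans e'
    refine (heq_of_eq (MorData.eval_one K _ _)).trans ((VDC.reframe_heq _ _ _).trans ?_)
    exact MorData.eval_heq _ rfl rfl hω.heq_of_nil
  comp_assoc {C D C' D' C'' D'' C₃ D₃ F F' G G' Γ Δ Θ F'' G'' K} T β := by
    refine eq_of_heq ((Mor.reframe_heq _ _ _).trans (Mor.heq_of_eval
      (EFunctor.vcomp_assoc h F F' F'') (EFunctor.vcomp_assoc h G G' G'') fun ω => ?_))
    obtain ⟨X, Y, Y', h₁, h₂, h₃, h₄⟩ := Elem.exists_push_tower h T ω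
    refine (heq_of_eq (h₃.eval_comp β)).trans ((VDC.reframe_heq _ _ _).trans ?_)
    refine .trans ?_ ((heq_of_eq (h₁.eval_comp _)).trans (VDC.reframe_heq _ _ _)).symm
    refine .trans ?_ ((heq_of_eq (h₂.eval_comp β)).trans (VDC.reframe_heq _ _ _)).symm
    exact MorData.eval_heq _ (E.lawful.vcomp_assoc _ _ _).symm (E.lawful.vcomp_assoc _ _ _).symm h₄

/-- The virtual double category of categories enriched in `E`. -/
abbrev VCat (E : VDC.{u, v, p, c}) : VDC :=
  ⟨VCatData (vcatClosed.{u, v, p, c, w} E), vcatData_isLawful _⟩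

/-! ## The laws of enriched categories and profunctors, on generalized elements -/

section

variable {C D : EnrichedCatData.{u, v, p, c, w} E} {A B X Z : E.Obj}

/-- The identity of an enriched category, as a generalized element. -/
abbrev EnrichedCatData.idAt (C : EnrichedCatData.{u, v, p, c, w} E) {a : C.Obj}
    (f : E.Hom A (C.ext a)) : E.Cell f f (ProPath.nil A) (C.hom a a) :=
  compTo (Row.nil f) (C.id a) (E.lawful.vcomp_one f) (E.lawful.vcomp_one f)

/-- Composition of generalized elements of homs. -/
abbrev EnrichedCatData.mul (C : EnrichedCatData.{u, v, p, c, w} E) {a b d : C.Obj}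
    {f : E.Hom A (C.ext a)} {g : E.Hom B (C.ext b)} {h : E.Hom Z (C.ext d)} {P : E.Path A B}
    {Q : E.Path B Z} {R : E.Path A Z} (σ : E.Cell f g P (C.hom a b))
    (τ : E.Cell g h Q (C.hom b d)) (e : P.append Q = R) : E.Cell f h R (C.hom a d) :=
  compTo (Row.cons σ (Row.single τ) e) (C.comp a b d) (E.lawful.vcomp_one f) (E.lawful.vcomp_one h)

variable {J : ProfData C D} {a a' a'' : C.Obj} {d d' d'' : D.Obj}

/-- As for morphisms, each law of a profunctor is precomposed with the row of the elements involved;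
the calculations with `lact`, `ract` and `mul` are then ordinary algebra. -/
theorem ProfData.IsLawful.lact_idAt (H : J.IsLawful) {f : E.Hom A (C.ext a)}
    {g : E.Hom B (D.ext d)} {P : E.Path A B} (τ : E.Cell f g P (J.pro a d))
    (e : (ProPath.nil A).append P = P) : J.lact (C.idAt f) τ e = τ := by
  have h : VComp (Row.single τ) (row₂ (C.id a) (E.idCell (J.pro a d)))
      (Row.cons (C.idAt f) (Row.single τ) e) := VComp.cons₀ _ _ _ (VComp.idRow_right _) _ _
  exact (h.comp_eq (J.actL a a d) (VDC.one_one _) (VDC.one_one _) (E.lawful.vcomp_one _)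
    (E.lawful.vcomp_one _) _ _).symm.trans ((congrArg (fun β => compTo (Row.single τ) β _ _)
      (H.id_actL a d)).trans (VDC.compTo_single_idCell _ _ _))

theorem ProfData.IsLawful.ract_idAt (H : J.IsLawful) {f : E.Hom A (C.ext a)}
    {g : E.Hom B (D.ext d)} {P : E.Path A B} (τ : E.Cell f g P (J.pro a d))
    (e : P.append (ProPath.nil B) = P) : J.ract τ (D.idAt g) e = τ := by
  have h : VComp (Row.single τ) (row₂ (E.idCell (J.pro a d)) (D.id d))
      (Row.cons τ (Row.single (D.idAt g)) e) :=
    VComp.cons_id _ (VComp.cons₀ _ _ _ (.nil _ _ (E.lawful.vcomp_one _)) rfl rfl) _ _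
  exact (h.comp_eq (J.actR a d d) (VDC.one_one _) (VDC.one_one _) (E.lawful.vcomp_one _)
    (E.lawful.vcomp_one _) _ _).symm.trans ((congrArg (fun β => compTo (Row.single τ) β _ _)
      (H.actR_id a d)).trans (VDC.compTo_single_idCell _ _ _))

theorem ProfData.IsLawful.lact_mul (H : J.IsLawful) {f : E.Hom A (C.ext a)}
    {g : E.Hom B (C.ext a')} {h : E.Hom X (C.ext a'')} {k : E.Hom Z (D.ext d)} {P : E.Path A B}
    {Q : E.Path B X} {R : E.Path X Z} {PQ : E.Path A X} {QR : E.Path B Z} {T : E.Path A Z}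
    (σ : E.Cell f g P (C.hom a a')) (σ' : E.Cell g h Q (C.hom a' a''))
    (τ : E.Cell h k R (J.pro a'' d)) (e₁ : P.append Q = PQ) (e₂ : PQ.append R = T)
    (e₃ : Q.append R = QR) (e₄ : P.append QR = T) :
    J.lact (C.mul σ σ' e₁) τ e₂ = J.lact σ (J.lact σ' τ e₃) e₄ := by
  have h₁ : VComp (Row.cons σ (Row.cons σ' (Row.single τ) e₃) e₄)
      (row₂ (C.comp a a' a'') (E.idCell (J.pro a'' d)))
      (Row.cons (C.mul σ σ' e₁) (Row.single τ) e₂) :=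
    VComp.cons₂ _ _ _ _ _ (VComp.idRow_right _) _ _ _ _ _
  have h₂ : VComp (Row.cons σ (Row.cons σ' (Row.single τ) e₃) e₄)
      (row₂ (E.idCell (C.hom a a')) (J.actL a' a'' d))
      (Row.cons σ (Row.single (J.lact σ' τ e₃)) e₄) :=
    VComp.cons_id _ (VComp.single _ _ _ _) _ _
  exact h₁.congr h₂ (β := J.actL _ _ _) (β' := J.actL _ _ _) (h₁ := rfl) (h₂ := rfl) (h₃ := rfl)
    (h₄ := rfl) (H.comp_actL a a' a'' d) _ _ _ _

theorem ProfData.IsLawful.ract_mul (H : J.IsLawful) {f : E.Hom A (C.ext a)}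
    {g : E.Hom B (D.ext d)} {h : E.Hom X (D.ext d')} {k : E.Hom Z (D.ext d'')} {P : E.Path A B}
    {Q : E.Path B X} {R : E.Path X Z} {PQ : E.Path A X} {QR : E.Path B Z} {T : E.Path A Z}
    (τ : E.Cell f g P (J.pro a d)) (σ : E.Cell g h Q (D.hom d d'))
    (σ' : E.Cell h k R (D.hom d' d'')) (e₁ : P.append Q = PQ) (e₂ : PQ.append R = T)
    (e₃ : Q.append R = QR) (e₄ : P.append QR = T) :
    J.ract τ (D.mul σ σ' e₃) e₄ = J.ract (J.ract τ σ e₁) σ' e₂ := by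
  have h₁ : VComp (Row.cons τ (Row.cons σ (Row.single σ') e₃) e₄)
      (row₂ (E.idCell (J.pro a d)) (D.comp d d' d''))
      (Row.cons τ (Row.single (D.mul σ σ' e₃)) e₄) :=
    VComp.cons_id _ (VComp.single _ _ _ _) _ _
  have h₂ : VComp (Row.cons τ (Row.cons σ (Row.single σ') e₃) e₄)
      (row₂ (J.actR a d d') (E.idCell (D.hom d' d'')))
      (Row.cons (J.ract τ σ e₁) (Row.single σ') e₂) :=
    VComp.cons₂ _ _ _ _ _ (VComp.idRow_right _) _ _ _ _ _
  exact h₁.congr h₂ (β := J.actR _ _ _) (β' := J.actR _ _ _) (h₁ := rfl) (h₂ := rfl) (h₃ := rfl)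
    (h₄ := rfl) (H.actR_comp a d d' d'') _ _ _ _

theorem ProfData.IsLawful.ract_lact (H : J.IsLawful) {f : E.Hom A (C.ext a)}
    {g : E.Hom B (C.ext a')} {h : E.Hom X (D.ext d)} {k : E.Hom Z (D.ext d')} {P : E.Path A B}
    {Q : E.Path B X} {R : E.Path X Z} {PQ : E.Path A X} {QR : E.Path B Z} {T : E.Path A Z}
    (σ : E.Cell f g P (C.hom a a')) (τ : E.Cell g h Q (J.pro a' d))
    (σ' : E.Cell h k R (D.hom d d')) (e₁ : P.append Q = PQ) (e₂ : PQ.append R = T)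
    (e₃ : Q.append R = QR) (e₄ : P.append QR = T) :
    J.ract (J.lact σ τ e₁) σ' e₂ = J.lact σ (J.ract τ σ' e₃) e₄ := by
  have h₁ : VComp (Row.cons σ (Row.cons τ (Row.single σ') e₃) e₄)
      (row₂ (J.actL a a' d) (E.idCell (D.hom d d')))
      (Row.cons (J.lact σ τ e₁) (Row.single σ') e₂) :=
    VComp.cons₂ _ _ _ _ _ (VComp.idRow_right _) _ _ _ _ _
  have h₂ : VComp (Row.cons σ (Row.cons τ (Row.single σ') e₃) e₄)
      (row₂ (E.idCell (C.hom a a')) (J.actR a' d d'))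
      (Row.cons σ (Row.single (J.ract τ σ' e₃)) e₄) :=
    VComp.cons_id _ (VComp.single _ _ _ _) _ _
  exact h₁.congr h₂ (β := J.actR _ _ _) (β' := J.actL _ _ _) (h₁ := rfl) (h₂ := rfl) (h₃ := rfl)
    (h₄ := rfl) (H.exchange a a' d d') _ _ _ _

theorem EnrichedCatData.idAt_one (C : EnrichedCatData.{u, v, p, c, w} E) (a : C.Obj) :
    C.idAt (E.one (C.ext a)) = C.id a :=
  VDC.compTo_idRow _ _ _

theorem EnrichedCatData.mul_idCell (C : EnrichedCatData.{u, v, p, c, w} E) (a b d : C.Obj) :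
    C.mul (E.idCell (C.hom a b)) (E.idCell (C.hom b d)) rfl = C.comp a b d :=
  VDC.compTo_idRow _ _ _

theorem ProfData.lact_idCell (J : ProfData C D) (a a' : C.Obj) (d : D.Obj) :
    J.lact (E.idCell (C.hom a a')) (E.idCell (J.pro a' d)) rfl = J.actL a a' d :=
  VDC.compTo_idRow _ _ _

theorem ProfData.ract_idCell (J : ProfData C D) (a : C.Obj) (d d' : D.Obj) :
    J.ract (E.idCell (J.pro a d)) (E.idCell (D.hom d d')) rfl = J.actR a d d' :=
  VDC.compTo_idRow _ _ _

/-- The laws of a profunctor, checked on generalized elements. -/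
theorem ProfData.isLawful_of_elem (J : ProfData C D)
    (lact_idAt : ∀ {a : C.Obj} {d : D.Obj} {A B : E.Obj} {f : E.Hom A (C.ext a)}
      {g : E.Hom B (D.ext d)} {P : E.Path A B} (τ : E.Cell f g P (J.pro a d))
      (e : (ProPath.nil A).append P = P), J.lact (C.idAt f) τ e = τ)
    (ract_idAt : ∀ {a : C.Obj} {d : D.Obj} {A B : E.Obj} {f : E.Hom A (C.ext a)}
      {g : E.Hom B (D.ext d)} {P : E.Path A B} (τ : E.Cell f g P (J.pro a d))
      (e : P.append (ProPath.nil B) = P), J.ract τ (D.idAt g) e = τ)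
    (lact_mul : ∀ {a a' a'' : C.Obj} {d : D.Obj} {A B X Z : E.Obj} {f : E.Hom A (C.ext a)}
      {g : E.Hom B (C.ext a')} {h : E.Hom X (C.ext a'')} {k : E.Hom Z (D.ext d)} {P : E.Path A B}
      {Q : E.Path B X} {R : E.Path X Z} {PQ : E.Path A X} {QR : E.Path B Z} {T : E.Path A Z}
      (σ : E.Cell f g P (C.hom a a')) (σ' : E.Cell g h Q (C.hom a' a''))
      (τ : E.Cell h k R (J.pro a'' d)) (e₁ : P.append Q = PQ) (e₂ : PQ.append R = T)
      (e₃ : Q.append R = QR) (e₄ : P.append QR = T),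
      J.lact (C.mul σ σ' e₁) τ e₂ = J.lact σ (J.lact σ' τ e₃) e₄)
    (ract_mul : ∀ {a : C.Obj} {d d' d'' : D.Obj} {A B X Z : E.Obj} {f : E.Hom A (C.ext a)}
      {g : E.Hom B (D.ext d)} {h : E.Hom X (D.ext d')} {k : E.Hom Z (D.ext d'')} {P : E.Path A B}
      {Q : E.Path B X} {R : E.Path X Z} {PQ : E.Path A X} {QR : E.Path B Z} {T : E.Path A Z}
      (τ : E.Cell f g P (J.pro a d)) (σ : E.Cell g h Q (D.hom d d'))
      (σ' : E.Cell h k R (D.hom d' d'')) (e₁ : P.append Q = PQ) (e₂ : PQ.append R = T)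
      (e₃ : Q.append R = QR) (e₄ : P.append QR = T),
      J.ract τ (D.mul σ σ' e₃) e₄ = J.ract (J.ract τ σ e₁) σ' e₂)
    (ract_lact : ∀ {a a' : C.Obj} {d d' : D.Obj} {A B X Z : E.Obj} {f : E.Hom A (C.ext a)}
      {g : E.Hom B (C.ext a')} {h : E.Hom X (D.ext d)} {k : E.Hom Z (D.ext d')} {P : E.Path A B}
      {Q : E.Path B X} {R : E.Path X Z} {PQ : E.Path A X} {QR : E.Path B Z} {T : E.Path A Z}
      (σ : E.Cell f g P (C.hom a a')) (τ : E.Cell g h Q (J.pro a' d))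
      (σ' : E.Cell h k R (D.hom d d')) (e₁ : P.append Q = PQ) (e₂ : PQ.append R = T)
      (e₃ : Q.append R = QR) (e₄ : P.append QR = T),
      J.ract (J.lact σ τ e₁) σ' e₂ = J.lact σ (J.ract τ σ' e₃) e₄) :
    J.IsLawful where
  id_actL a d := by
    have := lact_idAt (E.idCell (J.pro a d)) rfl
    rwa [C.idAt_one] at this
  actR_id a d := by
    have := ract_idAt (E.idCell (J.pro a d)) rfl
    rwa [D.idAt_one] at this
  comp_actL a a' a'' d := by
    have := lact_mul (E.idCell (C.hom a a')) (E.idCell (C.hom a' a'')) (E.idCell (J.pro a'' d))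
      rfl rfl rfl rfl
    rw [C.mul_idCell, J.lact_idCell] at this
    exact VDC.compTo_frame this rfl rfl rfl rfl
  actR_comp a d d' d'' := by
    have := ract_mul (E.idCell (J.pro a d)) (E.idCell (D.hom d d')) (E.idCell (D.hom d' d''))
      rfl rfl rfl rfl
    rw [D.mul_idCell, J.ract_idCell] at this
    exact VDC.compTo_frame this rfl rfl rfl rfl
  exchange a a' d d' := by
    have := ract_lact (E.idCell (C.hom a a')) (E.idCell (J.pro a' d)) (E.idCell (D.hom d d'))
      rfl rfl rfl rfl
    rw [J.lact_idCell, J.ract_idCell] at this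
    exact VDC.compTo_frame this rfl rfl rfl rfl

theorem FunctorData.IsLawful.on_idAt {F : FunctorData C D} (H : F.IsLawful)
    (f : E.Hom A (C.ext a)) : F.on (C.idAt f) = D.idAt (E.vcomp f (F.arr a)) := by
  have h₁ : VComp (Row.nil f) (Row.single (C.id a)) (Row.single (C.idAt f)) :=
    VComp.single _ _ _ _
  have h₂ : VComp (Row.nil f) (Row.nil (F.arr a)) (Row.nil (E.vcomp f (F.arr a))) := .nil _ _ rfl
  exact h₁.congr h₂ (β := F.map a a) (β' := D.id _) (h₁ := rfl) (h₂ := rfl) (h₃ := VDC.vcomp_one_eq _)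
    (h₄ := VDC.vcomp_one_eq _) (H.map_id a) rfl rfl _ _

theorem FunctorData.IsLawful.on_mul {F : FunctorData C D} (H : F.IsLawful)
    {f : E.Hom A (C.ext a)} {g : E.Hom B (C.ext a')} {h : E.Hom Z (C.ext a'')} {P : E.Path A B}
    {Q : E.Path B Z} {R : E.Path A Z} (σ : E.Cell f g P (C.hom a a'))
    (τ : E.Cell g h Q (C.hom a' a'')) (e : P.append Q = R) :
    F.on (C.mul σ τ e) = D.mul (F.on σ) (F.on τ) e := by
  have h₁ : VComp (Row.cons σ (Row.single τ) e) (Row.single (C.comp a a' a''))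
      (Row.single (C.mul σ τ e)) := VComp.single _ _ _ _
  have h₂ : VComp (Row.cons σ (Row.single τ) e) (row₂ (F.map a a') (F.map a' a''))
      (Row.cons (F.on σ) (Row.single (F.on τ)) e) :=
    VComp.cons₁ _ _ rfl rfl (VComp.single _ _ rfl rfl) _ _
  exact h₁.congr h₂ (β := F.map _ _) (β' := D.comp _ _ _) (h₁ := rfl) (h₂ := rfl)
    (h₃ := VDC.vcomp_one_eq _) (h₄ := VDC.vcomp_one_eq _) (H.map_comp a a' a'') rfl rfl _ _

end

/-! ## Restrictions of enriched profunctors -/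

namespace VDC.EquipmentData

variable (S : E.EquipmentData)

section

variable {A B A' B' Z W : E.Obj} {f : E.Hom A A'} {g : E.Hom B B'}
    {K : E.Pro A' B'} {Γ : E.Path Z W} {h : E.Hom Z A} {k : E.Hom W B}

/-- The composite of a 2-cell into a restriction with the cartesian 2-cell. -/
abbrev cart (τ : E.Cell h k Γ (S.restr f g K)) : E.Cell (E.vcomp h f) (E.vcomp k g) Γ K :=
  E.comp (Row.single τ) (S.restrCell f g K)

theorem cart_lift (φ : E.Cell (E.vcomp h f) (E.vcomp k g) Γ K) : S.cart (S.lift φ) = φ :=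
  (S.isCartesian f g K φ).choose_spec.1

/-- The uniqueness half of cartesianness. Together with `cart_lift`, it reduces any equation between
2-cells into a restriction to one about the original proarrow. -/
theorem cart_injective {τ τ' : E.Cell h k Γ (S.restr f g K)} (e : S.cart τ = S.cart τ') :
    τ = τ' :=
  (S.isCartesian f g K (S.cart τ')).unique e rfl

theorem cart_compTo {Z' W' : E.Obj} {h' : E.Hom Z' Z} {k' : E.Hom W' W} {Γ' : E.Path Z' W'}
    {h'' : E.Hom Z' A} {k'' : E.Hom W' B} (R : E.Row h' k' Γ' Γ)
    (τ : E.Cell h k Γ (S.restr f g K)) (e : E.vcomp h' h = h'') (e' : E.vcomp k' k = k'') :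
    S.cart (compTo R τ e e') = compTo R (S.cart τ)
      ((E.lawful.vcomp_assoc _ _ _).symm.trans (congrArg (E.vcomp · f) e))
      ((E.lawful.vcomp_assoc _ _ _).symm.trans (congrArg (E.vcomp · g) e')) :=
  ((VComp.single R τ e e').comp_eq (S.restrCell f g K) rfl rfl _ _ rfl rfl).symm

end

section

variable {C D C' D' : EnrichedCat.{u, v, p, c, w} E} (F : EFunctor C C')
    (G : EFunctor D D') (K : Prof C' D') {A B Z : E.Obj}

/-- The action on `K(F, G)` is defined as a lift, so composing with the cartesian 2-cell uncovers
the action of `K`. -/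
theorem cart_lact {a a' : C.Obj} {d : D.Obj} {f : E.Hom A (C.ext a)} {g : E.Hom B (C.ext a')}
    {h : E.Hom Z (D.ext d)} {P : E.Path A B} {Q : E.Path B Z} {R : E.Path A Z}
    (σ : E.Cell f g P (C.hom a a')) (τ : E.Cell g h Q ((restrProf S F G K).pro a' d))
    (e : P.append Q = R) :
    S.cart ((restrProf S F G K).lact σ τ e) = K.lact (F.on σ) (S.cart τ) e := by
  have h₁ : VComp (Row.cons σ (Row.single τ) e)
      (row₂ (F.map a a') (S.restrCell (F.arr a') (G.arr d) (K.pro (F.obj a') (G.obj d))))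
      (Row.cons (F.on σ) (Row.single (S.cart τ)) e) :=
    VComp.cons₁ _ _ rfl rfl (VComp.single _ _ rfl rfl) _ _
  refine (S.cart_compTo _ _ _ _).trans ?_
  refine (congrArg (fun β => compTo _ β _ _) (S.cart_lift _)).trans ?_
  exact h₁.comp_eq _ _ _ _ _ _ _

theorem cart_ract {a : C.Obj} {d d' : D.Obj} {f : E.Hom A (C.ext a)} {g : E.Hom B (D.ext d)}
    {h : E.Hom Z (D.ext d')} {P : E.Path A B} {Q : E.Path B Z} {R : E.Path A Z}
    (τ : E.Cell f g P ((restrProf S F G K).pro a d)) (σ : E.Cell g h Q (D.hom d d'))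
    (e : P.append Q = R) :
    S.cart ((restrProf S F G K).ract τ σ e) = K.ract (S.cart τ) (G.on σ) e := by
  have h₁ : VComp (Row.cons τ (Row.single σ) e)
      (row₂ (S.restrCell (F.arr a) (G.arr d) (K.pro (F.obj a) (G.obj d))) (G.map d d'))
      (Row.cons (S.cart τ) (Row.single (G.on σ)) e) :=
    VComp.cons₁ _ _ rfl rfl (VComp.single _ _ rfl rfl) _ _
  refine (S.cart_compTo _ _ _ _).trans ?_
  refine (congrArg (fun β => compTo _ β _ _) (S.cart_lift _)).trans ?_
  exact h₁.comp_eq _ _ _ _ _ _ _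

/-- Under the injection `cart` each law becomes the same law of `K`, once functoriality of `F` or
`G` has rewritten identities and composites of homs. -/
theorem restrProf_isLawful : (restrProf S F G K).IsLawful := by
  refine ProfData.isLawful_of_elem _ ?_ ?_ ?_ ?_ ?_
  · intro a d A B f g P τ e
    apply S.cart_injective
    rw [S.cart_lact, F.lawful.on_idAt, K.lawful.lact_idAt]
  · intro a d A B f g P τ e
    apply S.cart_injective
    rw [S.cart_ract, G.lawful.on_idAt, K.lawful.ract_idAt]
  · intro a a' a'' d A B X Z f g h k P Q R PQ QR T σ σ' τ e₁ e₂ e₃ e₄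
    apply S.cart_injective
    rw [S.cart_lact, S.cart_lact, S.cart_lact, F.lawful.on_mul, K.lawful.lact_mul]
  · intro a d d' d'' A B X Z f g h k P Q R PQ QR T τ σ σ' e₁ e₂ e₃ e₄
    apply S.cart_injective
    rw [S.cart_ract, S.cart_ract, S.cart_ract, G.lawful.on_mul, K.lawful.ract_mul]
  · intro a a' d d' A B X Z f g h k P Q R PQ QR T σ τ σ' e₁ e₂ e₃ e₄
    apply S.cart_injective
    rw [S.cart_ract, S.cart_lact, S.cart_lact, S.cart_ract, K.lawful.ract_lact]

end

end VDC.EquipmentData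

/-! ## Componentwise restrictions are restrictions -/

theorem Elem.IsAppend.right_nil {C D : EnrichedCat.{u, v, p, c, w} E} {Γ : ProfPath C D}
    {a : C.Obj} {d : D.Obj} {A B : E.Obj} {f : E.Hom A (C.ext a)} {g : E.Hom B (D.ext d)}
    {P : E.Path A B} (ω : Elem Γ a d f g P) : IsAppend ω (Elem.nil d g) ω := by
  induction ω with
  | nil a f => exact .nil _
  | cons a τ ω e ih => exact .cons a τ ih e e

theorem Elem.Push.of_single {C D C' D' : EnrichedCat.{u, v, p, c, w} E} {F : EFunctor C C'}
    {G : EFunctor D D'} {Γ : ProfPath C D} {K : Prof C' D'} (β : Mor F G Γ K) {a : C.Obj}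
    {d : D.Obj} {A B : E.Obj} {f : E.Hom A (C.ext a)} {g : E.Hom B (D.ext d)} {P : E.Path A B}
    (ω : Elem Γ a d f g P) :
    Elem.Push (Row.single (S := VCatSig.{u, v, p, c, w} E) β) ω
      (.cons (J := K) (F.obj a) (β.toMorData.eval ω) (.nil (G.obj d) (E.vcomp g (G.arr d)))
        (ProPath.append_nil P)) :=
  .cons β Γ.append_nil (.right_nil ω) (.nil G d g) _

namespace VDC.EquipmentData

variable (S : E.EquipmentData)

section

variable {C D C' D' : EnrichedCat.{u, v, p, c, w} E} (F : EFunctor C C')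
    (G : EFunctor D D') (K : Prof C' D')

/-- The restriction `K(F, G)`. -/
noncomputable abbrev restrictProf : Prof C D := ⟨restrProf S F G K, S.restrProf_isLawful F G K⟩

/-- The value of this morphism at a single component `τ` is `S.cart τ`, so its left and right laws
are `cart_lact` and `cart_ract`. -/
theorem restrMor_isLawful : (restrMor S F G K (S.restrProf_isLawful F G K)).IsLawful := by
  refine MorData.isLawful_of_eval _ ?_ ?_ ?_ ?_
  · intro a d A B f g P ω ω' H
    rcases H with _ | ⟨_, ⟨⟩, _⟩
  · intro a a' d A B Z f g h P Q X σ ω ω' H e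
    cases H with
    | mk σ τ ω e₁ e₂ e₃ =>
    cases ω with
    | nil a f =>
    obtain rfl := (ProPath.append_nil _).symm.trans e₁
    obtain rfl := (ProPath.append_nil _).symm.trans e₃
    exact S.cart_lact F G K σ τ e
  · intro a d d' A B Z f g h P Q X ω σ ω' H e
    cases H with
    | there τ H => cases H
    | last τ σ e₁ e₂ e₃ =>
    obtain rfl := (ProPath.append_nil _).symm.trans e₁
    obtain rfl := (ProPath.append_nil _).symm.trans e₃
    exact S.cart_ract F G K τ σ e
  · intro a a' d d' A A' B B' f f' g g' P P' Q Q' σ ω' ω σ' H X e e'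
    cases H

/-- The cartesian morphism `K(F, G) ⇒ K`. -/
noncomputable abbrev restrictMor : Mor F G (ProPath.single (S.restrictProf F G K)) K :=
  ⟨restrMor S F G K (S.restrProf_isLawful F G K), S.restrMor_isLawful F G K⟩

variable {X Y : EnrichedCat.{u, v, p, c, w} E} {Γ : ProfPath X Y} (H : EFunctor X C)
  (L : EFunctor Y D)

variable {F G K H L} in
theorem cart_eval (ψ : Mor H L Γ (S.restrictProf F G K)) {a : X.Obj} {d : Y.Obj} {A B : E.Obj}
    {f : E.Hom A (X.ext a)} {g : E.Hom B (Y.ext d)} {P : E.Path A B} (ω : Elem Γ a d f g P) :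
    S.cart (ψ.toMorData.eval ω) ≍
      (MorData.comp (Row.single (S := VCatSig.{u, v, p, c, w} E) ψ) (S.restrictMor F G K)).eval ω :=
  ((heq_of_eq ((Elem.Push.of_single ψ ω).eval_comp (S.restrictMor F G K))).trans
    (VDC.reframe_heq _ _ _)).symm

/-- The factorization of a morphism through a restriction. -/
noncomputable def liftMorData
    (φ : MorData (H.toFunctorData.vcomp F.toFunctorData) (L.toFunctorData.vcomp G.toFunctorData)
      Γ K.toProfData) :
    MorData H.toFunctorData L.toFunctorData Γ (restrProf S F G K) where
  app x := S.lift (φ.app x)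

theorem cart_eval_liftMorData
    (φ : MorData (H.toFunctorData.vcomp F.toFunctorData) (L.toFunctorData.vcomp G.toFunctorData)
      Γ K.toProfData) {a : X.Obj} {d : Y.Obj} {A B : E.Obj}
    {f : E.Hom A (X.ext a)} {g : E.Hom B (Y.ext d)} {P : E.Path A B} (ω : Elem Γ a d f g P) :
    S.cart ((S.liftMorData F G K H L φ).eval ω) =
      reframe (E.lawful.vcomp_assoc _ _ _).symm (E.lawful.vcomp_assoc _ _ _).symm (φ.eval ω) := by
  refine (S.cart_compTo ω.row (S.lift (φ.app ω.objs)) rfl rfl).trans ?_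
  exact congrArg (fun β => compTo ω.row β _ _) (S.cart_lift (φ.app ω.objs))

/-- After `cart` each law of the lift is the corresponding law of `φ`; only the bracketing of
boundaries has to be adjusted. -/
theorem liftMorData_isLawful
    {φ : MorData (H.toFunctorData.vcomp F.toFunctorData) (L.toFunctorData.vcomp G.toFunctorData)
      Γ K.toProfData} (hφ : φ.IsLawful) : (S.liftMorData F G K H L φ).IsLawful := by
  -- The law of `φ` speaks of the composite functor of `H` and `F`, while `cart_lact` produces `F`
  -- applied after `H`; these agree after reframing.
  have key := fun {a : X.Obj} {a' : X.Obj} {A B : E.Obj} {f : E.Hom A (X.ext a)}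
    {g : E.Hom B (X.ext a')} {P : E.Path A B} (σ : E.Cell f g P (X.hom a a')) =>
    eq_of_heq ((VDC.reframe_heq (E.lawful.vcomp_assoc f (H.arr a) (F.arr _)).symm
      (E.lawful.vcomp_assoc g (H.arr a') (F.arr _)).symm _).trans ((heq_of_eq
        (FunctorData.vcomp_on H.toFunctorData F.toFunctorData σ)).trans (VDC.reframe_heq _ _ _)))
  have key' := fun {a : Y.Obj} {a' : Y.Obj} {A B : E.Obj} {f : E.Hom A (Y.ext a)}
    {g : E.Hom B (Y.ext a')} {P : E.Path A B} (σ : E.Cell f g P (Y.hom a a')) =>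
    eq_of_heq ((VDC.reframe_heq (E.lawful.vcomp_assoc f (L.arr a) (G.arr _)).symm
      (E.lawful.vcomp_assoc g (L.arr a') (G.arr _)).symm _).trans ((heq_of_eq
        (FunctorData.vcomp_on L.toFunctorData G.toFunctorData σ)).trans (VDC.reframe_heq _ _ _)))
  refine MorData.isLawful_of_eval _ ?_ ?_ ?_ ?_
  · intro a d A B f g P ω ω' h
    apply S.cart_injective
    rw [cart_eval_liftMorData, cart_eval_liftMorData, hφ.eval_iact h]
  · intro a a' d A B Z f g h P Q R σ ω ω' hω e
    apply S.cart_injective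
    rw [cart_eval_liftMorData, hφ.eval_lact hω e]
    refine (ProfData.lact_reframe _ _ _ _ _
      (E.lawful.vcomp_assoc g (H.arr a') (F.arr _)).symm _).symm.trans ?_
    refine .trans ?_ (S.cart_lact F G K _ _ _).symm
    rw [cart_eval_liftMorData]
    exact congrArg (fun β => K.lact β _ e) (key σ)
  · intro a d d' A B Z f g h P Q R ω σ ω' hω e
    apply S.cart_injective
    rw [cart_eval_liftMorData, hφ.eval_ract hω e]
    refine (ProfData.ract_reframe _ _ _ _ _
      (E.lawful.vcomp_assoc g (L.arr d) (G.arr _)).symm _).symm.trans ?_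
    refine .trans ?_ (S.cart_ract F G K _ _ _).symm
    rw [cart_eval_liftMorData]
    exact congrArg (fun β => K.ract _ β e) (key' σ)
  · intro a a' d d' A A' B B' f f' g g' P P' Q Q' σ ω' ω σ' hω R e e'
    cases hω with
    | mk σ =>
    apply S.cart_injective
    refine (S.cart_lact F G K _ _ _).trans (.trans ?_ (S.cart_ract F G K _ _ _).symm)
    rw [cart_eval_liftMorData, cart_eval_liftMorData, ← key, ← key']
    refine (ProfData.lact_reframe _ _ _ _ _ _ _).trans (.trans ?_
      (ProfData.ract_reframe _ _ _ _ _ _ _).symm)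
    obtain rfl := (ProPath.append_nil _).symm.trans e
    exact congrArg _ (hφ.eval_empty σ _ _)

/-- Existence and uniqueness are both inherited from the cartesian 2-cells of `E`: the lift is
formed componentwise, and its values are determined by their images under `cart`. -/
theorem restrictMor_isCartesian :
    VDC.IsCartesian (E := VCat.{u, v, p, c, w} E) (f := F) (g := G) (L := S.restrictProf F G K)
      (K := K) (S.restrictMor F G K) := by
  intro X Y Γ H L φ
  refine ⟨⟨S.liftMorData F G K H L φ.toMorData, S.liftMorData_isLawful F G K H L φ.lawful⟩,
    ?_, ?_⟩
  · refine eq_of_heq (Mor.heq_of_eval rfl rfl fun ω => ?_)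
    refine (S.cart_eval _ ω).symm.trans ?_
    exact (heq_of_eq (S.cart_eval_liftMorData F G K H L φ.toMorData ω)).trans
      (VDC.reframe_heq _ _ _)
  · intro ψ hψ
    refine eq_of_heq (Mor.heq_of_eval rfl rfl fun ω => heq_of_eq (S.cart_injective ?_))
    refine eq_of_heq ((S.cart_eval ψ ω).trans ?_)
    refine .trans ?_ ((heq_of_eq (S.cart_eval_liftMorData F G K H L φ.toMorData ω)).trans
      (VDC.reframe_heq _ _ _)).symm
    rw [← hψ]
    rfl

end

end VDC.EquipmentData

/-! ## Units in the virtual double category of enriched categories -/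

section

variable {C D : EnrichedCat.{u, v, p, c, w} E}

/-- The hom profunctor of an enriched category. -/
def homProf (C : EnrichedCat.{u, v, p, c, w} E) : Prof C C where
  pro := C.hom
  actL := C.comp
  actR := C.comp
  lawful :=
    { id_actL := C.lawful.id_comp
      actR_id := C.lawful.comp_id
      comp_actL := C.lawful.assoc
      actR_comp := fun a b d e => (C.lawful.assoc a b d e).symm
      exchange := C.lawful.assoc }

/-- The identities of an enriched category, as a family of 2-cells into its hom profunctor. -/
def homUnitData (C : EnrichedCat.{u, v, p, c, w} E) :
    MorData (FunctorData.one C.toEnrichedCatData) (FunctorData.one C.toEnrichedCatData)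
      (ProPath.nil C) (homProf C).toProfData where
  app x := Objs.casesNil (C := C)
    (motive := fun {a d} x => E.Cell (E.one (C.ext a)) (E.one (C.ext d)) x.path (C.hom a d)) C.id x

/-- The right action, as a family of 2-cells `J, U ⇒ J`. -/
def actRData (J : Prof C D) :
    MorData (FunctorData.one C.toEnrichedCatData) (FunctorData.one D.toEnrichedCatData)
      (ProPath.cons J (ProPath.single (homProf D))) J.toProfData where
  app := fun
    | Objs.cons a (Objs.cons (b := d') d (Objs.nil _)) => J.actR a d d'

/-- The left action, as a family of 2-cells `U, J ⇒ J`. -/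
def actLData (J : Prof C D) :
    MorData (FunctorData.one C.toEnrichedCatData) (FunctorData.one D.toEnrichedCatData)
      (ProPath.cons (homProf C) (ProPath.single J)) J.toProfData where
  app := fun
    | Objs.cons a (Objs.cons (b := d) a' (Objs.nil _)) => J.actL a a' d

variable {A B X : E.Obj}

theorem FunctorData.one_on (C : EnrichedCatData.{u, v, p, c, w} E) {a a' : C.Obj}
    {f : E.Hom A (C.ext a)} {g : E.Hom B (C.ext a')} {P : E.Path A B}
    (σ : E.Cell f g P (C.hom a a')) : (FunctorData.one C).on σ =
      reframe (E.lawful.vcomp_one f).symm (E.lawful.vcomp_one g).symm σ :=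
  eq_of_heq (((VDC.compTo_heq _ _ (E.lawful.vcomp_one _) (E.lawful.vcomp_one _)).symm.trans
    (heq_of_eq (VDC.compTo_single_idCell σ _ _))).trans (VDC.reframe_heq _ _ _).symm)

theorem homUnitData_eval {a : C.Obj} (f : E.Hom A (C.ext a)) :
    (homUnitData C).eval (.nil a f) =
      reframe (E.lawful.vcomp_one f).symm (E.lawful.vcomp_one f).symm (C.idAt f) :=
  eq_of_heq (((VDC.compTo_heq _ _ _ _).symm).trans (VDC.reframe_heq _ _ _).symm)

theorem actRData_eval (J : Prof C D) {a : C.Obj} {d d' : D.Obj} {f : E.Hom A (C.ext a)}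
    {g : E.Hom B (D.ext d)} {h : E.Hom X (D.ext d')} {P : E.Path A B} {Q : E.Path B X}
    {R : E.Path A X} (τ : E.Cell f g P (J.pro a d)) (σ : E.Cell g h Q (D.hom d d'))
    (e : Q.append (ProPath.nil X) = Q) (e' : P.append Q = R) :
    (actRData J).eval (.cons (J := J) a τ (.cons (J := homProf D) d σ (.nil d' h) e) e') =
      reframe (E.lawful.vcomp_one f).symm (E.lawful.vcomp_one h).symm (J.ract τ σ e') :=
  eq_of_heq (((VDC.compTo_heq _ _ (E.lawful.vcomp_one _) (E.lawful.vcomp_one _)).symm).trans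
    (VDC.reframe_heq _ _ _).symm)

theorem actLData_eval (J : Prof C D) {a a' : C.Obj} {d : D.Obj} {f : E.Hom A (C.ext a)}
    {g : E.Hom B (C.ext a')} {h : E.Hom X (D.ext d)} {P : E.Path A B} {Q : E.Path B X}
    {R : E.Path A X} (σ : E.Cell f g P (C.hom a a')) (τ : E.Cell g h Q (J.pro a' d))
    (e : Q.append (ProPath.nil X) = Q) (e' : P.append Q = R) :
    (actLData J).eval (.cons (J := homProf C) a σ (.cons (J := J) a' τ (.nil d h) e) e') =
      reframe (E.lawful.vcomp_one f).symm (E.lawful.vcomp_one h).symm (J.lact σ τ e') :=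
  eq_of_heq (((VDC.compTo_heq _ _ (E.lawful.vcomp_one _) (E.lawful.vcomp_one _)).symm).trans
    (VDC.reframe_heq _ _ _).symm)

/-- Naturality of the identities says `σ · 1 = σ = 1 · σ`, the two unit laws of the hom profunctor.
-/
theorem homUnitData_isLawful (C : EnrichedCat.{u, v, p, c, w} E) : (homUnitData C).IsLawful := by
  refine MorData.isLawful_of_eval _ ?_ ?_ ?_ ?_
  · intro a d A B f g P ω ω' H; cases H
  · intro a a' d A B Z f g h P Q X σ ω ω' H e; cases H
  · intro a d d' A B Z f g h P Q X ω σ ω' H e; cases H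
  · intro a a' d d' A A' B B' f f' g g' P P' Q Q' σ ω' ω σ' H X e e'
    cases H with
    | mk σ =>
    obtain rfl := (ProPath.append_nil _).symm.trans e
    rw [homUnitData_eval, homUnitData_eval, FunctorData.one_on]
    refine (ProfData.lact_reframe _ _ _ _ _ _ _).trans (.trans (congrArg _ ?_)
      (ProfData.ract_reframe _ _ _ _ _ _ _).symm)
    exact ((homProf C).lawful.ract_idAt σ e).trans ((homProf C).lawful.lact_idAt σ e').symm

/-- The inner and right laws are both associativity of the right action; the left law is its
commutation with the left action. -/
theorem actRData_isLawful (J : Prof C D) : (actRData J).IsLawful := by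
  refine MorData.isLawful_of_eval _ ?_ ?_ ?_ ?_
  · intro a d A B f g P ω ω' H
    cases H with
    | there τ H =>
      cases H with
      | there _ H => cases H
    | here τ σ τ' ω e₁ e₂ e₃ e₄ e₅ e₆ =>
    cases ω with
    | nil =>
    obtain rfl := (ProPath.append_nil _).symm.trans e₂
    obtain rfl := (ProPath.append_nil _).symm.trans e₅
    refine (actRData_eval J _ _ _ _).trans (.trans (congrArg _ ?_) (actRData_eval J _ _ _ _).symm)
    exact (J.lawful.ract_mul τ σ τ' e₁ e₃ e₄ e₆).symm
  · intro a a' d A B Z f g h P Q X σ ω ω' H e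
    cases H with
    | mk σ τ ω e₁ e₂ e₃ =>
    rcases ω with _ | ⟨_, τ', _ | _, e₄⟩
    obtain rfl := (ProPath.append_nil _).symm.trans e₄
    refine (actRData_eval J _ _ _ _).trans (.trans (congrArg _ ?_)
      ((ProfData.lact_reframe _ _ _ _ _ _ _).symm.trans (congrArg₂ (fun x y => J.lact x y e)
        (FunctorData.one_on _ σ) (actRData_eval J _ _ _ _)).symm))
    exact J.lawful.ract_lact σ τ τ' e₂ e₃ e₁ e
  · intro a d d' A B Z f g h P Q X ω σ ω' H e
    cases H with
    | there τ H e₄ e₅ =>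
    cases H with
    | there _ H => cases H
    | last τ' σ e₁ e₂ e₃ =>
    obtain rfl := (ProPath.append_nil _).symm.trans e₁
    obtain rfl := (ProPath.append_nil _).symm.trans e₃
    refine (actRData_eval J _ _ _ _).trans (.trans (congrArg _ ?_)
      ((ProfData.ract_reframe _ _ _ _ _ _ _).symm.trans (congrArg₂ (fun x y => J.ract x y e)
        (actRData_eval J _ _ _ _) (FunctorData.one_on _ σ)).symm))
    exact J.lawful.ract_mul τ τ' σ e₄ e e₂ e₅
  · intro a a' d d' A A' B B' f f' g g' P P' Q Q' σ ω' ω σ' H X e e'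
    cases H

/-- Dually, the inner and left laws are associativity of the left action, and the right law is the
exchange of the two actions. -/
theorem actLData_isLawful (J : Prof C D) : (actLData J).IsLawful := by
  refine MorData.isLawful_of_eval _ ?_ ?_ ?_ ?_
  · intro a d A B f g P ω ω' H
    cases H with
    | there τ H =>
      cases H with
      | there _ H => cases H
    | here τ σ τ' ω e₁ e₂ e₃ e₄ e₅ e₆ =>
    cases ω with
    | nil =>
    obtain rfl := (ProPath.append_nil _).symm.trans e₂
    obtain rfl := (ProPath.append_nil _).symm.trans e₅
    refine (actLData_eval J _ _ _ _).trans (.trans (congrArg _ ?_) (actLData_eval J _ _ _ _).symm)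
    exact (J.lawful.lact_mul τ σ τ' e₁ e₃ e₄ e₆)
  · intro a a' d A B Z f g h P Q X σ ω ω' H e
    cases H with
    | mk σ τ ω e₁ e₂ e₃ =>
    rcases ω with _ | ⟨_, τ', _ | _, e₄⟩
    obtain rfl := (ProPath.append_nil _).symm.trans e₄
    refine (actLData_eval J _ _ _ _).trans (.trans (congrArg _ ?_)
      ((ProfData.lact_reframe _ _ _ _ _ _ _).symm.trans (congrArg₂ (fun x y => J.lact x y e)
        (FunctorData.one_on _ σ) (actLData_eval J _ _ _ _)).symm))
    exact J.lawful.lact_mul σ τ τ' e₂ e₃ e₁ e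
  · intro a d d' A B Z f g h P Q X ω σ ω' H e
    cases H with
    | there τ H e₄ e₅ =>
    cases H with
    | there _ H => cases H
    | last τ' σ e₁ e₂ e₃ =>
    obtain rfl := (ProPath.append_nil _).symm.trans e₁
    obtain rfl := (ProPath.append_nil _).symm.trans e₃
    refine (actLData_eval J _ _ _ _).trans (.trans (congrArg _ ?_)
      ((ProfData.ract_reframe _ _ _ _ _ _ _).symm.trans (congrArg₂ (fun x y => J.ract x y e)
        (actLData_eval J _ _ _ _) (FunctorData.one_on _ σ)).symm))
    exact (J.lawful.ract_lact τ τ' σ e₄ e e₂ e₅).symm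
  · intro a a' d d' A A' B B' f f' g g' P P' Q Q' σ ω' ω σ' H X e e'
    cases H

end

section

variable {C D : EnrichedCat.{u, v, p, c, w} E} {A B X : E.Obj}

/-- The unit cell of the hom profunctor. -/
def homUnit (C : EnrichedCat.{u, v, p, c, w} E) :
    (VCat.{u, v, p, c, w} E).Cell ((VCat E).one C) ((VCat E).one C) (ProPath.nil C) (homProf C) :=
  ⟨homUnitData C, homUnitData_isLawful C⟩

/-- The right action as a 2-cell `J, U ⇒ J`. -/
def actRMor (J : Prof C D) : (VCat.{u, v, p, c, w} E).Cell ((VCat E).one C) ((VCat E).one D)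
    (ProPath.cons J (ProPath.single (homProf D))) J :=
  ⟨actRData J, actRData_isLawful J⟩

/-- The left action as a 2-cell `U, J ⇒ J`. -/
def actLMor (J : Prof C D) : (VCat.{u, v, p, c, w} E).Cell ((VCat E).one C) ((VCat E).one D)
    (ProPath.cons (homProf C) (ProPath.single J)) J :=
  ⟨actLData J, actLData_isLawful J⟩

theorem Mor.eval_congr {C' D' : EnrichedCat.{u, v, p, c, w} E} {F F' : EFunctor C C'}
    {G G' : EFunctor D D'} {Γ : ProfPath C D} {K : Prof C' D'} {α : Mor F G Γ K}
    {β : Mor F' G' Γ K} (hF : F = F') (hG : G = G') (h : α ≍ β) {a : C.Obj} {d : D.Obj}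
    {f : E.Hom A (C.ext a)} {g : E.Hom B (D.ext d)} {P : E.Path A B} (ω : Elem Γ a d f g P) :
    α.toMorData.eval ω ≍ β.toMorData.eval ω := by
  subst hF; subst hG; obtain rfl := eq_of_heq h; rfl

theorem Elem.Push.eval_compTo {C' D' C'' D'' : EnrichedCat.{u, v, p, c, w} E} {F : EFunctor C C'}
    {G : EFunctor D D'} {Γ : ProfPath C D} {Δ : ProfPath C' D'}
    {R : (VCatSig.{u, v, p, c, w} E).Row F G Γ Δ} {a : C.Obj} {d : D.Obj}
    {f : E.Hom A (C.ext a)} {g : E.Hom B (D.ext d)} {P : E.Path A B} {ω : Elem Γ a d f g P}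
    {T : Elem Δ (F.obj a) (G.obj d) (E.vcomp f (F.arr a)) (E.vcomp g (G.arr d)) P}
    (H : Push R ω T) {F' : EFunctor C' C''} {G' : EFunctor D' D''} {K : Prof C'' D''}
    (β : Mor F' G' Δ K) {F'' : EFunctor C C''} {G'' : EFunctor D D''}
    (hF : (VCat E).vcomp F F' = F'') (hG : (VCat E).vcomp G G' = G'') :
    (Mor.toMorData (F := F'') (G := G'') (compTo (D := VCatData (vcatClosed E)) R β hF hG)).eval ω ≍
      β.toMorData.eval T :=
  (Mor.eval_congr hF.symm hG.symm (Mor.reframe_heq _ _ _) ω).trans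
    ((heq_of_eq (H.eval_comp β)).trans (VDC.reframe_heq _ _ _))

/-- Because identities act trivially, the action undoes the insertion of the unit. This provides
factorizations whenever a neighbouring profunctor exists. -/
theorem homUnit_actRMor (J : Prof C D) :
    compTo (D := VCatData (vcatClosed.{u, v, p, c, w} E))
      (row₂ ((VCat E).idCell J) (homUnit D)) (actRMor J) (VDC.one_one (E := VCat E) C)
      (VDC.one_one (E := VCat E) D) = (VCat E).idCell J := by
  refine eq_of_heq (Mor.heq_of_eval rfl rfl fun {a d A B f g P} ω => ?_)
  cases ω with
  | cons _ τ ω e =>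
  cases ω with
  | nil =>
  obtain rfl := (ProPath.append_nil _).symm.trans e
  have hT : Elem.Push (row₂ (S := VCatSig.{u, v, p, c, w} E) ((VCat E).idCell J) (homUnit D))
      (.cons (J := J) a τ (.nil d g) e) _ :=
    .cons (K := J) _ _ (Elem.IsAppend.right_nil _)
      (.cons (K := homProf D) (Γ₁ := ProPath.nil D) _ rfl (.nil _) (.nil _ _ _) rfl) e
  refine (hT.eval_compTo (actRMor J) _ _).trans ?_
  refine (heq_of_eq (actRData_eval J _ _ rfl _)).trans ((VDC.reframe_heq _ _ _).trans ?_)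
  refine .trans ?_ ((heq_of_eq (MorData.eval_one J τ e)).trans (VDC.reframe_heq _ _ _)).symm
  refine (heq_of_eq ((congrArg₂ (fun x y => J.ract x y e) (MorData.eval_one J τ e)
    (homUnitData_eval _)).trans (ProfData.ract_reframe _ _ _ _ _ _ _))).trans
    ((VDC.reframe_heq _ _ _).trans (heq_of_eq (J.lawful.ract_idAt τ e)))

theorem homUnit_actLMor (J : Prof C D) :
    compTo (D := VCatData (vcatClosed.{u, v, p, c, w} E))
      (row₂ (homUnit C) ((VCat E).idCell J)) (actLMor J) (VDC.one_one (E := VCat E) C)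
      (VDC.one_one (E := VCat E) D) = (VCat E).idCell J := by
  refine eq_of_heq (Mor.heq_of_eval rfl rfl fun {a d A B f g P} ω => ?_)
  cases ω with
  | cons _ τ ω e =>
  cases ω with
  | nil =>
  obtain rfl := (ProPath.append_nil _).symm.trans e
  have hT : Elem.Push (row₂ (S := VCatSig.{u, v, p, c, w} E) (homUnit C) ((VCat E).idCell J))
      (.cons (J := J) a τ (.nil d g) e) _ :=
    .cons (K := homProf C) (Γ₁ := ProPath.nil C) _ rfl (.nil _)
      (.cons (K := J) _ _ (Elem.IsAppend.right_nil _) (.nil _ _ _) e) rfl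
  refine (hT.eval_compTo (actLMor J) _ _).trans ?_
  refine (heq_of_eq (actLData_eval J _ _ e _)).trans ((VDC.reframe_heq _ _ _).trans ?_)
  refine .trans ?_ ((heq_of_eq (MorData.eval_one J τ e)).trans (VDC.reframe_heq _ _ _)).symm
  refine (heq_of_eq ((congrArg₂ (fun x y => J.lact x y rfl)
    (homUnitData_eval _) (MorData.eval_one J τ e)).trans (ProfData.lact_reframe _ _ _ _ _ _ _))).trans
    ((VDC.reframe_heq _ _ _).trans (heq_of_eq (J.lawful.lact_idAt τ rfl)))

end

/-! ### Insertion of a unit -/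

section

variable {V : VDC.{u, v, p, c}} {C : V.Obj} {U : V.Pro C C}
  (η : V.Cell (V.one C) (V.one C) (ProPath.nil C) U)

/-- The row inserting a cell with empty domain into a list of proarrows. -/
abbrev VDC.insertRow {A B C : V.Obj} {Γ : V.Path C C} {U : V.Pro C C}
    (η : V.Cell (V.one C) (V.one C) Γ U) (Γ₁ : V.Path A C) (Γ₂ : V.Path C B) :
    V.Row (V.one A) (V.one B) (Γ₁.append (Γ.append Γ₂)) (Γ₁.append (ProPath.cons U Γ₂)) :=
  (V.idRow Γ₁).append (Row.cons η (V.idRow Γ₂) rfl) rfl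

/-- The retraction lets the inserted `U` act on the last proarrow before it. The list is written
with a first member `J` because it must not be empty. -/
theorem VDC.exists_retraction_right
    (act : ∀ {A : V.Obj} (J : V.Pro A C), V.Cell (V.one A) (V.one C) (path₂ J U) J)
    (hact : ∀ {A : V.Obj} (J : V.Pro A C), compTo (row₂ (V.idCell J) η) (act J)
      (VDC.one_one _) (VDC.one_one _) = V.idCell J) {A B A' : V.Obj} (J : V.Pro A' A)
    (Γ₁ : V.Path A C) (Γ₂ : V.Path C B) :
    ∃ R : V.Row (V.one _) (V.one _) _ _, VComp (VDC.insertRow η (ProPath.cons J Γ₁) Γ₂) R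
      (V.idRow ((ProPath.cons J Γ₁).append Γ₂)) := by
  induction Γ₁ generalizing A' with
  | nil C =>
    refine ⟨Row.cons (act J) (V.idRow Γ₂) rfl, ?_⟩
    have := VComp.cons₂ (V.idCell J) η (act J) (VDC.one_one _) (VDC.one_one _)
      (VComp.idRow_left (V.idRow Γ₂)) rfl rfl rfl rfl rfl
    erw [hact J] at this
    exact this
  | cons J' Γ₁ ih =>
    obtain ⟨R, hR⟩ := ih η act hact J' Γ₂
    exact ⟨Row.cons (V.idCell J) R rfl, VComp.id_cons (V.idCell J) hR rfl rfl⟩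

end

section

variable {V : VDC.{u, v, p, c}}

/-- In the applications `T` is an identity row, and the factorization is `φ` precomposed with the
retraction `R`. -/
theorem VDC.factor_of_retraction {Z W Y Y' : V.Obj} {Θ Θ' : V.Path Z W}
    {T : V.Row (V.one Z) (V.one W) Θ Θ} {I : V.Row (V.one Z) (V.one W) Θ Θ'}
    {R : V.Row (V.one Z) (V.one W) Θ' Θ}
    (H : VComp I R T) {f : V.Hom Z Y} {g : V.Hom W Y'}
    {K : V.Pro Y Y'} (φ : V.Cell f g Θ K)
    (hT : compTo T φ (V.lawful.one_vcomp f) (V.lawful.one_vcomp g) = φ) :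
    compTo I (compTo R φ (V.lawful.one_vcomp f) (V.lawful.one_vcomp g))
      (V.lawful.one_vcomp f) (V.lawful.one_vcomp g) = φ :=
  (H.comp_eq φ _ _ _ _ _ _).trans hT

theorem VDC.retraction_left {C D B : V.Obj} {U : V.Pro C C}
    (η : V.Cell (V.one C) (V.one C) (ProPath.nil C) U) (J : V.Pro C D)
    (act : V.Cell (V.one C) (V.one D) (path₂ U J) J)
    (hact : compTo (row₂ η (V.idCell J)) act (VDC.one_one _) (VDC.one_one _) = V.idCell J)
    (Γ₂ : V.Path D B) :
    VComp (VDC.insertRow η (ProPath.nil C) (ProPath.cons J Γ₂)) (Row.cons act (V.idRow Γ₂) rfl)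
      (V.idRow (ProPath.cons J Γ₂)) := by
  have := VComp.cons₂ η (V.idCell J) act (VDC.one_one _) (VDC.one_one _)
    (VComp.idRow_left (V.idRow Γ₂)) rfl rfl rfl rfl rfl
  erw [hact] at this
  exact this

end

/-! ### Identities inserted into elements, and uniqueness of factorizations -/

namespace Elem

section

variable {C M D : EnrichedCat.{u, v, p, c, w} E} {Γ₁ : ProfPath C M}
    {Γ₂ : ProfPath M D} {Γ : ProfPath C D} {a : C.Obj} {b : M.Obj} {d : D.Obj} {A B Z : E.Obj}

theorem exists_append {f : E.Hom A (C.ext a)} {g : E.Hom B (M.ext b)} {h : E.Hom Z (D.ext d)}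
    {P₁ : E.Path A B} {P₂ : E.Path B Z} (ω₁ : Elem Γ₁ a b f g P₁) (ω₂ : Elem Γ₂ b d g h P₂) :
    ∃ ω : Elem (Γ₁.append Γ₂) a d f h (P₁.append P₂), IsAppend ω₁ ω₂ ω := by
  induction ω₁ with
  | nil a f => exact ⟨ω₂, .nil _⟩
  | cons a τ ω₁ e ih =>
    subst e
    obtain ⟨ω, h⟩ := ih ω₂
    exact ⟨_, .cons a τ h rfl (ProPath.append_assoc _ _ _).symm⟩

theorem IsAppend.unique {f : E.Hom A (C.ext a)} {g : E.Hom B (M.ext b)} {h : E.Hom Z (D.ext d)}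
    {P₁ : E.Path A B} {P₂ : E.Path B Z} {P : E.Path A Z} {ω₁ : Elem Γ₁ a b f g P₁}
    {ω₂ : Elem Γ₂ b d g h P₂} {ω ω' : Elem Γ a d f h P} (H : IsAppend ω₁ ω₂ ω)
    (H' : IsAppend ω₁ ω₂ ω') : ω = ω' := by
  induction H with
  | nil => cases H'; rfl
  | cons a τ H e e' ih =>
    cases H' with
    | cons _ _ H' e e'' =>
    obtain rfl := H.top_eq
    obtain rfl := H'.top_eq
    rw [ih H']

theorem IsAppend.congr {f f' : E.Hom A (C.ext a)} {g g' : E.Hom B (M.ext b)}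
    {h h' : E.Hom Z (D.ext d)} {P₁ : E.Path A B} {P₂ : E.Path B Z} {P : E.Path A Z}
    {ω₁ : Elem Γ₁ a b f g P₁} {ω₂ : Elem Γ₂ b d g h P₂} {ω : Elem Γ a d f h P}
    {ω₁' : Elem Γ₁ a b f' g' P₁} {ω₂' : Elem Γ₂ b d g' h' P₂} {ω' : Elem Γ a d f' h' P}
    (H : IsAppend ω₁ ω₂ ω) (H' : IsAppend ω₁' ω₂' ω') (hf : f = f') (hg : g = g') (hh : h = h')
    (h₁ : ω₁ ≍ ω₁') (h₂ : ω₂ ≍ ω₂') : ω ≍ ω' := by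
  subst hf; subst hg; subst hh
  obtain rfl := eq_of_heq h₁
  obtain rfl := eq_of_heq h₂
  exact heq_of_eq (H.unique H')

theorem IsAppend.iact {f : E.Hom A (C.ext a)} {g : E.Hom B (M.ext b)} {h : E.Hom Z (D.ext d)}
    {P₁ : E.Path A B} {P₂ : E.Path B Z} {P : E.Path A Z} {ω₁ : Elem Γ₁ a b f g P₁}
    {ω₂ ω₂' : Elem Γ₂ b d g h P₂} {ω ω' : Elem Γ a d f h P} (H : IsAppend ω₁ ω₂ ω)
    (H' : IsAppend ω₁ ω₂' ω') (h : IAct ω₂ ω₂') : IAct ω ω' := by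
  induction H with
  | nil => cases H'; exact h
  | cons a τ H e e' ih =>
    cases H' with
    | cons _ _ H' e e'' =>
    obtain rfl := H.top_eq
    obtain rfl := H'.top_eq
    exact .there τ (ih H' h) _

theorem IsAppend.ract {f : E.Hom A (C.ext a)} {g : E.Hom B (M.ext b)} {h : E.Hom Z (D.ext d)}
    {P₁ : E.Path A B} {P₂ : E.Path B Z} {P : E.Path A Z} {ω₁ : Elem Γ₁ a b f g P₁}
    {ω₂ : Elem Γ₂ b d g h P₂} {ω : Elem Γ a d f h P} (H : IsAppend ω₁ ω₂ ω)
    {d' : D.Obj} {X : E.Obj} {k : E.Hom X (D.ext d')} {Q : E.Path Z X} {P₂' : E.Path B X}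
    {P' : E.Path A X} {ω₂' : Elem Γ₂ b d' g k P₂'} {ω' : Elem Γ a d' f k P'}
    (H' : IsAppend ω₁ ω₂' ω') {σ : E.Cell h k Q (D.hom d d')} (h : RAct ω₂ σ ω₂') :
    RAct ω σ ω' := by
  induction H with
  | nil => cases H'; exact h
  | cons a τ H e e' ih =>
    cases H' with
    | cons _ _ H' e e'' =>
    exact .there τ (ih H' h) _ _

end

/-- Insertion of an identity into a generalized element. -/
inductive InsertId {C M D : EnrichedCat.{u, v, p, c, w} E} (Γ₁ : ProfPath C M)
    (Γ₂ : ProfPath M D) {a : C.Obj} {d : D.Obj} {A B : E.Obj} {f : E.Hom A (C.ext a)}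
    {g : E.Hom B (D.ext d)} {P : E.Path A B} (ω : Elem (Γ₁.append Γ₂) a d f g P)
    (ω' : Elem (Γ₁.append (ProPath.cons (homProf M) Γ₂)) a d f g P) : Prop
  | mk {b : M.Obj} {X : E.Obj} {h : E.Hom X (M.ext b)} {P₁ : E.Path A X} {P₂ : E.Path X B}
      {ω₁ : Elem Γ₁ a b f h P₁} {ω₂ : Elem Γ₂ b d h g P₂} (H : IsAppend ω₁ ω₂ ω)
      (H' : IsAppend ω₁ (.cons (J := homProf M) b (M.idAt h) ω₂ rfl) ω')

/-- The unit 2-cell is evaluated at the empty element in the cut, where its value is the identity;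
the other components are only framed by identity arrows. -/
theorem InsertId.push {C M D : EnrichedCat.{u, v, p, c, w} E} {Γ₁ : ProfPath C M}
    {Γ₂ : ProfPath M D} {a : C.Obj} {d : D.Obj} {A B : E.Obj} {f : E.Hom A (C.ext a)}
    {g : E.Hom B (D.ext d)} {P : E.Path A B} {ω : Elem (Γ₁.append Γ₂) a d f g P}
    {ω' : Elem (Γ₁.append (ProPath.cons (homProf M) Γ₂)) a d f g P} (H : InsertId Γ₁ Γ₂ ω ω') :
    ∃ T, Push (VDC.insertRow (V := VCat.{u, v, p, c, w} E) (homUnit M) Γ₁ Γ₂) ω T ∧ T ≍ ω' := by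
  obtain ⟨H, H'⟩ := H
  rename_i b X h P₁ P₂ ω₁ ω₂
  obtain ⟨X₁, h₁, h₂⟩ := Push.of_idRow (vcatClosed E) ω₁
  obtain ⟨X₂, h₃, h₄⟩ := Push.of_idRow (vcatClosed E) ω₂
  have h₅ : Push (Row.cons (S := VCatSig.{u, v, p, c, w} E) (homUnit M) ((VCat E).idRow Γ₂) rfl) ω₂ _ :=
    .cons (K := homProf M) (Γ₁ := ProPath.nil M) (homUnit M) rfl (.nil _) h₃ rfl
  obtain ⟨T, h₆, h₇⟩ := Push.append rfl H h₁ h₅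
  refine ⟨T, h₇, h₆.congr H' (E.lawful.vcomp_one _) (E.lawful.vcomp_one _) (E.lawful.vcomp_one _)
    h₂ ?_⟩
  exact cons_congr (E.lawful.vcomp_one _) (E.lawful.vcomp_one _) (E.lawful.vcomp_one _) rfl
    ((heq_of_eq (homUnitData_eval h)).trans (VDC.reframe_heq _ _ _)) h₄ rfl rfl

end Elem

theorem InsertId.eval {C M D C' D' : EnrichedCat.{u, v, p, c, w} E} {Γ₁ : ProfPath C M}
    {Γ₂ : ProfPath M D} {F : EFunctor C C'} {G : EFunctor D D'} {K : Prof C' D'}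
    (ψ : Mor F G (Γ₁.append (ProPath.cons (homProf M) Γ₂)) K) {a : C.Obj} {d : D.Obj}
    {A B : E.Obj} {f : E.Hom A (C.ext a)}
    {g : E.Hom B (D.ext d)} {P : E.Path A B} {ω : Elem (Γ₁.append Γ₂) a d f g P}
    {ω' : Elem (Γ₁.append (ProPath.cons (homProf M) Γ₂)) a d f g P} (H : Elem.InsertId Γ₁ Γ₂ ω ω') :
    (Mor.toMorData (F := F) (G := G) (compTo (D := VCatData (vcatClosed E))
      (VDC.insertRow (V := VCat.{u, v, p, c, w} E) (homUnit M) Γ₁ Γ₂) ψ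
      ((VCat E).lawful.one_vcomp F) ((VCat E).lawful.one_vcomp G))).eval ω =
      ψ.toMorData.eval ω' := by
  obtain ⟨T, h₁, h₂⟩ := H.push
  exact eq_of_heq ((h₁.eval_compTo ψ _ _).trans
    (MorData.eval_heq _ (E.lawful.vcomp_one _) (E.lawful.vcomp_one _) h₂))

/-- The component of an element at the inserted hom profunctor is some `σ = 1 · σ`. The laws of a
morphism move the factor `σ` away, leaving an identity in its place, so the values at inserted
identities determine all values. -/
theorem Mor.ext_of_insertUnit {C M D C' D' : EnrichedCat.{u, v, p, c, w} E} {Γ₁ : ProfPath C M}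
    {Γ₂ : ProfPath M D} {F : EFunctor C C'} {G : EFunctor D D'} {K : Prof C' D'}
    {ψ ψ' : Mor F G (Γ₁.append (ProPath.cons (homProf M) Γ₂)) K}
    (h : ∀ {a : C.Obj} {d : D.Obj} {A B : E.Obj} {f : E.Hom A (C.ext a)}
      {g : E.Hom B (D.ext d)} {P : E.Path A B} {ω : Elem (Γ₁.append Γ₂) a d f g P}
      {ω' : Elem (Γ₁.append (ProPath.cons (homProf M) Γ₂)) a d f g P},
      Elem.InsertId Γ₁ Γ₂ ω ω' → ψ.toMorData.eval ω' = ψ'.toMorData.eval ω') : ψ = ψ' := by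
  refine eq_of_heq (Mor.heq_of_eval rfl rfl fun {a d A B f g P} ω => heq_of_eq ?_)
  obtain ⟨b, Z, k, P₁, P₂, ω₁, ω₂, H⟩ := Elem.exists_isAppend Γ₁ ω
  cases ω₂ with
  | @cons _ _ _ _ _ _ b' _ _ X _ _ l _ _ _ _ σ ω₂ e =>
  cases ω₂ with
  -- Nothing follows the hom profunctor, so `σ` leaves as a right action, which both morphisms
  -- transfer to `K` in the same way.
  | nil =>
    obtain rfl := (ProPath.append_nil _).symm.trans e
    obtain ⟨ω', H'⟩ := Elem.exists_append ω₁
      (.cons (J := homProf M) b (M.idAt k) (.nil b k) rfl)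
    obtain ⟨ω'', H''⟩ := Elem.exists_append ω₁ (.nil b k)
    have hσ : (homProf M).ract (M.idAt k) σ rfl = σ := (homProf M).lawful.lact_idAt σ rfl
    have hR := Elem.RAct.last (J := homProf M) (M.idAt k) σ rfl rfl e
    rw [hσ] at hR
    have hR := H'.ract H hR
    exact (ψ.lawful.eval_ract hR hR.top_eq).trans ((congrArg (fun x => K.ract x (G.on σ) _)
      (h (.mk H'' H'))).trans (ψ'.lawful.eval_ract hR hR.top_eq).symm)
  -- A profunctor `J'` follows, and `σ` is moved to act on its component.
  | @cons _ _ _ J' _ _ _ _ _ _ _ _ _ _ _ _ _ τ' ω₂ e' =>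
    have hσ : (homProf M).ract (M.idAt k) σ rfl = σ := (homProf M).lawful.lact_idAt σ rfl
    have e₅ := (ProPath.append_assoc _ _ _).trans ((congrArg _ e').trans e)
    have hI := Elem.IAct.here (J := homProf M) (J' := J') (M.idAt k) σ τ' ω₂ rfl e' e rfl e₅ rfl
    rw [hσ] at hI
    obtain ⟨ω', H'⟩ := Elem.exists_append ω₁ (.cons (J := homProf M) b (M.idAt k)
      (.cons (J := J') b ((ProfData.lact _ σ τ' rfl)) ω₂ e₅) rfl)
    obtain ⟨ω'', H''⟩ := Elem.exists_append ω₁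
      (.cons (J := J') b ((ProfData.lact _ σ τ' rfl)) ω₂ e₅)
    obtain rfl := H.top_eq
    have hI := H.iact H' hI
    rw [ψ.lawful.eval_iact hI, ψ'.lawful.eval_iact hI, h (.mk H'' H')]

/-- The factorization of a morphism out of the empty list through the unit. -/
def extendUnitData {C C' D' : EnrichedCat.{u, v, p, c, w} E} {F : EFunctor C C'}
    {G : EFunctor C D'} {K : Prof C' D'} (φ : Mor F G (ProPath.nil C) K) :
    MorData F.toFunctorData G.toFunctorData (ProPath.single (homProf C)) K.toProfData where
  app := fun
    | Objs.cons (b := a') a (Objs.nil _) =>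
        K.lact (F.map a a') (φ.app (Objs.nil a')) rfl

theorem extendUnitData_eval {C C' D' : EnrichedCat.{u, v, p, c, w} E} {F : EFunctor C C'}
    {G : EFunctor C D'} {K : Prof C' D'} (φ : Mor F G (ProPath.nil C) K) {a a' : C.Obj}
    {A B : E.Obj} {f : E.Hom A (C.ext a)} {g : E.Hom B (C.ext a')} {P : E.Path A B}
    (σ : E.Cell f g P (C.hom a a')) (e : P.append (ProPath.nil B) = P) :
    (extendUnitData φ).eval (.cons (J := homProf C) a σ (.nil a' g) e) =
      K.lact (F.on σ) (φ.toMorData.eval (.nil a' g)) e := by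
  have h : VComp (Row.single σ)
      (Row.cons (F.map a a') (Row.single (φ.app (Objs.nil a'))) rfl)
      (Row.cons (F.on σ) (Row.single (φ.toMorData.eval (.nil a' g))) e) :=
    VComp.cons₁ _ _ rfl rfl (VComp.single _ _ rfl rfl) _ _
  exact h.comp_eq (K.actL _ _ _) (E.lawful.vcomp_one _) (E.lawful.vcomp_one _) rfl rfl _ _

/-- The left law is functoriality of `F` with associativity of the action of `K`. The right law also
needs naturality of `φ`, to exchange `F` for `G`. -/
theorem extendUnitData_isLawful {C C' D' : EnrichedCat.{u, v, p, c, w} E} {F : EFunctor C C'}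
    {G : EFunctor C D'} {K : Prof C' D'} (φ : Mor F G (ProPath.nil C) K) :
    (extendUnitData φ).IsLawful := by
  refine MorData.isLawful_of_eval _ ?_ ?_ ?_ ?_
  · intro a d A B f g P ω ω' H
    cases H with
    | there _ H => cases H
  · intro a a' d A B Z f g h P Q X σ ω ω' H e
    cases H with
    | mk σ τ ω e₁ e₂ e₃ =>
    cases ω with
    | nil a f =>
    obtain rfl := (ProPath.append_nil _).symm.trans e₁
    obtain rfl := (ProPath.append_nil _).symm.trans e₃
    refine (extendUnitData_eval φ _ _).trans (.trans ?_
      (congrArg (fun x => K.lact (F.on σ) x e) (extendUnitData_eval φ τ e₁)).symm)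
    refine (congrArg (fun x => K.lact x _ e₃) (F.lawful.on_mul σ τ e)).trans ?_
    exact K.lawful.lact_mul _ _ _ _ _ _ _
  · intro a d d' A B Z f g h P Q X ω σ ω' H e
    cases H with
    | there τ H => cases H
    | last τ σ e₁ e₂ e₃ =>
    obtain rfl := (ProPath.append_nil _).symm.trans e₁
    obtain rfl := (ProPath.append_nil _).symm.trans e₃
    refine (extendUnitData_eval φ _ _).trans (.trans ?_
      (congrArg (fun x => K.ract x (G.on σ) e) (extendUnitData_eval φ τ e₁)).symm)
    refine (congrArg (fun x => K.lact x _ e₃) (F.lawful.on_mul τ σ e)).trans ?_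
    refine (K.lawful.lact_mul _ _ _ e e₃ (ProPath.append_nil _) e).trans ?_
    -- `F τ · (F σ · φ)` becomes `F τ · (φ · G σ)`, and the two actions of `K` commute.
    rw [φ.lawful.eval_empty σ (ProPath.append_nil _) rfl]
    exact (K.lawful.ract_lact _ _ _ e₁ e rfl e).symm
  · intro a a' d d' A A' B B' f f' g g' P P' Q Q' σ ω' ω σ' H X e e'
    cases H

/-- The factorization of `φ` lets the inserted hom act on the profunctor before it if there is one,
otherwise on the one after it, and on `K` through `F` if both lists are empty. Uniqueness does not
depend on the case. -/
theorem homUnit_isComposite (M : EnrichedCat.{u, v, p, c, w} E) :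
    VDC.IsComposite (E := VCat.{u, v, p, c, w} E) (homUnit M) := by
  intro C D C' D' Γ₁ Γ₂ F G K φ
  refine existsUnique_of_exists_of_unique ?_ ?_
  · have h₁ := (VCat.{u, v, p, c, w} E).lawful.idRow_comp φ
    cases Γ₁ with
    | cons J Γ₁ =>
      obtain ⟨R, hR⟩ := VDC.exists_retraction_right (V := VCat.{u, v, p, c, w} E) (homUnit M)
        actRMor homUnit_actRMor J Γ₁ Γ₂
      exact ⟨_, VDC.factor_of_retraction hR φ h₁⟩
    | nil =>
      cases Γ₂ with
      | cons J Γ₂ =>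
        exact ⟨_, VDC.factor_of_retraction (V := VCat.{u, v, p, c, w} E) (VDC.retraction_left (homUnit M) J
          (actLMor J) (homUnit_actLMor J) Γ₂) φ h₁⟩
      | nil =>
        refine ⟨⟨extendUnitData φ, extendUnitData_isLawful φ⟩, ?_⟩
        refine eq_of_heq (Mor.heq_of_eval rfl rfl fun {a d A B f g P} ω => heq_of_eq ?_)
        refine (InsertId.eval (Γ₁ := ProPath.nil M) (Γ₂ := ProPath.nil M)
          ⟨extendUnitData φ, extendUnitData_isLawful φ⟩ (.mk (.nil ω) (.nil _))).trans ?_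
        cases ω with
        | nil a f =>
        refine (extendUnitData_eval φ (M.idAt f) rfl).trans ?_
        refine (congrArg (fun x => ProfData.lact _ x _ rfl) (F.lawful.on_idAt f)).trans ?_
        exact K.lawful.lact_idAt _ _
  · intro ψ ψ' h h'
    refine Mor.ext_of_insertUnit fun H => ?_
    refine (InsertId.eval ψ H).symm.trans (.trans ?_ (InsertId.eval ψ' H))
    exact congrArg (fun x : Mor F G _ K => x.toMorData.eval _) (h.trans h'.symm)

theorem vcat_isVirtualEquipment (S : E.EquipmentData) :
    (VCat.{u, v, p, c, w} E).IsVirtualEquipment where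
  exists_unit C := ⟨homProf C, homUnit C, homUnit_isComposite C⟩
  exists_restr F G K :=
    ⟨S.restrictProf F G K, S.restrictMor F G K, S.restrictMor_isCartesian F G K⟩

/-! ## The calculus of units -/

namespace VDC.EquipmentData

variable (S : E.EquipmentData)

/-- The rows inserting a unit into a list of proarrows. -/
inductive UnitInsert : ∀ {A B : E.Obj} {Θ Θ' : E.Path A B},
    E.Row (E.one A) (E.one B) Θ Θ' → Prop
  | here {A B : E.Obj} (Γ : E.Path A B) :
      UnitInsert (Row.cons (S.unitCell A) (E.idRow Γ) (Θ := Γ) rfl)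
  | there {A B Z : E.Obj} (J : E.Pro Z A) {Θ Θ' : E.Path A B}
      {I : E.Row (E.one A) (E.one B) Θ Θ'} (H : UnitInsert I) :
      UnitInsert (Row.cons (E.idCell J) I (Θ := ProPath.cons J Θ) rfl)

-- `UnitInsert` builds by recursion the rows that the definition of a composite builds by
-- concatenation, so that later rows need no reassociation.
variable {S} in
theorem UnitInsert.exists_eq {A B : E.Obj} {Θ Θ' : E.Path A B}
    {I : E.Row (E.one A) (E.one B) Θ Θ'} (H : S.UnitInsert I) :
    ∃ (C : E.Obj) (Γ₁ : E.Path A C) (Γ₂ : E.Path C B), Θ = Γ₁.append Γ₂ ∧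
      Θ' = Γ₁.append (ProPath.cons (S.unit C) Γ₂) ∧ I ≍ VDC.insertRow (S.unitCell C) Γ₁ Γ₂ := by
  induction H with
  | here Γ => exact ⟨_, ProPath.nil _, Γ, rfl, rfl, HEq.rfl⟩
  | there J H ih =>
    obtain ⟨C, Γ₁, Γ₂, rfl, rfl, h⟩ := ih
    obtain rfl := eq_of_heq h
    exact ⟨C, ProPath.cons J Γ₁, Γ₂, rfl, rfl, HEq.rfl⟩

-- The uniqueness half of the universal property of units. Each identity below that involves units
-- is proved by inserting a unit on both sides and finding the same 2-cell.
variable {S} in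
theorem UnitInsert.ext {A B A' B' : E.Obj} {Θ Θ' : E.Path A B}
    {I : E.Row (E.one A) (E.one B) Θ Θ'} (H : S.UnitInsert I) {f : E.Hom A A'} {g : E.Hom B B'}
    {K : E.Pro A' B'} {φ ψ ψ' : E.Cell f g _ K}
    (h : compTo I ψ (E.lawful.one_vcomp f) (E.lawful.one_vcomp g) = φ)
    (h' : compTo I ψ' (E.lawful.one_vcomp f) (E.lawful.one_vcomp g) = φ) : ψ = ψ' := by
  obtain ⟨C, Γ₁, Γ₂, rfl, rfl, hI⟩ := H.exists_eq
  obtain rfl := eq_of_heq hI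
  exact (S.isUnit C Γ₁ Γ₂ φ).unique h h'

theorem unitL_spec {A B : E.Obj} (J : E.Pro A B) :
    compTo (row₂ (S.unitCell A) (E.idCell J)) (S.unitL J) (VDC.one_one _) (VDC.one_one _) =
      E.idCell J :=
  (S.isUnit A (ProPath.nil A) (ProPath.single J) (E.idCell J)).choose_spec.1

theorem unitR_spec {A B : E.Obj} (J : E.Pro A B) :
    compTo (row₂ (E.idCell J) (S.unitCell B)) (S.unitR J) (VDC.one_one _) (VDC.one_one _) =
      E.idCell J :=
  (S.isUnit B (ProPath.single J) (ProPath.nil B) (E.idCell J)).choose_spec.1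

theorem unitMap_spec {A B : E.Obj} (f : E.Hom A B) :
    compTo (Row.single (S.unitCell A)) (S.unitMap f) (E.lawful.one_vcomp f)
      (E.lawful.one_vcomp f) =
      compTo (Row.nil f) (S.unitCell B) (E.lawful.vcomp_one f) (E.lawful.vcomp_one f) :=
  (S.isUnit A (ProPath.nil A) (ProPath.nil A) _).choose_spec.1

section

variable {A B X Z Y Y' : E.Obj}

/-- The identity of a unit, at an arrow. -/
abbrev uid (f : E.Hom A Y) : E.Cell f f (ProPath.nil A) (S.unit Y) :=
  compTo (Row.nil f) (S.unitCell Y) (E.lawful.vcomp_one f) (E.lawful.vcomp_one f)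

/-- The left action of a unit, on generalized elements. -/
noncomputable abbrev ulact {f : E.Hom A Y} {g : E.Hom B Y} {h : E.Hom Z Y'} {P : E.Path A B} {Q : E.Path B Z}
    {R : E.Path A Z} {J : E.Pro Y Y'} (σ : E.Cell f g P (S.unit Y)) (τ : E.Cell g h Q J)
    (e : P.append Q = R) : E.Cell f h R J :=
  compTo (Row.cons σ (Row.single τ) e) (S.unitL J) (E.lawful.vcomp_one f) (E.lawful.vcomp_one h)

/-- The right action of a unit, on generalized elements. -/
noncomputable abbrev uract {f : E.Hom A Y} {g : E.Hom B Y'} {h : E.Hom Z Y'} {P : E.Path A B} {Q : E.Path B Z}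
    {R : E.Path A Z} {J : E.Pro Y Y'} (τ : E.Cell f g P J) (σ : E.Cell g h Q (S.unit Y'))
    (e : P.append Q = R) : E.Cell f h R J :=
  compTo (Row.cons τ (Row.single σ) e) (S.unitR J) (E.lawful.vcomp_one f) (E.lawful.vcomp_one h)

/-- The action of an arrow on generalized elements of units. -/
noncomputable abbrev uon {f : E.Hom A Y} {g : E.Hom B Y} {P : E.Path A B} (k : E.Hom Y Y')
    (σ : E.Cell f g P (S.unit Y)) : E.Cell (E.vcomp f k) (E.vcomp g k) P (S.unit Y') :=
  E.comp (Row.single σ) (S.unitMap k)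

theorem ulact_uid {f : E.Hom A Y} {g : E.Hom B Y'} {P : E.Path A B} {J : E.Pro Y Y'}
    (τ : E.Cell f g P J) (e : (ProPath.nil A).append P = P) : S.ulact (S.uid f) τ e = τ := by
  have h : VComp (Row.single τ) (row₂ (S.unitCell Y) (E.idCell J))
      (Row.cons (S.uid f) (Row.single τ) e) := VComp.cons₀ _ _ _ (VComp.idRow_right _) _ _
  exact (h.comp_eq (S.unitL J) (VDC.one_one _) (VDC.one_one _) (E.lawful.vcomp_one _)
    (E.lawful.vcomp_one _) _ _).symm.trans ((congrArg (fun β => compTo (Row.single τ) β _ _)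
      (S.unitL_spec J)).trans (VDC.compTo_single_idCell _ _ _))

theorem uract_uid {f : E.Hom A Y} {g : E.Hom B Y'} {P : E.Path A B} {J : E.Pro Y Y'}
    (τ : E.Cell f g P J) (e : P.append (ProPath.nil B) = P) : S.uract τ (S.uid g) e = τ := by
  have h : VComp (Row.single τ) (row₂ (E.idCell J) (S.unitCell Y'))
      (Row.cons τ (Row.single (S.uid g)) e) :=
    VComp.cons_id _ (VComp.cons₀ _ _ _ (.nil _ _ (E.lawful.vcomp_one _)) rfl rfl) _ _
  exact (h.comp_eq (S.unitR J) (VDC.one_one _) (VDC.one_one _) (E.lawful.vcomp_one _)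
    (E.lawful.vcomp_one _) _ _).symm.trans ((congrArg (fun β => compTo (Row.single τ) β _ _)
      (S.unitR_spec J)).trans (VDC.compTo_single_idCell _ _ _))

/-- The row of the left action of a unit on the first proarrow of a list. -/
theorem comp_unitL_row {f : E.Hom A Y} {g : E.Hom Z Y'} {J : E.Pro A B} {Γ : E.Path B Z}
    {K : E.Pro Y Y'} (α : E.Cell f g (ProPath.cons J Γ) K) :
    compTo (Row.cons (S.unitL J) (E.idRow Γ) rfl) α (E.lawful.one_vcomp f) (E.lawful.one_vcomp g) =
      compTo (Row.cons (S.unitMap f) (Row.single α) rfl) (S.unitL K) (E.lawful.vcomp_one f)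
        (E.lawful.vcomp_one g) := by
  -- After insertion of a unit in front, both sides equal `α`: on the left the unit acts trivially
  -- on `J`, on the right `unitMap f` turns it into the identity of the unit at `f`, which acts
  -- trivially on `K`.
  refine (UnitInsert.here (S := S) (ProPath.cons J Γ)).ext (φ := α) ?_ ?_
  · have h := VComp.cons₂ (S.unitCell A) (E.idCell J) (S.unitL J) (VDC.one_one _) (VDC.one_one _)
      (VComp.idRow_left (E.idRow Γ)) rfl rfl rfl rfl rfl
    refine (h.comp_eq α _ _ _ _ (E.lawful.one_vcomp f) (E.lawful.one_vcomp g)).trans ?_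
    erw [S.unitL_spec J]
    exact VDC.compTo_idRow α _ _
  · have h : VComp (Row.cons (S.unitCell A) (E.idRow (ProPath.cons J Γ)) rfl)
        (Row.cons (S.unitMap f) (Row.single α) rfl)
        (Row.cons (compTo (Row.single (S.unitCell A)) (S.unitMap f) (E.lawful.one_vcomp f)
          (E.lawful.one_vcomp f)) (Row.single α) rfl) :=
      VComp.cons₁ _ _ _ _ (VComp.idRow_left _) _ _
    refine (h.comp_eq (S.unitL K) _ _ _ _ (E.lawful.vcomp_one f) (E.lawful.vcomp_one g)).trans ?_
    rw [S.unitMap_spec]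
    exact S.ulact_uid α rfl

/-- Every 2-cell of `E` respects the left action of units; this is `comp_unitL_row` precomposed with
a row of elements. -/
theorem ulact_comp {f : E.Hom X Y} {g : E.Hom Z Y'} {J : E.Pro X B} {Γ : E.Path B Z}
    {K : E.Pro Y Y'} (α : E.Cell f g (ProPath.cons J Γ) K) {A₁ A₂ A₃ A₄ : E.Obj}
    {h₁ : E.Hom A₁ X} {h₂ : E.Hom A₂ X} {h₃ : E.Hom A₃ B} {h₄ : E.Hom A₄ Z} {P : E.Path A₁ A₂}
    {P₁ : E.Path A₂ A₃} {P₂ : E.Path A₃ A₄} {P₁₂ : E.Path A₂ A₄} {Q : E.Path A₁ A₃}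
    {R : E.Path A₁ A₄} (σ : E.Cell h₁ h₂ P (S.unit X)) (τ : E.Cell h₂ h₃ P₁ J)
    (ρ : E.Row h₃ h₄ P₂ Γ) (e : P₁.append P₂ = P₁₂) (e' : P.append P₁ = Q)
    (e'' : Q.append P₂ = R) (e₃ : P.append P₁₂ = R) :
    E.comp (Row.cons (S.ulact σ τ e') ρ e'') α =
      S.ulact (S.uon f σ) (E.comp (Row.cons τ ρ e) α) e₃ := by
  have H : VComp (Row.cons σ (Row.cons τ ρ e) e₃) (Row.cons (S.unitL J) (E.idRow Γ) rfl)
      (Row.cons (S.ulact σ τ e') ρ e'') :=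
    VComp.cons₂ _ _ _ _ _ (VComp.idRow_right _) _ _ _ _ _
  have H' : VComp (Row.cons σ (Row.cons τ ρ e) e₃) (Row.cons (S.unitMap f) (Row.single α) rfl)
      (Row.cons (S.uon f σ) (Row.single (E.comp (Row.cons τ ρ e) α)) e₃) :=
    VComp.cons₁ _ _ rfl rfl (VComp.single _ _ rfl rfl) _ _
  exact H.congr H' (β := α) (β' := S.unitL K) (S.comp_unitL_row α) rfl rfl _ _

theorem ulact_comp_nil {f : E.Hom A Y} {g' : E.Hom A Y'} {K : E.Pro Y Y'}
    (α : E.Cell f g' (ProPath.nil A) K) {X X' : E.Obj} {h : E.Hom X A} {k : E.Hom X' A}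
    {P : E.Path X X'} (σ : E.Cell h k P (S.unit A)) (e : P.append (ProPath.nil X') = P)
    (e' : (ProPath.nil X).append P = P) :
    S.ulact (S.uon f σ) (E.comp (Row.nil k) α) e = S.uract (E.comp (Row.nil h) α) (S.uon g' σ) e' := by
  have key : compTo (Row.cons (S.unitMap f) (Row.single α) (Θ := ProPath.single _) rfl) (S.unitL K)
      (E.lawful.vcomp_one f) (E.lawful.vcomp_one g') =
      compTo (Row.cons α (Row.single (S.unitMap g')) rfl) (S.unitR K) (E.lawful.vcomp_one f)
        (E.lawful.vcomp_one g') := by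
    -- Inserting a unit into the empty list makes both sides equal to `α`, since the identity of a
    -- unit acts trivially on either side.
    refine (UnitInsert.here (S := S) (ProPath.nil A)).ext (φ := α) ?_ ?_
    · have h : VComp (Row.cons (S.unitCell A) (E.idRow (ProPath.nil A)) (Θ := ProPath.nil A) rfl)
          (Row.cons (S.unitMap f) (Row.single α) (Θ := ProPath.single _) rfl)
          (Row.cons (compTo (Row.single (S.unitCell A)) (S.unitMap f) (E.lawful.one_vcomp f)
            (E.lawful.one_vcomp f)) (Row.single α) rfl) :=
        VComp.cons₁ _ _ _ _ (VComp.idRow_left _) _ _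
      refine (h.comp_eq (S.unitL K) _ _ _ _ (E.lawful.vcomp_one f) (E.lawful.vcomp_one g')).trans ?_
      rw [S.unitMap_spec]
      exact S.ulact_uid α rfl
    · have h : VComp (Row.cons (S.unitCell A) (E.idRow (ProPath.nil A)) (Θ := ProPath.nil A) rfl)
          (Row.cons α (Row.single (S.unitMap g')) (Θ := ProPath.single _) rfl)
          (Row.cons α (Row.single (compTo (Row.single (S.unitCell A)) (S.unitMap g')
            (E.lawful.one_vcomp g') (E.lawful.one_vcomp g'))) rfl) :=
        VComp.cons₀_one _ (VComp.single _ _ _ _) _ _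
      refine (h.comp_eq (S.unitR K) _ _ _ _ (E.lawful.vcomp_one f) (E.lawful.vcomp_one g')).trans ?_
      rw [S.unitMap_spec]
      exact S.uract_uid α rfl
  have H : VComp (Row.single σ)
      (Row.cons (S.unitMap f) (Row.single α) (Θ := ProPath.single _) rfl)
      (Row.cons (S.uon f σ) (Row.single (E.comp (Row.nil k) α)) e) :=
    VComp.cons₁ _ _ rfl rfl (VComp.single _ _ rfl rfl) _ _
  have H' : VComp (Row.single σ)
      (Row.cons α (Row.single (S.unitMap g')) rfl)
      (Row.cons (E.comp (Row.nil h) α) (Row.single (S.uon g' σ)) e') :=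
    VComp.cons₀ _ rfl rfl (VComp.single _ _ rfl rfl) _ _
  exact H.congr H' (β := S.unitL K) (β' := S.unitR K) key _ _ _ _

end

end VDC.EquipmentData

namespace VDC.EquipmentData

variable (S : E.EquipmentData)

/-! ### The right action -/

/-- The row of the right action of a unit on the last proarrow of a list. -/
inductive URight : ∀ {A B : E.Obj} {Γ : E.Path A B},
    E.Row (E.one A) (E.one B) (Γ.append (ProPath.single (S.unit B))) Γ → Prop
  | last {A B : E.Obj} (J : E.Pro A B) :
      URight (Γ := ProPath.single J) (Row.single (S.unitR J))
  | there {A B Z : E.Obj} (J : E.Pro Z A) {Γ : E.Path A B}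
      {Q : E.Row (E.one A) (E.one B) (Γ.append (ProPath.single (S.unit B))) Γ} (H : URight Q) :
      URight (Γ := ProPath.cons J Γ) (Row.cons (E.idCell J) Q rfl)

/-- A generalized element of a unit acts on the last component of a row. -/
inductive URAct : ∀ {A B Z X Y : E.Obj} {f : E.Hom A X} {g : E.Hom B Y} {h : E.Hom Z Y}
    {P : E.Path A B} {Q : E.Path B Z} {R : E.Path A Z} {Γ : E.Path X Y}
    (_ : E.Row f g P Γ) (_ : E.Cell g h Q (S.unit Y)) (_ : E.Row f h R Γ), Prop
  | last {A B Z X Y : E.Obj} {J : E.Pro X Y} {f : E.Hom A X} {g : E.Hom B Y}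
      {h : E.Hom Z Y} {P P' : E.Path A B} {Q : E.Path B Z} {R R' : E.Path A Z}
      (τ : E.Cell f g P J) (σ : E.Cell g h Q (S.unit Y))
      (e : P.append (ProPath.nil B) = P') (e' : P.append Q = R)
      (e'' : R.append (ProPath.nil Z) = R') :
      URAct (Row.cons τ (Row.nil g) e) σ (Row.cons (S.uract τ σ e') (Row.nil h) e'')
  | there {A B X Z A' B' Z' : E.Obj} {J : E.Pro A' B'} {Γ : E.Path B' Z'} {f : E.Hom A A'}
      {g : E.Hom B B'} {k : E.Hom X Z'} {h : E.Hom Z Z'} {P : E.Path A B}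
      {P₁ : E.Path B X} {Q : E.Path X Z} {P₂ : E.Path B Z} {R : E.Path A X} {R' : E.Path A Z}
      (τ : E.Cell f g P J) {ρ : E.Row g k P₁ Γ} {σ : E.Cell k h Q (S.unit Z')}
      {ρ' : E.Row g h P₂ Γ} (H : URAct ρ σ ρ') (e : P.append P₁ = R)
      (e' : P.append P₂ = R') :
      URAct (Row.cons τ ρ e) σ (Row.cons τ ρ' e')

variable {S}

/-- The right action on the last proarrow undoes the insertion of a unit at the end. The description
of `I` as a concatenation is what allows a composition with `α` beside `unitMap`. -/
theorem URight.exists_insert {A B : E.Obj} {Γ : E.Path A B}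
    {Q : E.Row (E.one A) (E.one B) (Γ.append (ProPath.single (S.unit B))) Γ} (H : S.URight Q) :
    ∃ I, S.UnitInsert I ∧ VComp I Q (E.idRow Γ) ∧
      (E.idRow Γ).IsAppend (Row.single (S.unitCell B)) I := by
  induction H with
  | @last A B J =>
    refine ⟨_, .there J (.here (ProPath.nil B)), ?_, .cons _ (.nil _) rfl rfl⟩
    have := VComp.single (row₂ (E.idCell J) (S.unitCell B)) (S.unitR J) (VDC.one_one _)
      (VDC.one_one _)
    rw [S.unitR_spec J] at this
    exact this
  | there J H ih =>
    obtain ⟨I, h₁, h₂, h₃⟩ := ih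
    exact ⟨_, .there J h₁, VComp.id_cons _ h₂ _ _, .cons _ h₃ rfl rfl⟩

theorem URAct.exists_uright {A B Z X Y : E.Obj} {f : E.Hom A X} {g : E.Hom B Y} {h : E.Hom Z Y}
    {P : E.Path A B} {Q : E.Path B Z} {R : E.Path A Z} {Γ : E.Path X Y}
    {ρ : E.Row f g P Γ} {σ : E.Cell g h Q (S.unit Y)} {ρ' : E.Row f h R Γ} (H : S.URAct ρ σ ρ') :
    ∃ (π : E.Row f h R (Γ.append (ProPath.single (S.unit Y))))
      (Q : E.Row (E.one X) (E.one Y) (Γ.append (ProPath.single (S.unit Y))) Γ),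
      ρ.IsAppend (Row.single σ) π ∧ S.URight Q ∧ VComp π Q ρ' := by
  induction H with
  | @last _ _ _ _ _ J _ _ _ _ _ _ _ _ τ σ e e' e'' =>
    have e₀ := (ProPath.append_nil _).symm.trans e''
    subst e₀
    exact ⟨Row.cons τ (Row.single σ) e', Row.single (S.unitR J), .cons τ (.nil _) e e',
      .last J, VComp.single _ _ _ _⟩
  | there τ H e e' ih =>
    obtain ⟨π, Q, h₁, h₂, h₃⟩ := ih
    exact ⟨Row.cons τ π e', Row.cons (E.idCell _) Q rfl, .cons τ h₁ e e', .there _ h₂,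
      VComp.cons_id τ h₃ _ _⟩

theorem URight.comp_eq {A B : E.Obj} {Γ : E.Path A B}
    {Q : E.Row (E.one A) (E.one B) (Γ.append (ProPath.single (S.unit B))) Γ} (H : S.URight Q)
    {Y Y' : E.Obj} {f : E.Hom A Y} {g : E.Hom B Y'} {K : E.Pro Y Y'} (α : E.Cell f g Γ K) :
    compTo Q α (E.lawful.one_vcomp f) (E.lawful.one_vcomp g) =
      compTo (Row.cons α (Row.single (S.unitMap g)) rfl) (S.unitR K) (E.lawful.vcomp_one f)
        (E.lawful.vcomp_one g) := by
  obtain ⟨I, h₁, h₂, h₃⟩ := H.exists_insert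
  refine h₁.ext (φ := α) ?_ ?_
  · exact (h₂.comp_eq α _ _ _ _ (E.lawful.one_vcomp f) (E.lawful.one_vcomp g)).trans
      (VDC.compTo_idRow α _ _)
  · have h : VComp I (Row.cons α (Row.single (S.unitMap g)) rfl)
        (Row.cons (compTo (E.idRow Γ) α (E.lawful.one_vcomp f) (E.lawful.one_vcomp g))
          (Row.single (compTo (Row.single (S.unitCell B)) (S.unitMap g) (E.lawful.one_vcomp g)
          (E.lawful.one_vcomp g))) (ProPath.append_nil Γ)) :=
      .cons h₃ α _ _ (VComp.single _ _ _ _) _ _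
    rw [S.unitMap_spec, VDC.compTo_idRow] at h
    refine (h.comp_eq (S.unitR K) _ _ _ _ (E.lawful.vcomp_one f) (E.lawful.vcomp_one g)).trans ?_
    exact S.uract_uid α _

theorem URAct.comp_eq {A B Z X Y : E.Obj} {f : E.Hom A X} {g : E.Hom B Y} {h : E.Hom Z Y}
    {P : E.Path A B} {Q : E.Path B Z} {R : E.Path A Z} {Γ : E.Path X Y}
    {ρ : E.Row f g P Γ} {σ : E.Cell g h Q (S.unit Y)} {ρ' : E.Row f h R Γ} (H : S.URAct ρ σ ρ')
    {X' Y' : E.Obj} {k : E.Hom X X'} {l : E.Hom Y Y'} {K : E.Pro X' Y'} (α : E.Cell k l Γ K)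
    (e : P.append Q = R) : E.comp ρ' α = S.uract (E.comp ρ α) (S.uon l σ) e := by
  obtain ⟨π, Q, h₁, h₂, h₃⟩ := H.exists_uright
  have h₄ : VComp π (Row.cons α (Row.single (S.unitMap l)) rfl)
      (Row.cons (E.comp ρ α) (Row.single (S.uon l σ)) e) :=
    .cons h₁ _ rfl rfl (VComp.single _ _ rfl rfl) _ _
  exact h₃.congr h₄ (β := α) (β' := S.unitR K) (h₂.comp_eq α) rfl rfl _ _

variable (S)

/-! ### The inner actions -/

/-- The two rows by which a unit acts on the proarrows before and after it. -/
inductive UInner : ∀ {A B : E.Obj} {Γ Γ' : E.Path A B},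
    E.Row (E.one A) (E.one B) Γ' Γ → E.Row (E.one A) (E.one B) Γ' Γ → Prop
  | here {A B C D : E.Obj} (J : E.Pro A B) (J' : E.Pro B C) (Γ : E.Path C D) :
      UInner (Row.cons (S.unitR J) (Row.cons (E.idCell J') (E.idRow Γ) rfl) rfl)
        (Row.cons (E.idCell J) (Row.cons (S.unitL J') (E.idRow Γ) rfl) rfl)
  | there {A B Z : E.Obj} (J : E.Pro Z A) {Γ Γ' : E.Path A B}
      {Q Q' : E.Row (E.one A) (E.one B) Γ' Γ} (H : UInner Q Q') :
      UInner (Row.cons (E.idCell J) Q rfl) (Row.cons (E.idCell J) Q' rfl)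

/-- A generalized element of a unit is moved from the component before it to the component after
it. -/
inductive UIAct : ∀ {A B X Y : E.Obj} {f : E.Hom A X} {g : E.Hom B Y} {P : E.Path A B}
    {Γ : E.Path X Y} (_ : E.Row f g P Γ) (_ : E.Row f g P Γ), Prop
  | here {C M N D : E.Obj} {J : E.Pro C M} {J' : E.Pro M N} {Γ : E.Path N D}
      {A B X Y Z : E.Obj} {f : E.Hom A C} {g : E.Hom B M} {h : E.Hom X M}
      {k : E.Hom Y N} {l : E.Hom Z D} {P₁ : E.Path A B} {P₂ : E.Path B X}
      {P₃ : E.Path X Y} {P₄ : E.Path Y Z} {P₁₂ : E.Path A X} {P₂₃ : E.Path B Y}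
      {P₃₄ : E.Path X Z} {Q : E.Path B Z} {P : E.Path A Z}
      (τ : E.Cell f g P₁ J) (σ : E.Cell g h P₂ (S.unit M))
      (τ' : E.Cell h k P₃ J') (ρ : E.Row k l P₄ Γ) (e₁ : P₁.append P₂ = P₁₂)
      (e₂ : P₃.append P₄ = P₃₄) (e₃ : P₁₂.append P₃₄ = P) (e₄ : P₂.append P₃ = P₂₃)
      (e₅ : P₂₃.append P₄ = Q) (e₆ : P₁.append Q = P) :
      UIAct (Row.cons (S.uract τ σ e₁) (Row.cons τ' ρ e₂) e₃)
        (Row.cons τ (Row.cons (S.ulact σ τ' e₄) ρ e₅) e₆)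
  | there {A B Z A' B' Z' : E.Obj} {J : E.Pro A' B'} {Γ : E.Path B' Z'} {f : E.Hom A A'}
      {g : E.Hom B B'} {h : E.Hom Z Z'} {P : E.Path A B} {Q : E.Path B Z} {R : E.Path A Z}
      (τ : E.Cell f g P J) {ρ ρ' : E.Row g h Q Γ} (H : UIAct ρ ρ')
      (e : P.append Q = R) : UIAct (Row.cons τ ρ e) (Row.cons τ ρ' e)

variable {S}

/-- Both action rows undo the same insertion of a unit, so by uniqueness of factorization no 2-cell
below them can tell them apart. -/
theorem UInner.exists_insert {A B : E.Obj} {Γ Γ' : E.Path A B}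
    {Q Q' : E.Row (E.one A) (E.one B) Γ' Γ} (H : S.UInner Q Q') :
    ∃ I, S.UnitInsert I ∧ VComp I Q (E.idRow Γ) ∧ VComp I Q' (E.idRow Γ) := by
  induction H with
  | @here A B C D J J' Γ =>
    refine ⟨_, .there J (.here (ProPath.cons J' Γ)), ?_, ?_⟩
    · have := VComp.cons₂ (E.idCell J) (S.unitCell B) (S.unitR J) (VDC.one_one _) (VDC.one_one _)
        (VComp.idRow_left (E.idRow (ProPath.cons J' Γ))) rfl rfl rfl rfl rfl
      erw [S.unitR_spec J] at this
      exact this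
    · have := VComp.cons₂ (S.unitCell B) (E.idCell J') (S.unitL J') (VDC.one_one _) (VDC.one_one _)
        (VComp.idRow_left (E.idRow Γ)) rfl rfl rfl rfl rfl
      erw [S.unitL_spec J'] at this
      exact VComp.id_cons _ this _ _
  | there J H ih =>
    obtain ⟨I, h₁, h₂, h₃⟩ := ih
    exact ⟨_, .there J h₁, VComp.id_cons _ h₂ _ _, VComp.id_cons _ h₃ _ _⟩

theorem UInner.comp_eq {A B : E.Obj} {Γ Γ' : E.Path A B}
    {Q Q' : E.Row (E.one A) (E.one B) Γ' Γ} (H : S.UInner Q Q')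
    {Y Y' : E.Obj} {f : E.Hom A Y} {g : E.Hom B Y'} {K : E.Pro Y Y'} (α : E.Cell f g Γ K) :
    compTo Q α (E.lawful.one_vcomp f) (E.lawful.one_vcomp g) =
      compTo Q' α (E.lawful.one_vcomp f) (E.lawful.one_vcomp g) := by
  obtain ⟨I, h₁, h₂, h₃⟩ := H.exists_insert
  refine h₁.ext (φ := α) ?_ ?_
  · exact (h₂.comp_eq α _ _ _ _ (E.lawful.one_vcomp f) (E.lawful.one_vcomp g)).trans
      (VDC.compTo_idRow α _ _)
  · exact (h₃.comp_eq α _ _ _ _ (E.lawful.one_vcomp f) (E.lawful.one_vcomp g)).trans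
      (VDC.compTo_idRow α _ _)

theorem UIAct.exists_uinner {A B X Y : E.Obj} {f : E.Hom A X} {g : E.Hom B Y} {P : E.Path A B}
    {Γ : E.Path X Y} {ρ ρ' : E.Row f g P Γ} (H : S.UIAct ρ ρ') :
    ∃ (Γ' : E.Path X Y) (π : E.Row f g P Γ') (Q Q' : E.Row (E.one X) (E.one Y) Γ' Γ),
      S.UInner Q Q' ∧ VComp π Q ρ ∧ VComp π Q' ρ' := by
  induction H with
  | @here C M N D J J' Γ _ _ _ _ _ _ _ _ _ _ P₁ P₂ P₃ P₄ P₁₂ P₂₃ P₃₄ Q P τ σ τ' ρ e₁ e₂ e₃ e₄ e₅ e₆ =>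
    have e : P₁.append (P₂.append P₃₄) = P := by
      subst e₁; subst e₂; subst e₃; rw [ProPath.append_assoc]
    refine ⟨_, Row.cons τ (Row.cons σ (Row.cons τ' ρ e₂) rfl) e, _, _, .here J J' Γ, ?_, ?_⟩
    · exact VComp.cons₂ τ σ _ _ _ (VComp.cons_id τ' (VComp.idRow_right _) _ _) _ _ _ _ _
    · have e₇ : Q = P₂.append P₃₄ := by
        subst e₂; subst e₄; subst e₅; rw [ProPath.append_assoc]
      subst e₇
      exact VComp.cons_id τ (VComp.cons₂ σ τ' _ _ _ (VComp.idRow_right _) _ _ _ _ _) _ _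
  | there τ H e ih =>
    obtain ⟨Γ', π, Q, Q', h₁, h₂, h₃⟩ := ih
    exact ⟨_, Row.cons τ π e, _, _, .there _ h₁, VComp.cons_id τ h₂ _ _, VComp.cons_id τ h₃ _ _⟩

/-- Every 2-cell is invariant under moving elements of units. This yields the inner law of `|α|` as
well as the composites of companions and conjoints. -/
theorem UIAct.comp_eq {A B X Y : E.Obj} {f : E.Hom A X} {g : E.Hom B Y} {P : E.Path A B}
    {Γ : E.Path X Y} {ρ ρ' : E.Row f g P Γ} (H : S.UIAct ρ ρ') {X' Y' : E.Obj} {k : E.Hom X X'}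
    {l : E.Hom Y Y'} {K : E.Pro X' Y'} (α : E.Cell k l Γ K) : E.comp ρ α = E.comp ρ' α := by
  obtain ⟨Γ', π, Q, Q', h₁, h₂, h₃⟩ := H.exists_uinner
  exact h₂.congr h₃ (β := α) (β' := α) (h₁.comp_eq α) rfl rfl rfl rfl

/-! ### The unital structure of units -/

variable (S)

/-- By uniqueness of factorization: both 2-cells restrict to the unit 2-cell. The composite of
arrows is treated in the same way. -/
theorem unitMap_one (A : E.Obj) : S.unitMap (E.one A) = E.idCell (S.unit A) := by
  refine (UnitInsert.here (S := S) (ProPath.nil A)).ext (φ := S.unitCell A) ?_ ?_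
  · refine (S.unitMap_spec (E.one A)).trans ?_
    exact VDC.compTo_idRow (S.unitCell A) _ _
  · exact VDC.compTo_single_idCell (S.unitCell A) _ _

theorem uon_one {A B Y : E.Obj} {f : E.Hom A Y} {g : E.Hom B Y} {P : E.Path A B}
    (σ : E.Cell f g P (S.unit Y)) : S.uon (E.one Y) σ =
      reframe (E.lawful.vcomp_one f).symm (E.lawful.vcomp_one g).symm σ := by
  rw [uon, unitMap_one]
  exact eq_of_heq (((VDC.compTo_heq _ _ (E.lawful.vcomp_one _) (E.lawful.vcomp_one _)).symm.trans
    (heq_of_eq (VDC.compTo_single_idCell σ _ _))).trans (VDC.reframe_heq _ _ _).symm)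

theorem uon_uid {A Y Z : E.Obj} (f : E.Hom A Y) (k : E.Hom Y Z) :
    S.uon k (S.uid f) = S.uid (E.vcomp f k) := by
  have h₁ : VComp (Row.nil f) (Row.single (S.unitCell Y)) (Row.single (S.uid f)) :=
    VComp.single _ _ _ _
  have h₂ : VComp (Row.nil f) (Row.nil k) (Row.nil (E.vcomp f k)) := .nil _ _ rfl
  exact h₁.congr h₂ (β := S.unitMap k) (β' := S.unitCell Z) (S.unitMap_spec k) rfl rfl _ _

theorem unitMap_vcomp {A B C : E.Obj} (f : E.Hom A B) (g : E.Hom B C) :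
    S.unitMap (E.vcomp f g) = S.uon g (S.unitMap f) := by
  refine (UnitInsert.here (S := S) (ProPath.nil A)).ext (φ := S.uid (E.vcomp f g)) ?_ ?_
  · exact S.unitMap_spec _
  · refine ((VComp.single (Row.single (S.unitCell A)) (S.unitMap f) (E.lawful.one_vcomp f)
      (E.lawful.one_vcomp f)).comp_eq (S.unitMap g) rfl rfl _ _ rfl rfl).trans ?_
    rw [S.unitMap_spec]
    exact S.uon_uid f g

/-- A 2-cell out of `U, U` is determined after inserting both units, and inserting them in either
order gives the same row of two unit 2-cells. The two unit laws then settle the comparison. -/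
theorem unitL_unit (A : E.Obj) : S.unitL (S.unit A) = S.unitR (S.unit A) := by
  refine (UnitInsert.here (S := S) (ProPath.single (S.unit A))).ext (φ := E.idCell (S.unit A))
    (S.unitL_spec _) ?_
  refine (UnitInsert.here (S := S) (ProPath.nil A)).ext (φ := S.unitCell A) ?_
    (VDC.compTo_single_idCell (S.unitCell A) _ _)
  have h : VComp (Row.single (S.unitCell A)) (row₂ (S.unitCell A) (E.idCell (S.unit A)))
      (row₂ (S.unitCell A) (S.unitCell A)) :=
    VComp.cons₀_one _ (VComp.idRow_right _) rfl rfl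
  have h' : VComp (Row.single (S.unitCell A)) (row₂ (E.idCell (S.unit A)) (S.unitCell A))
      (row₂ (S.unitCell A) (S.unitCell A)) :=
    VComp.cons_id _ (.idRow_left _) rfl rfl
  have o := VDC.one_one A
  exact (h.comp_eq (S.unitR (S.unit A)) o o o o o o).trans
    ((h'.comp_eq (S.unitR (S.unit A)) o o o o o o).symm.trans ((congrArg (fun β =>
      compTo (Row.single (S.unitCell A)) β o o) (S.unitR_spec (S.unit A))).trans
        (VDC.compTo_single_idCell _ _ _)))

end VDC.EquipmentData

/-! ### One-object enriched categories on units, and representatives -/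

namespace VDC.EquipmentData

variable (S : E.EquipmentData)

/-- The enriched category with one object, whose hom is the unit of `Y`. -/
noncomputable def unitCat (Y : E.Obj) : EnrichedCatData.{u, v, p, c, 0} E where
  Obj := PUnit
  ext _ := Y
  hom _ _ := S.unit Y
  id _ := S.unitCell Y
  comp _ _ _ := S.unitL (S.unit Y)

/-- A proarrow as a profunctor between enriched categories with one object. -/
noncomputable def unitProf {Y Z : E.Obj} (J : E.Pro Y Z) :
    ProfData (S.unitCat Y) (S.unitCat Z) where
  pro _ _ := J
  actL _ _ _ := S.unitL J
  actR _ _ _ := S.unitR J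

/-- Associativity and exchange express that the 2-cells `unitL J` and `unitR J` respect the unit
actions, like every 2-cell; their vertical boundaries are identities, so `unitMap` contributes
nothing. -/
theorem unitProf_isLawful {Y Z : E.Obj} (J : E.Pro Y Z) : (S.unitProf J).IsLawful where
  id_actL _ _ := S.unitL_spec J
  actR_id _ _ := S.unitR_spec J
  comp_actL _ _ _ _ := by
    have h := S.comp_unitL_row (S.unitL J)
    rw [S.unitMap_one] at h
    exact VDC.compTo_frame h rfl rfl rfl rfl
  actR_comp _ _ _ _ := by
    have h := (URight.there J (URight.last (S := S) (S.unit Z))).comp_eq (S.unitR J)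
    rw [S.unitMap_one, ← S.unitL_unit] at h
    exact VDC.compTo_frame h rfl rfl rfl rfl
  exchange _ _ _ _ := by
    have h := (URight.there (S.unit Y) (URight.last (S := S) J)).comp_eq (S.unitL J)
    rw [S.unitMap_one] at h
    exact (VDC.compTo_frame h rfl rfl rfl rfl).symm

/-! ### Composites with the cartesian 2-cells of representatives -/

variable {A B Z Y Y' : E.Obj}

/-- The structure of a representative consists of lifts, so `cart` translates it into the structure
of the unit. The next three lemmas do this for composition and the two actions. -/
theorem cart_rep_id (x : (repCat S Y).Obj) (f : E.Hom A x.1) :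
    S.cart ((repCat S Y).idAt (a := x) f) = S.uid (E.vcomp f x.2) := by
  refine (S.cart_compTo _ _ _ _).trans ?_
  refine (congrArg (fun β => compTo _ β _ _) (S.cart_lift _)).trans ?_
  exact (VComp.nil f x.2 rfl).comp_eq _ _ _ _ _ _ _

theorem cart_rep_mul {x y z : (repCat S Y).Obj} {f : E.Hom A x.1} {g : E.Hom B y.1}
    {h : E.Hom Z z.1} {P : E.Path A B} {Q : E.Path B Z} {R : E.Path A Z}
    (σ : E.Cell f g P ((repCat S Y).hom x y)) (τ : E.Cell g h Q ((repCat S Y).hom y z))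
    (e : P.append Q = R) :
    S.cart ((repCat S Y).mul σ τ e) = S.ulact (S.cart σ) (S.cart τ) e := by
  refine (S.cart_compTo _ _ _ _).trans ?_
  refine (congrArg (fun β => compTo _ β _ _) (S.cart_lift _)).trans ?_
  exact (VComp.cons₁ _ _ rfl rfl (VComp.single _ _ rfl rfl) _ rfl).comp_eq _ _ _ _ _ _ _

theorem cart_rep_lact {J : E.Pro Y Y'} {x x' : (repCat S Y).Obj} {y : (repCat S Y').Obj}
    {f : E.Hom A x.1} {g : E.Hom B x'.1}
    {h : E.Hom Z y.1} {P : E.Path A B} {Q : E.Path B Z} {R : E.Path A Z}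
    (σ : E.Cell f g P ((repCat S Y).hom x x')) (τ : E.Cell g h Q ((repProf S J).pro x' y))
    (e : P.append Q = R) :
    S.cart ((repProf S J).lact σ τ e) = S.ulact (S.cart σ) (S.cart τ) e := by
  refine (S.cart_compTo _ _ _ _).trans ?_
  refine (congrArg (fun β => compTo _ β _ _) (S.cart_lift _)).trans ?_
  exact (VComp.cons₁ _ _ rfl rfl (VComp.single _ _ rfl rfl) _ rfl).comp_eq _ _ _ _ _ _ _

theorem cart_rep_ract {J : E.Pro Y Y'} {x : (repCat S Y).Obj} {y y' : (repCat S Y').Obj}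
    {f : E.Hom A x.1} {g : E.Hom B y.1}
    {h : E.Hom Z y'.1} {P : E.Path A B} {Q : E.Path B Z} {R : E.Path A Z}
    (τ : E.Cell f g P ((repProf S J).pro x y)) (σ : E.Cell g h Q ((repCat S Y').hom y y'))
    (e : P.append Q = R) :
    S.cart ((repProf S J).ract τ σ e) = S.uract (S.cart τ) (S.cart σ) e := by
  refine (S.cart_compTo _ _ _ _).trans ?_
  refine (congrArg (fun β => compTo _ β _ _) (S.cart_lift _)).trans ?_
  exact (VComp.cons₁ _ _ rfl rfl (VComp.single _ _ rfl rfl) _ rfl).comp_eq _ _ _ _ _ _ _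

/-- Under `cart` the laws of `|J|` become those of the profunctor `unitProf J` between one-object
categories, evaluated at elements with arbitrary boundaries. -/
theorem repProf_isLawful (J : E.Pro Y Y') : (repProf S J).IsLawful := by
  have H := S.unitProf_isLawful J
  refine ProfData.isLawful_of_elem _ ?_ ?_ ?_ ?_ ?_
  · intro a d A B f g P τ e
    refine S.cart_injective ((S.cart_rep_lact _ _ _).trans ?_)
    exact (congrArg (S.ulact · (S.cart τ) e) (S.cart_rep_id a f)).trans (S.ulact_uid _ e)
  · intro a d A B f g P τ e
    refine S.cart_injective ((S.cart_rep_ract _ _ _).trans ?_)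
    exact (congrArg (S.uract (S.cart τ) · e) (S.cart_rep_id d g)).trans (S.uract_uid _ e)
  · intro a a' a'' d A B X Z f g h k P Q R PQ QR T σ σ' τ e₁ e₂ e₃ e₄
    refine S.cart_injective ((S.cart_rep_lact _ _ _).trans (.trans ?_ (S.cart_rep_lact _ _ _).symm))
    refine (congrArg (S.ulact · (S.cart τ) e₂) (S.cart_rep_mul σ σ' e₁)).trans (.trans ?_
      (congrArg (S.ulact (S.cart σ) · e₄) (S.cart_rep_lact σ' τ e₃)).symm)
    exact H.lact_mul (a := PUnit.unit) (a' := PUnit.unit) (a'' := PUnit.unit) (d := PUnit.unit) _ _ _ e₁ e₂ e₃ e₄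
  · intro a d d' d'' A B X Z f g h k P Q R PQ QR T τ σ σ' e₁ e₂ e₃ e₄
    refine S.cart_injective ((S.cart_rep_ract _ _ _).trans (.trans ?_ (S.cart_rep_ract _ _ _).symm))
    refine (congrArg (S.uract (S.cart τ) · e₄) (S.cart_rep_mul σ σ' e₃)).trans (.trans ?_
      (congrArg (S.uract · (S.cart σ') e₂) (S.cart_rep_ract τ σ e₁)).symm)
    exact H.ract_mul (a := PUnit.unit) (d := PUnit.unit) (d' := PUnit.unit) (d'' := PUnit.unit) _ _ _ e₁ e₂ e₃ e₄
  · intro a a' d d' A B X Z f g h k P Q R PQ QR T σ τ σ' e₁ e₂ e₃ e₄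
    refine S.cart_injective ((S.cart_rep_ract _ _ _).trans (.trans ?_ (S.cart_rep_lact _ _ _).symm))
    refine (congrArg (S.uract · (S.cart σ') e₂) (S.cart_rep_lact σ τ e₁)).trans (.trans ?_
      (congrArg (S.ulact (S.cart σ) · e₄) (S.cart_rep_ract τ σ' e₃)).symm)
    exact H.ract_lact (a := PUnit.unit) (a' := PUnit.unit) (d := PUnit.unit) (d' := PUnit.unit) _ _ _ e₁ e₂ e₃ e₄

/-- The homs of `|Y|` are the components of `|U_Y|`, so the laws are those of that profunctor. -/
theorem repCat_isLawful (Y : E.Obj) : (repCat S Y).IsLawful where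
  id_comp a b := (S.repProf_isLawful (S.unit Y)).id_actL a b
  comp_id a b := by
    have h := (S.repProf_isLawful (S.unit Y)).actR_id a b
    -- Composition in `|Y|` is defined by `unitL`, but the right action of `|U_Y|` by `unitR`.
    simp only [repProf, ← S.unitL_unit] at h
    exact h
  assoc a b d e := (S.repProf_isLawful (S.unit Y)).comp_actL a b d e

theorem cart_rep_map (k : E.Hom Y Y') {x y : (repCat S Y).Obj} {f : E.Hom A x.1}
    {g : E.Hom B y.1} {P : E.Path A B} (σ : E.Cell f g P ((repCat S Y).hom x y))
    {f' : E.Hom A x.1} {g' : E.Hom B y.1} (hf : E.vcomp f (E.one x.1) = f')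
    (hg : E.vcomp g (E.one y.1) = g') :
    S.cart (compTo (Row.single σ) ((repFunctor S k).map x y) hf hg) =
      compTo (Row.single (S.cart σ)) (S.unitMap k)
        ((E.lawful.vcomp_assoc _ _ _).trans
          (congrArg (E.vcomp · _) ((E.lawful.vcomp_one f).symm.trans hf)))
        ((E.lawful.vcomp_assoc _ _ _).trans
          (congrArg (E.vcomp · _) ((E.lawful.vcomp_one g).symm.trans hg))) := by
  refine (S.cart_compTo _ _ hf hg).trans ?_
  refine (congrArg (fun β => compTo _ β _ _) (S.cart_lift _)).trans ?_
  exact (VComp.single (Row.single σ) _ rfl rfl).comp_eq _ _ _ _ _ _ _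

/-- After `cart`, preservation of identities is the defining property of `unitMap k`, and
preservation of composition says that the 2-cell `unitMap k` respects the left action of units. -/
theorem repFunctor_isLawful (k : E.Hom Y Y') : (repFunctor S k).IsLawful where
  map_id x := by
    refine S.cart_injective ((S.cart_rep_map k ((repCat S Y).id x) rfl rfl).trans
      (.trans ?_ (S.cart_compTo _ _ _ _).symm))
    refine (congrArg (fun σ => compTo (Row.single σ) (S.unitMap k) _ _) (S.cart_lift _)).trans
      (.trans ?_ (congrArg (fun σ => compTo (Row.nil (E.one x.1)) σ _ _) (S.cart_lift _)).symm)
    have h₁ : VComp (Row.nil x.2) (Row.single (S.unitCell Y)) (Row.single (compTo (Row.nil x.2)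
        (S.unitCell Y) (VDC.vcomp_one_eq _) (VDC.vcomp_one_eq _))) := VComp.single _ _ _ _
    have h₂ : VComp (Row.nil x.2) (Row.nil k) (Row.nil (E.vcomp (E.one x.1) (E.vcomp x.2 k))) :=
      .nil _ _ (E.lawful.one_vcomp _).symm
    have h₃ : VComp (Row.nil (E.one x.1)) (Row.nil (E.vcomp x.2 k))
      (Row.nil (E.vcomp (E.one x.1) (E.vcomp x.2 k))) := .nil _ _ rfl
    have e : E.vcomp (E.vcomp (E.one x.1) (E.vcomp x.2 k)) (E.one Y') =
      E.vcomp (E.vcomp (E.one x.1) (E.one x.1)) (E.vcomp x.2 k) := by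
      rw [VDC.one_one, E.lawful.vcomp_one]
    exact (h₁.congr h₂ (β := S.unitMap k) (β' := S.unitCell Y') (S.unitMap_spec k) _ _ e e).trans
      (h₃.comp_eq _ _ _ _ _ _ _).symm
  map_comp x y z := by
    refine S.cart_injective ((S.cart_rep_map k ((repCat S Y).comp x y z) rfl rfl).trans
      (.trans ?_ (S.cart_compTo _ _ _ _).symm))
    refine (congrArg (fun σ => compTo (Row.single σ) (S.unitMap k) _ _) (S.cart_lift _)).trans
      (.trans ?_ (congrArg (fun σ => compTo (row₂ ((repFunctor S k).map x y)
        ((repFunctor S k).map y z)) σ _ _) (S.cart_lift _)).symm)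
    have h₁ : VComp (row₂ (S.restrCell x.2 y.2 (S.unit Y)) (S.restrCell y.2 z.2 (S.unit Y)))
        (Row.single (S.unitL (S.unit Y))) (Row.single (compTo (row₂ (S.restrCell x.2 y.2 (S.unit Y))
          (S.restrCell y.2 z.2 (S.unit Y))) (S.unitL (S.unit Y)) (VDC.vcomp_one_eq _)
          (VDC.vcomp_one_eq _))) := VComp.single _ _ _ _
    have h₂ : VComp (row₂ (S.restrCell x.2 y.2 (S.unit Y)) (S.restrCell y.2 z.2 (S.unit Y)))
        (row₂ (S.unitMap k) (S.unitMap k))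
        (row₂ (S.cart ((repFunctor S k).map x y)) (S.cart ((repFunctor S k).map y z))) := by
      have h := VComp.cons₁ (S.restrCell x.2 y.2 (S.unit Y)) (S.unitMap k)
        (E.lawful.one_vcomp _).symm (E.lawful.one_vcomp _).symm
        (VComp.single (Row.single (S.restrCell y.2 z.2 (S.unit Y))) (S.unitMap k)
          (E.lawful.one_vcomp _).symm (E.lawful.one_vcomp _).symm) rfl rfl
      erw [← S.cart_lift (compTo (Row.single (S.restrCell x.2 y.2 (S.unit Y))) (S.unitMap k) _ _),
        ← S.cart_lift (compTo (Row.single (S.restrCell y.2 z.2 (S.unit Y))) (S.unitMap k) _ _)] at h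
      exact h
    have h₃ : VComp (row₂ ((repFunctor S k).map x y) ((repFunctor S k).map y z))
        (row₂ (S.restrCell (E.vcomp x.2 k) (E.vcomp y.2 k) (S.unit Y'))
          (S.restrCell (E.vcomp y.2 k) (E.vcomp z.2 k) (S.unit Y')))
        (row₂ (S.cart ((repFunctor S k).map x y)) (S.cart ((repFunctor S k).map y z))) :=
      VComp.cons₁ _ _ rfl rfl (VComp.single _ _ rfl rfl) _ rfl
    have e : ∀ {A : E.Obj} (x : E.Hom A Y), E.vcomp (E.vcomp (E.one A) (E.vcomp x k)) (E.one Y') =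
      E.vcomp (E.vcomp (E.one A) (E.one A)) (E.vcomp x k) := fun x => by
      rw [VDC.one_one, E.lawful.vcomp_one]
    exact (h₁.congr h₂ (β := S.unitMap k) (β' := S.unitL (S.unit Y'))
      (S.comp_unitL_row (S.unitMap k)) _ _ (e _) (e _)).trans
      (h₃.comp_eq _ _ _ _ _ _ _).symm

theorem repLawful : RepLawful S where
  cat := S.repCat_isLawful
  functor := S.repFunctor_isLawful
  prof := S.repProf_isLawful

end VDC.EquipmentData

/-! ### Inversion of elements and actions -/

namespace Elem

/-- Case analysis on a generalized element of the empty list of profunctors. -/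
def casesNil {C : EnrichedCat.{u, v, p, c, w} E}
    {motive : ∀ {a d : C.Obj} {A B : E.Obj} {f : E.Hom A (C.ext a)} {g : E.Hom B (C.ext d)}
      {P : E.Path A B}, Elem (ProPath.nil C) a d f g P → Sort*}
    (h : ∀ (a : C.Obj) {A : E.Obj} (f : E.Hom A (C.ext a)), motive (nil a f)) :
    ∀ {a d : C.Obj} {A B : E.Obj} {f : E.Hom A (C.ext a)} {g : E.Hom B (C.ext d)}
      {P : E.Path A B} (ω : Elem (ProPath.nil C) a d f g P), motive ω
  | _, _, _, _, _, _, _, nil a f => h a f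

/-- Case analysis on a generalized element of a nonempty list of profunctors. -/
def casesCons {C M D : EnrichedCat.{u, v, p, c, w} E} {J : Prof C M} {Γ : ProfPath M D}
    {motive : ∀ {a : C.Obj} {d : D.Obj} {A B : E.Obj} {f : E.Hom A (C.ext a)}
      {g : E.Hom B (D.ext d)} {P : E.Path A B}, Elem (ProPath.cons J Γ) a d f g P → Sort*}
    (h : ∀ (a : C.Obj) {b : M.Obj} {d : D.Obj} {A B Z : E.Obj} {f : E.Hom A (C.ext a)}
      {g : E.Hom B (M.ext b)} {h : E.Hom Z (D.ext d)} {P₁ : E.Path A B} {P₂ : E.Path B Z}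
      {P : E.Path A Z} (τ : E.Cell f g P₁ (J.pro a b)) (ω : Elem Γ b d g h P₂)
      (e : P₁.append P₂ = P), motive (cons a τ ω e)) :
    ∀ {a : C.Obj} {d : D.Obj} {A B : E.Obj} {f : E.Hom A (C.ext a)} {g : E.Hom B (D.ext d)}
      {P : E.Path A B} (ω : Elem (ProPath.cons J Γ) a d f g P), motive ω
  | _, _, _, _, _, _, _, cons a τ ω e => h a τ ω e

theorem IAct.not_nil {C : EnrichedCat.{u, v, p, c, w} E} {a d : C.Obj} {A B : E.Obj}
    {f : E.Hom A (C.ext a)} {g : E.Hom B (C.ext d)} {P : E.Path A B}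
    {ω ω' : Elem (ProPath.nil C) a d f g P} (H : IAct ω ω') : False := by
  cases ω; cases H

theorem LAct.not_nil {C : EnrichedCat.{u, v, p, c, w} E} {a a' d : C.Obj} {A B Z : E.Obj}
    {f : E.Hom A (C.ext a)} {g : E.Hom B (C.ext a')} {h : E.Hom Z (C.ext d)} {P : E.Path A B}
    {Q : E.Path B Z} {R : E.Path A Z} {σ : E.Cell f g P (C.hom a a')}
    {ω : Elem (ProPath.nil C) a' d g h Q} {ω' : Elem (ProPath.nil C) a d f h R}
    (H : LAct σ ω ω') : False := by
  cases H

theorem RAct.not_nil {C : EnrichedCat.{u, v, p, c, w} E} {a d d' : C.Obj} {A B Z : E.Obj}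
    {f : E.Hom A (C.ext a)} {g : E.Hom B (C.ext d)} {h : E.Hom Z (C.ext d')} {P : E.Path A B}
    {Q : E.Path B Z} {R : E.Path A Z} {ω : Elem (ProPath.nil C) a d f g P}
    {σ : E.Cell g h Q (C.hom d d')} {ω' : Elem (ProPath.nil C) a d' f h R}
    (H : RAct ω σ ω') : False := by
  cases H

/-- For representatives the categories in question are `H.obj Y` and not variables. The case
analysis is therefore carried out here, for arbitrary enriched categories. -/
theorem RAct.single_cases {C D : EnrichedCat.{u, v, p, c, w} E} {J : Prof C D} {a : C.Obj}
    {d d' : D.Obj} {A B Z : E.Obj} {f : E.Hom A (C.ext a)} {g : E.Hom B (D.ext d)}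
    {h : E.Hom Z (D.ext d')} {P' : E.Path A B} {Q : E.Path B Z} {R' : E.Path A Z}
    {ω : Elem (ProPath.cons J (ProPath.nil D)) a d f g P'} {σ : E.Cell g h Q (D.hom d d')}
    {ω' : Elem (ProPath.cons J (ProPath.nil D)) a d' f h R'} (H : RAct ω σ ω') :
    ∃ (P : E.Path A B) (R : E.Path A Z) (τ : E.Cell f g P (J.pro a d))
      (e : P.append (ProPath.nil B) = P') (e' : P.append Q = R)
      (e'' : R.append (ProPath.nil Z) = R'), ω = cons (J := J) a τ (nil d g) e ∧
        ω' = cons (J := J) a (J.ract τ σ e') (nil d' h) e'' := by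
  cases H with
  | last τ σ e e' e'' => exact ⟨_, _, τ, e, e', e'', rfl, rfl⟩
  | there τ H e e' => exact H.not_nil.elim

theorem RAct.cons_cases {C M N D : EnrichedCat.{u, v, p, c, w} E} {J : Prof C M}
    {J' : Prof M N} {Γ : ProfPath N D} {a : C.Obj}
    {d d' : D.Obj} {A X Z : E.Obj} {f : E.Hom A (C.ext a)} {k : E.Hom X (D.ext d)}
    {h : E.Hom Z (D.ext d')} {R : E.Path A X} {Q : E.Path X Z} {R' : E.Path A Z}
    {ω : Elem (ProPath.cons J (ProPath.cons J' Γ)) a d f k R} {σ : E.Cell k h Q (D.hom d d')}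
    {ω' : Elem (ProPath.cons J (ProPath.cons J' Γ)) a d' f h R'} (H : RAct ω σ ω') :
    ∃ (b : M.Obj) (B : E.Obj) (g : E.Hom B (M.ext b)) (P : E.Path A B) (P₁ : E.Path B X)
      (P₂ : E.Path B Z) (τ : E.Cell f g P (J.pro a b))
      (ω₁ : Elem (ProPath.cons J' Γ) b d g k P₁) (ω₁' : Elem (ProPath.cons J' Γ) b d' g h P₂)
      (e : P.append P₁ = R) (e' : P.append P₂ = R'), ω = cons (J := J) a τ ω₁ e ∧
        ω' = cons (J := J) a τ ω₁' e' ∧ RAct ω₁ σ ω₁' := by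
  cases H with
  | there τ H e e' => exact ⟨_, _, _, _, _, _, τ, _, _, e, e', rfl, rfl, H⟩

theorem EAct.nil_cases {C : EnrichedCat.{u, v, p, c, w} E}
    {motive : ∀ {a a' d d' : C.Obj} {A A' B B' : E.Obj} {f : E.Hom A (C.ext a)}
      {f' : E.Hom A' (C.ext a')} {g : E.Hom B (C.ext d)} {g' : E.Hom B' (C.ext d')}
      {P : E.Path A A'} {P' : E.Path B B'} {Q : E.Path A B} {Q' : E.Path A' B'}
      (_ : E.Cell f f' P (C.hom a a')) (_ : Elem (ProPath.nil C) a' d' f' g' Q')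
      (_ : Elem (ProPath.nil C) a d f g Q) (_ : E.Cell g g' P' (C.hom d d')), Prop}
    (h : ∀ {a a' : C.Obj} {A A' : E.Obj} {f : E.Hom A (C.ext a)} {f' : E.Hom A' (C.ext a')}
      {P : E.Path A A'} (σ : E.Cell f f' P (C.hom a a')), motive σ (nil a' f') (nil a f) σ)
    {a a' d d' : C.Obj} {A A' B B' : E.Obj} {f : E.Hom A (C.ext a)}
    {f' : E.Hom A' (C.ext a')} {g : E.Hom B (C.ext d)} {g' : E.Hom B' (C.ext d')}
    {P : E.Path A A'} {P' : E.Path B B'} {Q : E.Path A B} {Q' : E.Path A' B'}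
    {σ : E.Cell f f' P (C.hom a a')} {ω' : Elem (ProPath.nil C) a' d' f' g' Q'}
    {ω : Elem (ProPath.nil C) a d f g Q} {σ' : E.Cell g g' P' (C.hom d d')}
    (H : EAct σ ω' ω σ') : motive σ ω' ω σ' := by
  cases H; exact h _

theorem EAct.not_cons {C M D : EnrichedCat.{u, v, p, c, w} E} {J : Prof C M} {Γ : ProfPath M D}
    {a a' : C.Obj} {d d' : D.Obj} {A A' B B' : E.Obj} {f : E.Hom A (C.ext a)}
    {f' : E.Hom A' (C.ext a')} {g : E.Hom B (D.ext d)} {g' : E.Hom B' (D.ext d')}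
    {P : E.Path A A'} {P' : E.Path B B'} {Q : E.Path A B} {Q' : E.Path A' B'}
    {σ : E.Cell f f' P (C.hom a a')} {ω' : Elem (ProPath.cons J Γ) a' d' f' g' Q'}
    {ω : Elem (ProPath.cons J Γ) a d f g Q} {σ' : E.Cell g g' P' (D.hom d d')}
    (H : EAct σ ω' ω σ') : False := by
  cases H

end Elem

/-! ## Representatives of 2-cells -/

namespace RepLawful

variable {S : E.EquipmentData} (H : RepLawful S)

/-- The row of 2-cells of `E` that corresponds to a generalized element of a list of
representatives. -/
noncomputable def elemRow : ∀ {Y Z : E.Obj} (Γ : E.Path Y Z) {a : (H.obj Y).Obj}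
    {d : (H.obj Z).Obj} {A B : E.Obj} {f : E.Hom A a.1} {g : E.Hom B d.1} {P : E.Path A B},
    Elem (H.path Γ) a d f g P → E.Row (E.vcomp f a.2) (E.vcomp g d.2) P Γ
  | Y, _, ProPath.nil _, _, _, _, _, _, _, _, ω =>
      Elem.casesNil (C := H.obj Y)
        (motive := fun {a d _ _ f g P} _ => E.Row (E.vcomp f a.2) (E.vcomp g d.2) P (ProPath.nil Y))
        (fun a _ f => Row.nil (E.vcomp f a.2)) ω
  | _, _, ProPath.cons J Γ, _, _, _, _, _, _, _, ω =>
      Elem.casesCons (J := H.pro J) (Γ := H.path Γ)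
        (motive := fun {a d _ _ f g P} _ =>
          E.Row (E.vcomp f a.2) (E.vcomp g d.2) P (ProPath.cons J Γ))
        (fun _ _ _ _ _ _ _ _ _ _ _ _ τ ω e => Row.cons (S.cart τ) (elemRow Γ ω) e) ω

theorem vcomp_cartRow : ∀ {Y Z : E.Obj} (Γ : E.Path Y Z) {a : (H.obj Y).Obj}
    {d : (H.obj Z).Obj} {A B : E.Obj} {f : E.Hom A a.1} {g : E.Hom B d.1} {P : E.Path A B}
    (ω : Elem (H.path Γ) a d f g P), VComp ω.row (H.cartRow Γ ω.objs) (H.elemRow Γ ω)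
  | Y, _, ProPath.nil _, a, d, _, _, f, g, P, ω =>
    Elem.casesNil (C := H.obj Y)
      (motive := fun ω => VComp ω.row (H.cartRow (ProPath.nil Y) ω.objs)
        (H.elemRow (ProPath.nil Y) ω)) (fun _ _ _ => .nil _ _ rfl) ω
  | _, _, ProPath.cons J Γ, _, _, _, _, _, _, _, ω =>
    Elem.casesCons (J := H.pro J) (Γ := H.path Γ)
      (motive := fun ω => VComp ω.row (H.cartRow (ProPath.cons J Γ) ω.objs)
        (H.elemRow (ProPath.cons J Γ) ω)) (fun _ _ _ _ _ _ _ _ _ _ _ _ _ ω _ =>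
          VComp.cons₁ _ _ rfl rfl (vcomp_cartRow Γ ω) _ _) ω

variable {Y Z Y' Z' : E.Obj} {k : E.Hom Y Y'} {l : E.Hom Z Z'} {Γ : E.Path Y Z}
    {K : E.Pro Y' Z'}

/-- The components of `|α|` are lifts of `α` composed with cartesian 2-cells. Absorbing these into
the element turns it into a row of `E`, so evaluation of `|α|` becomes composition with `α`. -/
theorem cart_eval (α : E.Cell k l Γ K) {a : (H.obj Y).Obj}
    {d : (H.obj Z).Obj} {A B : E.Obj} {f : E.Hom A a.1} {g : E.Hom B d.1} {P : E.Path A B}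
    (ω : Elem (H.path Γ) a d f g P) :
    S.cart ((H.mor α).eval ω) ≍ E.comp (H.elemRow Γ ω) α := by
  have h : S.cart (compTo ω.row ((H.mor α).app ω.objs) rfl rfl) =
      compTo (H.elemRow Γ ω) α
        ((E.lawful.vcomp_assoc _ _ _).trans (congrArg (E.vcomp · _) (E.lawful.vcomp_one _).symm))
        ((E.lawful.vcomp_assoc _ _ _).trans (congrArg (E.vcomp · _) (E.lawful.vcomp_one _).symm)) := by
    refine (S.cart_compTo _ _ rfl rfl).trans ?_
    refine (congrArg (fun β => compTo _ β _ _) (S.cart_lift _)).trans ?_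
    exact (H.vcomp_cartRow Γ ω).comp_eq _ _ _ _ _ _ _
  exact (heq_of_eq h).trans (VDC.compTo_heq _ _ _ _)

/-- The functor `|k|` has identity arrows between extents, and these remain in the boundary until
removed. -/
theorem cart_frame {Y Y' : E.Obj} {x : (H.obj Y).Obj} {A : E.Obj} (f : E.Hom A x.1)
    (k : E.Hom Y Y') : E.vcomp (E.vcomp f ((H.hom k).arr x)) ((H.hom k).obj x).2 =
      E.vcomp (E.vcomp f x.2) k :=
  (congrArg (E.vcomp · _) (E.lawful.vcomp_one f)).trans (E.lawful.vcomp_assoc _ _ _).symm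

theorem cart_on (k : E.Hom Y Y') {x y : (H.obj Y).Obj} {A B : E.Obj} {f : E.Hom A x.1}
    {g : E.Hom B y.1} {P : E.Path A B} (σ : E.Cell f g P ((H.obj Y).hom x y)) :
    S.cart ((H.hom k).on σ) ≍ S.uon k (S.cart σ) :=
  (heq_of_eq (S.cart_rep_map k σ rfl rfl)).trans (VDC.compTo_heq _ _ _ _)

end RepLawful

section

variable {S : E.EquipmentData} {A B Z Y Y' : E.Obj} {f f' : E.Hom A Y}
  {P : E.Path A B} {Q : E.Path B Z} {R : E.Path A Z} {J : E.Pro Y Y'}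

theorem VDC.EquipmentData.ulact_heq {g g' : E.Hom B Y} {h h' : E.Hom Z Y'}
    {σ : E.Cell f g P (S.unit Y)} {σ' : E.Cell f' g' P (S.unit Y)} {τ : E.Cell g h Q J}
    {τ' : E.Cell g' h' Q J} (hf : f = f') (hg : g = g') (hh : h = h') (hσ : σ ≍ σ') (hτ : τ ≍ τ')
    (e : P.append Q = R) : S.ulact σ τ e ≍ S.ulact σ' τ' e := by
  subst hf; subst hg; subst hh; rw [eq_of_heq hσ, eq_of_heq hτ]

theorem VDC.EquipmentData.uract_heq {g g' : E.Hom B Y'} {h h' : E.Hom Z Y'}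
    {σ : E.Cell g h Q (S.unit Y')} {σ' : E.Cell g' h' Q (S.unit Y')} {τ : E.Cell f g P J}
    {τ' : E.Cell f' g' P J} (hf : f = f') (hg : g = g') (hh : h = h') (hτ : τ ≍ τ') (hσ : σ ≍ σ')
    (e : P.append Q = R) : S.uract τ σ e ≍ S.uract τ' σ' e := by
  subst hf; subst hg; subst hh; rw [eq_of_heq hσ, eq_of_heq hτ]

/-- Since `cart` commutes with the actions only up to a proved equation, this and the next two
lemmas accept a 2-cell that is merely equal to the result of the action. -/
theorem VDC.EquipmentData.URAct.of_eq {f : E.Hom A Y} {g : E.Hom B Y'} {h : E.Hom Z Y'}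
    {P P' : E.Path A B} {R' : E.Path A Z} (τ : E.Cell f g P J) (σ : E.Cell g h Q (S.unit Y'))
    (e : P.append (ProPath.nil B) = P') (e' : P.append Q = R)
    (e'' : R.append (ProPath.nil Z) = R') {κ : E.Cell f h R J} (hκ : κ = S.uract τ σ e') :
    S.URAct (Row.cons τ (Row.nil g) e) σ (Row.cons κ (Row.nil h) e'') := by
  subst hκ; exact .last τ σ e e' e''

theorem VDC.EquipmentData.UIAct.of_eq {C M N D : E.Obj} {J : E.Pro C M} {J' : E.Pro M N}
    {Γ : E.Path N D} {A B X Y Z : E.Obj} {f : E.Hom A C} {g : E.Hom B M} {h : E.Hom X M}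
    {k : E.Hom Y N} {l : E.Hom Z D} {P₁ : E.Path A B} {P₂ : E.Path B X}
    {P₃ : E.Path X Y} {P₄ : E.Path Y Z} {P₁₂ : E.Path A X} {P₂₃ : E.Path B Y}
    {P₃₄ : E.Path X Z} {Q : E.Path B Z} {P : E.Path A Z}
    (τ : E.Cell f g P₁ J) (σ : E.Cell g h P₂ (S.unit M))
    (τ' : E.Cell h k P₃ J') (ρ : E.Row k l P₄ Γ) (e₁ : P₁.append P₂ = P₁₂)
    (e₂ : P₃.append P₄ = P₃₄) (e₃ : P₁₂.append P₃₄ = P) (e₄ : P₂.append P₃ = P₂₃)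
    (e₅ : P₂₃.append P₄ = Q) (e₆ : P₁.append Q = P) {κ : E.Cell f h P₁₂ J}
    {κ' : E.Cell g k P₂₃ J'} (hκ : κ = S.uract τ σ e₁) (hκ' : κ' = S.ulact σ τ' e₄) :
    S.UIAct (Row.cons κ (Row.cons τ' ρ e₂) e₃) (Row.cons τ (Row.cons κ' ρ e₅) e₆) := by
  subst hκ; subst hκ'; exact .here τ σ τ' ρ e₁ e₂ e₃ e₄ e₅ e₆

theorem VDC.EquipmentData.ulact_comp_of_eq {X : E.Obj} {f : E.Hom X Y} {g : E.Hom Z Y'}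
    {J : E.Pro X B} {Γ : E.Path B Z}
    {K : E.Pro Y Y'} (α : E.Cell f g (ProPath.cons J Γ) K) {A₁ A₂ A₃ A₄ : E.Obj}
    {h₁ : E.Hom A₁ X} {h₂ : E.Hom A₂ X} {h₃ : E.Hom A₃ B} {h₄ : E.Hom A₄ Z} {P : E.Path A₁ A₂}
    {P₁ : E.Path A₂ A₃} {P₂ : E.Path A₃ A₄} {P₁₂ : E.Path A₂ A₄} {Q : E.Path A₁ A₃}
    {R : E.Path A₁ A₄} (σ : E.Cell h₁ h₂ P (S.unit X)) (τ : E.Cell h₂ h₃ P₁ J)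
    (ρ : E.Row h₃ h₄ P₂ Γ) (e : P₁.append P₂ = P₁₂) (e' : P.append P₁ = Q)
    (e'' : Q.append P₂ = R) (e₃ : P.append P₁₂ = R) {κ : E.Cell h₁ h₃ Q J}
    (hκ : κ = S.ulact σ τ e') :
    E.comp (Row.cons κ ρ e'') α = S.ulact (S.uon f σ) (E.comp (Row.cons τ ρ e) α) e₃ := by
  subst hκ; exact S.ulact_comp α σ τ ρ e e' e'' e₃

end

namespace RepLawful

variable {S : E.EquipmentData} (H : RepLawful S)

/-- `cart` turns both actions of a hom of a representative into actions of a unit, so a move of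
elements becomes a move of rows in `E`. -/
theorem uiact_elemRow {Y Z : E.Obj} (Γ : E.Path Y Z) {a : (H.obj Y).Obj}
    {d : (H.obj Z).Obj} {A B : E.Obj} {f : E.Hom A a.1} {g : E.Hom B d.1} {P : E.Path A B}
    {ω ω' : Elem (H.path Γ) a d f g P} (h : ω.IAct ω') :
    S.UIAct (H.elemRow Γ ω) (H.elemRow Γ ω') := by
  induction Γ generalizing A with
  | nil => exact h.not_nil.elim
  | cons J Γ ih =>
    change Elem (ProPath.cons (H.pro J) (H.path Γ)) a d f g P at ω ω'
    cases Γ with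
    | nil =>
      cases h with
      | there τ h e => exact .there _ (ih h) e
    | cons J' Γ =>
      change Elem (ProPath.cons (H.pro J) (ProPath.cons (H.pro J') (H.path Γ))) a d f g P at ω ω'
      cases h with
      | there τ h e => exact .there _ (ih h) e
      | here τ σ τ' ω e₁ e₂ e₃ e₄ e₅ e₆ =>
        exact .of_eq (S.cart τ) (S.cart σ) (S.cart τ') (H.elemRow Γ ω) e₁ e₂ e₃ e₄ e₅ e₆
          (S.cart_rep_ract τ σ e₁) (S.cart_rep_lact σ τ' e₄)

theorem uract_elemRow {Y Z : E.Obj} (Γ : E.Path Y Z) {a : (H.obj Y).Obj}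
    {d d' : (H.obj Z).Obj} {A B X : E.Obj} {f : E.Hom A a.1} {g : E.Hom B d.1}
    {h : E.Hom X d'.1} {P : E.Path A B} {Q : E.Path B X} {R : E.Path A X}
    {ω : Elem (H.path Γ) a d f g P} {σ : E.Cell g h Q ((H.obj Z).hom d d')}
    {ω' : Elem (H.path Γ) a d' f h R} (h : ω.RAct σ ω') :
    S.URAct (H.elemRow Γ ω) (S.cart σ) (H.elemRow Γ ω') := by
  induction Γ generalizing A P R with
  | nil => exact h.not_nil.elim
  | cons J Γ ih =>
    change Elem (ProPath.cons (H.pro J) (H.path Γ)) a _ f _ _ at ω ω'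
    cases Γ with
    | nil =>
      rcases h.single_cases with ⟨P₀, R₀, τ, e, e', e'', rfl, rfl⟩
      exact .of_eq (S.cart τ) (S.cart σ) e e' e'' (S.cart_rep_ract τ σ e')
    | cons J' Γ =>
      change Elem (ProPath.cons (H.pro J) (ProPath.cons (H.pro J') (H.path Γ))) a _ f _ _ at ω ω'
      obtain ⟨_, _, _, _, _, _, τ, ω, ω', e, e', rfl, rfl, h'⟩ := h.cons_cases
      exact .there _ (ih h') e e'

/-- Under `cart` the four laws of `|α|` say that `α` respects the actions of units inside, on the
left, on the right and, for an empty domain, on the two sides. -/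
theorem morLawful : H.MorLawful := by
  intro Y Z Y' Z' k l Γ K α
  refine MorData.isLawful_of_eval _ ?_ ?_ ?_ ?_
  · intro a d A B f g P ω ω' h
    refine S.cart_injective (eq_of_heq ((H.cart_eval α ω).trans (.trans (heq_of_eq ?_)
      (H.cart_eval α ω').symm)))
    exact (H.uiact_elemRow Γ h).comp_eq α
  · intro a a' d A B X f g h P Q R σ ω ω' H' e
    refine S.cart_injective (eq_of_heq ((H.cart_eval α ω').trans (.trans ?_
      (heq_of_eq (S.cart_rep_lact _ _ _)).symm)))
    refine .trans ?_ (VDC.EquipmentData.ulact_heq (H.cart_frame f k).symm (H.cart_frame g k).symm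
      (H.cart_frame h l).symm (H.cart_on k σ).symm (H.cart_eval α ω).symm e)
    cases Γ with
    | nil => exact H'.not_nil.elim
    | cons J Γ =>
      change Elem (ProPath.cons (H.pro J) (H.path Γ)) _ d _ h _ at ω ω'
      cases H' with
      | mk σ τ ω e₁ e₂ e₃ =>
        exact heq_of_eq (S.ulact_comp_of_eq α (S.cart σ) (S.cart τ) (H.elemRow Γ ω) e₁ e₂ e₃ e
          (S.cart_rep_lact σ τ e₂))
  · intro a d d' A B X f g h P Q R ω σ ω' H' e
    refine S.cart_injective (eq_of_heq ((H.cart_eval α ω').trans (.trans ?_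
      (heq_of_eq (S.cart_rep_ract _ _ _)).symm)))
    refine .trans ?_ (VDC.EquipmentData.uract_heq (H.cart_frame f k).symm (H.cart_frame g l).symm
      (H.cart_frame h l).symm (H.cart_eval α ω).symm (H.cart_on l σ).symm e)
    exact heq_of_eq ((H.uract_elemRow Γ H').comp_eq α e)
  · intro a a' d d' A A' B B' f f' g g' P P' Q Q' σ ω' ω σ' H' R e e'
    refine S.cart_injective (eq_of_heq ((heq_of_eq (S.cart_rep_lact _ _ _)).trans (.trans ?_
      (heq_of_eq (S.cart_rep_ract _ _ _)).symm)))
    refine (VDC.EquipmentData.ulact_heq (H.cart_frame f k) (H.cart_frame f' k)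
      (H.cart_frame g' l) (H.cart_on k σ) (H.cart_eval α ω') e).trans (.trans ?_
      (VDC.EquipmentData.uract_heq (H.cart_frame f k) (H.cart_frame g l)
      (H.cart_frame g' l) (H.cart_eval α ω) (H.cart_on l σ') e').symm)
    refine heq_of_eq ?_
    cases Γ with
    | nil =>
      exact Elem.EAct.nil_cases (C := H.obj Y) (motive := fun {a a' d d' A A' B B' f f' g g'
        P P' Q Q'} σ ω' ω σ' => ∀ {R : E.Path A B'} (e : P.append Q' = R) (e' : Q.append P' = R),
        S.ulact (S.uon k (S.cart σ)) (E.comp (H.elemRow (ProPath.nil Y) ω') α) e =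
          S.uract (E.comp (H.elemRow (ProPath.nil Y) ω) α) (S.uon l (S.cart σ')) e')
        (fun σ R e e' => by
          obtain rfl : _ = R := e'
          exact S.ulact_comp_nil α (S.cart σ) e rfl) H' e e'
    | cons J Γ => exact H'.not_cons.elim

end RepLawful

/-- Functoriality compares restrictions along arrows such as `(x f) g` and `x (f g)`, which are
equal only propositionally; `cart` still detects equality of 2-cells into them. -/
theorem VDC.EquipmentData.heq_of_cart (S : E.EquipmentData) {A B A' B' Z W : E.Obj}
    {f f' : E.Hom A A'} {g g' : E.Hom B B'} {K : E.Pro A' B'} {Γ : E.Path Z W} {h h' : E.Hom Z A}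
    {k k' : E.Hom W B} (hf : f = f') (hg : g = g') (hh : h = h') (hk : k = k')
    {τ : E.Cell h k Γ (S.restr f g K)} {τ' : E.Cell h' k' Γ (S.restr f' g' K)}
    (e : S.cart τ ≍ S.cart τ') : τ ≍ τ' := by
  subst hf; subst hg; subst hh; subst hk
  exact heq_of_eq (S.cart_injective (eq_of_heq e))

theorem VDC.comp_heq_of_vcomp {A B A' B' A'' B'' A₃ B₃ : E.Obj} {f : E.Hom A A'} {g : E.Hom B B'}
    {f' : E.Hom A' A''} {g' : E.Hom B' B''} {f'' : E.Hom A A''} {g'' : E.Hom B B''}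
    {Γ : E.Path A B} {Δ : E.Path A' B'} {Θ : E.Path A'' B''} {R : E.Row f g Γ Δ}
    {S : E.Row f' g' Δ Θ} {T : E.Row f'' g'' Γ Θ} (H : VComp R S T) {k : E.Hom A'' A₃}
    {l : E.Hom B'' B₃} {K : E.Pro A₃ B₃} (β : E.Cell k l Θ K) :
    E.comp R (E.comp S β) ≍ E.comp T β := by
  obtain rfl := H.left_eq
  obtain rfl := H.right_eq
  exact (heq_of_eq (H.comp_eq β rfl rfl rfl rfl (E.lawful.vcomp_assoc _ _ _)
    (E.lawful.vcomp_assoc _ _ _))).trans (VDC.compTo_heq _ _ _ _)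

namespace Elem

theorem exists_isAppend_of_eq {C M D : EnrichedCat.{u, v, p, c, w} E} {Γ₁ : ProfPath C M}
    {Γ₂ : ProfPath M D} {Γ : ProfPath C D} (e : Γ₁.append Γ₂ = Γ) {a : C.Obj} {d : D.Obj}
    {A Z : E.Obj} {f : E.Hom A (C.ext a)} {h : E.Hom Z (D.ext d)} {P : E.Path A Z}
    (ω : Elem Γ a d f h P) : ∃ (b : M.Obj) (B : E.Obj) (g : E.Hom B (M.ext b)) (P₁ : E.Path A B)
      (P₂ : E.Path B Z) (ω₁ : Elem Γ₁ a b f g P₁) (ω₂ : Elem Γ₂ b d g h P₂), IsAppend ω₁ ω₂ ω := by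
  subst e; exact exists_isAppend _ ω

theorem IsAppend.nil_cases {C D : EnrichedCat.{u, v, p, c, w} E} {Γ : ProfPath C D}
    {motive : ∀ {a b : C.Obj} {d : D.Obj} {A B Z : E.Obj} {f : E.Hom A (C.ext a)}
      {g : E.Hom B (C.ext b)} {h : E.Hom Z (D.ext d)} {P₁ : E.Path A B} {P₂ : E.Path B Z}
      {P : E.Path A Z} (_ : Elem (ProPath.nil C) a b f g P₁) (_ : Elem Γ b d g h P₂)
      (_ : Elem Γ a d f h P), Prop}
    (H₀ : ∀ {a : C.Obj} {d : D.Obj} {A Z : E.Obj} {f : E.Hom A (C.ext a)} {h : E.Hom Z (D.ext d)}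
      {P : E.Path A Z} (ω : Elem Γ a d f h P), motive (Elem.nil a f) ω ω)
    {a b : C.Obj} {d : D.Obj} {A B Z : E.Obj} {f : E.Hom A (C.ext a)}
    {g : E.Hom B (C.ext b)} {h : E.Hom Z (D.ext d)} {P₁ : E.Path A B} {P₂ : E.Path B Z}
    {P : E.Path A Z} {ω₁ : Elem (ProPath.nil C) a b f g P₁} {ω₂ : Elem Γ b d g h P₂}
    {ω : Elem Γ a d f h P} (H : IsAppend ω₁ ω₂ ω) : motive ω₁ ω₂ ω := by
  cases H; exact H₀ _

theorem IsAppend.cons_cases {C N M D : EnrichedCat.{u, v, p, c, w} E} {J : Prof C N}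
    {Γ₁ : ProfPath N M} {Γ₂ : ProfPath M D} {Γ : ProfPath N D} {a : C.Obj} {b : M.Obj} {d : D.Obj}
    {A B Z : E.Obj} {f : E.Hom A (C.ext a)} {g : E.Hom B (M.ext b)} {h : E.Hom Z (D.ext d)}
    {P₁ : E.Path A B} {P₂ : E.Path B Z} {P : E.Path A Z}
    {ω₁ : Elem (ProPath.cons J Γ₁) a b f g P₁} {ω₂ : Elem Γ₂ b d g h P₂}
    {ω : Elem (ProPath.cons J Γ) a d f h P} (H : IsAppend ω₁ ω₂ ω) :
    ∃ (n : N.Obj) (X : E.Obj) (k : E.Hom X (N.ext n)) (Q : E.Path A X) (Q₁ : E.Path X B)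
      (Q₂ : E.Path X Z) (τ : E.Cell f k Q (J.pro a n)) (ω₁' : Elem Γ₁ n b k g Q₁)
      (ω' : Elem Γ n d k h Q₂) (e : Q.append Q₁ = P₁) (e' : Q.append Q₂ = P),
      ω₁ = Elem.cons (J := J) a τ ω₁' e ∧ ω = Elem.cons (J := J) a τ ω' e' ∧ IsAppend ω₁' ω₂ ω' := by
  cases H with
  | cons a τ H e e' => exact ⟨_, _, _, _, _, _, τ, _, _, e, e', rfl, rfl, H⟩

theorem single_cases {C D : EnrichedCat.{u, v, p, c, w} E} {J : Prof C D} {a : C.Obj} {d : D.Obj}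
    {A B : E.Obj} {f : E.Hom A (C.ext a)} {g : E.Hom B (D.ext d)} {P : E.Path A B}
    (ω : Elem (ProPath.single J) a d f g P) :
    ∃ τ : E.Cell f g P (J.pro a d),
      ω = cons (J := J) a τ (nil d g) (ProPath.append_nil P) := by
  cases ω with
  | cons a τ ω e =>
    cases ω
    obtain rfl := (ProPath.append_nil _).symm.trans e
    exact ⟨τ, rfl⟩

end Elem

/-! ### Functoriality of the embedding -/

namespace RepLawful

variable {S : E.EquipmentData} (H : RepLawful S)

theorem elemRow_isAppend {X Y Z : E.Obj} {Γ₁ : E.Path X Y} {Γ₂ : E.Path Y Z}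
    {a : (H.obj X).Obj} {b : (H.obj Y).Obj} {d : (H.obj Z).Obj} {A B A' : E.Obj} {f : E.Hom A a.1}
    {g : E.Hom B b.1} {h : E.Hom A' d.1} {P₁ : E.Path A B} {P₂ : E.Path B A'} {P : E.Path A A'}
    {ω₁ : Elem (H.path Γ₁) a b f g P₁} {ω₂ : Elem (H.path Γ₂) b d g h P₂}
    {ω : Elem (H.path (Γ₁.append Γ₂)) a d f h P} (h' : Elem.IsAppend ω₁ ω₂ ω) :
    (H.elemRow Γ₁ ω₁).IsAppend (H.elemRow Γ₂ ω₂) (H.elemRow (Γ₁.append Γ₂) ω) := by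
  induction Γ₁ generalizing A P₁ P with
  | nil X =>
    exact Elem.IsAppend.nil_cases (C := H.obj X) (D := H.obj Z) (Γ := H.path Γ₂)
      (motive := fun ω₁ ω₂ ω => (H.elemRow (ProPath.nil X) ω₁).IsAppend (H.elemRow Γ₂ ω₂)
        (H.elemRow Γ₂ ω)) (fun ω => .nil _) h'
  | cons J Γ₁ ih =>
    obtain ⟨_, _, _, _, _, _, τ, ω₁', ω', e, e', rfl, rfl, h₁⟩ := Elem.IsAppend.cons_cases
      (J := H.pro J) (Γ₁ := H.path Γ₁) (Γ := H.path (Γ₁.append Γ₂)) h'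
    exact .cons _ (ih h₁) e e'

/-- Translating elements into rows of `E` intertwines the image under the embedded row with vertical
composition with `R`. Preservation of multi-composites is then associativity in `E`. -/
theorem exists_push (H' : H.MorLawful) {Y Z Y' Z' : E.Obj} {k : E.Hom Y Y'} {l : E.Hom Z Z'}
    {Γ : E.Path Y Z} {Δ : E.Path Y' Z'} (R : E.Row k l Γ Δ) {a : (H.obj Y).Obj}
    {d : (H.obj Z).Obj} {A B : E.Obj} {f : E.Hom A a.1} {g : E.Hom B d.1} {P : E.Path A B}
    (ω : Elem (H.path Γ) a d f g P) :
    ∃ T : Elem (H.path Δ) ((H.hom k).obj a) ((H.hom l).obj d) (E.vcomp f ((H.hom k).arr a))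
      (E.vcomp g ((H.hom l).arr d)) P,
      Elem.Push ((H.embedding H').row R) ω T ∧ VComp (H.elemRow Γ ω) R (H.elemRow Δ T) := by
  induction R generalizing A with
  | @nil Y Y' k =>
    exact Elem.casesNil (C := H.obj Y) (motive := fun {a d A B f g P} ω =>
      ∃ T : Elem (H.path (ProPath.nil Y')) ((H.hom k).obj a) ((H.hom k).obj d)
        (E.vcomp f ((H.hom k).arr a)) (E.vcomp g ((H.hom k).arr d)) P,
      Elem.Push ((H.embedding H').row (Row.nil k)) ω T ∧
        VComp (H.elemRow (ProPath.nil Y) ω) (Row.nil k) (H.elemRow (ProPath.nil Y') T))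
      (fun a _ f => ⟨_, .nil (H.hom k) a f, .nil _ _ (H.cart_frame f k).symm⟩) ω
  | @cons _ _ _ _ _ _ k₁ k₂ k₃ Γ₁ Γ₂ Γ K Δ α R e ih =>
    subst e
    obtain ⟨b, X, h, P₁, P₂, ω₁, ω₂, hω⟩ := Elem.exists_isAppend_of_eq
      (ProPath.map_append H.obj H.pro Γ₁ Γ₂).symm ω
    obtain ⟨T, hT, hv⟩ := ih ω₂
    refine ⟨Elem.cons (J := H.pro K) _ ((H.mor α).eval ω₁) T hω.top_eq,
      .cons (⟨H.mor α, H' α⟩ : Mor (H.hom k₁) (H.hom k₂) (H.path Γ₁) (H.pro K)) _ hω hT _, ?_⟩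
    -- The first component of the translated image is the first column of the vertical composite.
    have e₁ : S.cart ((H.mor α).eval ω₁) = compTo (H.elemRow Γ₁ ω₁) α (H.cart_frame _ _).symm
      (H.cart_frame _ _).symm :=
      eq_of_heq ((H.cart_eval α ω₁).trans (VDC.compTo_heq _ _ _ _).symm)
    have h₂ := VComp.cons (H.elemRow_isAppend hω) α (H.cart_frame _ _).symm
      (H.cart_frame _ _).symm hv rfl hω.top_eq
    rw [← e₁] at h₂
    exact h₂

/-- The object maps agree because `x 1 = x`, and `cart` reduces the 2-cells to the fact that
`unitMap` of an identity arrow is an identity 2-cell. -/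
theorem map_one (Y : E.Obj) :
    H.hom (E.one Y) = (VCat.{u, v, p, c, max u v} E).one (H.obj Y) := by
  have e : ∀ x : (H.obj Y).Obj, E.vcomp x.2 (E.one Y) = x.2 := fun x => E.lawful.vcomp_one _
  refine EFunctor.ext_of_obj (funext fun x => congrArg (Sigma.mk x.1) (e x)) (fun x => HEq.rfl)
    fun x y => ?_
  refine S.heq_of_cart (e x) (e y) rfl rfl ((heq_of_eq (S.cart_lift _)).trans ?_)
  refine (VDC.compTo_heq _ _ _ _).trans ?_
  rw [S.unitMap_one]
  refine (VDC.compTo_heq _ _ (e x) (e y)).symm.trans ((heq_of_eq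
    (VDC.compTo_single_idCell _ _ _)).trans ?_)
  exact (heq_of_eq (VDC.compTo_idRow (S.restrCell x.2 y.2 (S.unit Y)) (E.lawful.one_vcomp _)
    (E.lawful.one_vcomp _)).symm).trans (VDC.compTo_heq _ _ _ _)

theorem map_vcomp {X Y Z : E.Obj} (f : E.Hom X Y) (g : E.Hom Y Z) :
    H.hom (E.vcomp f g) = (VCat.{u, v, p, c, max u v} E).vcomp (H.hom f) (H.hom g) := by
  have e : ∀ x : (H.obj X).Obj, E.vcomp x.2 (E.vcomp f g) = E.vcomp (E.vcomp x.2 f) g :=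
    fun x => (E.lawful.vcomp_assoc _ _ _).symm
  refine EFunctor.ext_of_obj (funext fun x => congrArg (Sigma.mk x.1) (e x))
    (fun x => heq_of_eq (VDC.one_one _).symm) fun x y => ?_
  refine S.heq_of_cart (e x) (e y) (VDC.one_one _).symm (VDC.one_one _).symm
    ((heq_of_eq (S.cart_lift _)).trans ?_)
  refine (VDC.compTo_heq _ _ _ _).trans ?_
  rw [S.unitMap_vcomp]
  refine .trans ?_ (heq_of_eq (S.cart_rep_map g ((H.hom f).map x y) rfl rfl)).symm
  refine .trans ?_ (VDC.compTo_heq _ _ _ _).symm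
  have h : VComp (Row.single (S.restrCell x.2 y.2 (S.unit X))) (Row.single (S.unitMap f))
      (Row.single (S.cart ((H.hom f).map x y))) := by
    have h := VComp.single (Row.single (S.restrCell x.2 y.2 (S.unit X))) (S.unitMap f)
      (E.lawful.one_vcomp _).symm (E.lawful.one_vcomp _).symm
    rw [← S.cart_lift (compTo _ _ _ _)] at h
    exact h
  exact VDC.comp_heq_of_vcomp h _

theorem map_idCell (H' : H.MorLawful) {Y Z : E.Obj} (J : E.Pro Y Z) :
    (H.embedding H').cell (E.idCell J) ≍ (VCat.{u, v, p, c, max u v} E).idCell (H.pro J) := by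
  refine Mor.heq_of_eval (H.map_one Y) (H.map_one Z) fun {a d A B f g P} ω => ?_
  obtain ⟨τ, rfl⟩ := Elem.single_cases (J := H.pro J) ω
  refine .trans ?_ (heq_of_eq (MorData.eval_one (H.pro J) τ (ProPath.append_nil P))).symm
  refine .trans ?_ (VDC.reframe_heq _ _ _).symm
  refine S.heq_of_cart (E.lawful.vcomp_one _) (E.lawful.vcomp_one _) (E.lawful.vcomp_one _)
    (E.lawful.vcomp_one _) ((H.cart_eval (E.idCell J) _).trans ?_)
  exact (VDC.compTo_heq _ _ (E.lawful.vcomp_one _) (E.lawful.vcomp_one _)).symm.trans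
    (heq_of_eq (VDC.compTo_single_idCell (S.cart τ) _ _))

/-- Both sides are compared by values and then by `cart`. One side becomes `R` followed by `β` below
the row of the element, the other `β` below the row of its image under `R`. -/
theorem map_comp (H' : H.MorLawful) {A B A' B' A'' B'' : E.Obj} {f : E.Hom A A'} {g : E.Hom B B'}
    {Γ : E.Path A B} {Δ : E.Path A' B'} {f' : E.Hom A' A''} {g' : E.Hom B' B''} {K : E.Pro A'' B''}
    (R : E.Row f g Γ Δ) (β : E.Cell f' g' Δ K) :
    (H.embedding H').cell (E.comp R β) ≍ (VCat.{u, v, p, c, max u v} E).comp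
      ((H.embedding H').row R) ((H.embedding H').cell β) := by
  refine Mor.heq_of_eval (H.map_vcomp f f') (H.map_vcomp g g') fun {a d A B h k P} ω => ?_
  obtain ⟨T, hT, hv⟩ := H.exists_push H' R ω
  refine .trans ?_ (heq_of_eq (hT.eval_comp (⟨H.mor β, H' β⟩ : Mor (H.hom f') (H.hom g')
    (H.path Δ) (H.pro K)))).symm
  refine .trans ?_ (VDC.reframe_heq _ _ _).symm
  refine S.heq_of_cart (E.lawful.vcomp_assoc _ _ _).symm (E.lawful.vcomp_assoc _ _ _).symm
    (E.lawful.vcomp_one _).symm (E.lawful.vcomp_one _).symm ?_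
  exact (H.cart_eval (E.comp R β) ω).trans ((VDC.comp_heq_of_vcomp hv β).trans
    (H.cart_eval β T).symm)

theorem embedding_isFunctor (H' : H.MorLawful) :
    (H.embedding H').IsFunctor (D := E) (D' := VCat.{u, v, p, c, max u v} E) where
  map_one := H.map_one
  map_vcomp := H.map_vcomp
  map_idCell J := eq_of_heq ((Mor.reframe_heq _ _ _).trans (H.map_idCell H' J))
  map_comp R β := eq_of_heq ((Mor.reframe_heq _ _ _).trans (H.map_comp H' R β))

end RepLawful

namespace VDC.EquipmentData

variable (S : E.EquipmentData)

/-! ## Composites of companions and conjoints -/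

section

variable {A B Z W Y Y' : E.Obj} {f : E.Hom A Y} {g : E.Hom B Y'} {K : E.Pro Y Y'}
    {P : E.Path Z W} {h : E.Hom Z A} {k : E.Hom W B}

variable {S} in
theorem restr_ext {h' : E.Hom Z Y} {k' : E.Hom W Y'} {τ τ' : E.Cell h k P (S.restr f g K)}
    {hh : E.vcomp h f = h'} {hk : E.vcomp k g = k'}
    (e : compTo (Row.single τ) (S.restrCell f g K) hh hk =
      compTo (Row.single τ') (S.restrCell f g K) hh hk) : τ = τ' := by
  subst hh; subst hk; exact S.cart_injective e

theorem lift_compTo {X X' : E.Obj} {Q : E.Path X X'} {l : E.Hom Z X} {m : E.Hom W X'}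
    {l' : E.Hom X Y} {m' : E.Hom X' Y'} (R : E.Row l m P Q) (β : E.Cell l' m' Q K)
    (hl : E.vcomp l l' = E.vcomp h f) (hm : E.vcomp m m' = E.vcomp k g) {h' : E.Hom Z Y}
    {k' : E.Hom W Y'} (hh : E.vcomp h f = h') (hk : E.vcomp k g = k') :
    compTo (Row.single (S.lift (compTo R β hl hm))) (S.restrCell f g K) hh hk =
      compTo R β (hl.trans hh) (hm.trans hk) := by
  subst hh; subst hk; exact S.cart_lift _

theorem uon_one_heq {k : E.Hom W A} (σ : E.Cell h k P (S.unit A)) :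
    S.uon (E.one A) σ ≍ σ :=
  (heq_of_eq (S.uon_one σ)).trans (VDC.reframe_heq _ _ _)

/-- The cartesian 2-cell respects the action of units like any 2-cell; its left boundary is an
identity, so the acting element is unchanged. -/
theorem compTo_ulact {X : E.Obj} {h : E.Hom Z Y} {l : E.Hom W Y} {k : E.Hom X B} {k' : E.Hom X Y'}
    {Q : E.Path W X} {R : E.Path Z X} (σ : E.Cell h l P (S.unit Y))
    (τ : E.Cell l k Q (S.restr (E.one Y) g K)) (e : P.append Q = R) (hk : E.vcomp k g = k') :
    compTo (Row.single (S.ulact σ τ e)) (S.restrCell (E.one Y) g K) (E.lawful.vcomp_one h) hk =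
      S.ulact σ (compTo (Row.single τ) (S.restrCell (E.one Y) g K) (E.lawful.vcomp_one l) hk) e := by
  have H := S.ulact_comp (S.restrCell (E.one Y) g K) σ τ (Row.nil k) (ProPath.append_nil Q) e
    (ProPath.append_nil R) e
  exact eq_of_heq ((VDC.compTo_heq _ _ _ _).trans ((heq_of_eq H).trans (ulact_heq
    (E.lawful.vcomp_one _) (E.lawful.vcomp_one _) hk (S.uon_one_heq σ)
    (VDC.compTo_heq _ _ _ _).symm e)))

theorem compTo_uract {X : E.Obj} {h : E.Hom Z A} {h' : E.Hom Z Y} {l : E.Hom W Y'} {k : E.Hom X Y'}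
    {Q : E.Path W X} {R : E.Path Z X} (τ : E.Cell h l P (S.restr f (E.one Y') K))
    (σ : E.Cell l k Q (S.unit Y')) (e : P.append Q = R) (hh : E.vcomp h f = h') :
    compTo (Row.single (S.uract τ σ e)) (S.restrCell f (E.one Y') K) hh (E.lawful.vcomp_one k) =
      S.uract (compTo (Row.single τ) (S.restrCell f (E.one Y') K) hh (E.lawful.vcomp_one l)) σ e := by
  have H := (URAct.last τ σ (ProPath.append_nil P) e (ProPath.append_nil R)).comp_eq
    (S.restrCell f (E.one Y') K) e
  exact eq_of_heq ((VDC.compTo_heq _ _ _ _).trans ((heq_of_eq H).trans (uract_heq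
    hh (E.lawful.vcomp_one _) (E.lawful.vcomp_one _) (VDC.compTo_heq _ _ _ _).symm
    (S.uon_one_heq σ) e)))

/-- On the unit itself the left and right actions coincide, so the identity may be placed on either
side. -/
theorem uract_unit {h : E.Hom Z Y} {k : E.Hom W Y} (σ : E.Cell h k P (S.unit Y))
    (e : (ProPath.nil Z).append P = P) : S.uract (S.uid h) σ e = σ :=
  (congrArg (fun β => compTo _ β _ _) (S.unitL_unit Y).symm).trans (S.ulact_uid σ e)

theorem ulact_unit {h : E.Hom Z Y} {k : E.Hom W Y} (σ : E.Cell h k P (S.unit Y))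
    (e : P.append (ProPath.nil W) = P) : S.ulact σ (S.uid k) e = σ :=
  (congrArg (fun β => compTo _ β _ _) (S.unitL_unit Y)).trans (S.uract_uid σ e)

end

section

variable {A B Y Z : E.Obj} (f : E.Hom A Y) (g : E.Hom B Z)

/-- The 2-cell `() ⇒ U_Y(f, 1)` along `1` and `f`. -/
noncomputable def companionUnit : E.Cell (E.one A) f (ProPath.nil A) (S.companion f) :=
  S.lift (compTo (Row.nil f) (S.unitCell Y) (VDC.vcomp_one_eq f) rfl)

/-- The 2-cell `() ⇒ U_Z(1, g)` along `g` and `1`. -/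
noncomputable def conjointUnit : E.Cell g (E.one B) (ProPath.nil B) (S.conjoint g) :=
  S.lift (compTo (Row.nil g) (S.unitCell Z) rfl (VDC.vcomp_one_eq g))

theorem companionUnit_spec : compTo (Row.single (S.companionUnit f))
    (S.restrCell f (E.one Y) (S.unit Y)) (E.lawful.one_vcomp f) (E.lawful.vcomp_one f) =
      S.uid f :=
  S.lift_compTo _ _ _ _ _ _

theorem conjointUnit_spec : compTo (Row.single (S.conjointUnit g))
    (S.restrCell (E.one Z) g (S.unit Z)) (E.lawful.vcomp_one g) (E.lawful.one_vcomp g) =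
      S.uid g :=
  S.lift_compTo _ _ _ _ _ _

/-- One of the triangle identities of a companion. After `cart` the unit 2-cell of the companion
becomes an identity of the unit, which acts trivially. -/
theorem uract_companionUnit : S.uract (S.companionUnit f) (S.restrCell f (E.one Y) (S.unit Y)) rfl =
    E.idCell (S.companion f) := by
  refine S.restr_ext (hh := E.lawful.one_vcomp f) (hk := E.lawful.vcomp_one (E.one Y))
    ((S.compTo_uract _ _ _ _).trans ?_)
  refine (congrArg (S.uract · _ _) (S.companionUnit_spec f)).trans ?_
  exact (S.uract_unit _ _).trans (VDC.compTo_idRow _ _ _).symm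

/-- The corresponding triangle identity of a conjoint. -/
theorem ulact_conjointUnit : S.ulact (S.restrCell (E.one Z) g (S.unit Z)) (S.conjointUnit g) rfl =
    E.idCell (S.conjoint g) := by
  refine S.restr_ext (hh := E.lawful.vcomp_one (E.one Z)) (hk := E.lawful.one_vcomp g)
    ((S.compTo_ulact _ _ _ _).trans ?_)
  refine (congrArg (S.ulact _ · _) (S.conjointUnit_spec g)).trans ?_
  exact (S.ulact_unit _ _).trans (VDC.compTo_idRow _ _ _).symm

end

/-- The equivalence relation generated by moving elements of units between the components of a
row. -/
abbrev URel {A B X Y : E.Obj} {f : E.Hom A X} {g : E.Hom B Y} {P : E.Path A B}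
    {Γ : E.Path X Y} : E.Row f g P Γ → E.Row f g P Γ → Prop :=
  Relation.EqvGen S.UIAct

variable {S}

theorem URel.comp_eq {A B X Y : E.Obj} {f : E.Hom A X} {g : E.Hom B Y} {P : E.Path A B}
    {Γ : E.Path X Y} {ρ ρ' : E.Row f g P Γ} (H : S.URel ρ ρ') {X' Y' : E.Obj} {k : E.Hom X X'}
    {l : E.Hom Y Y'} {K : E.Pro X' Y'} (α : E.Cell k l Γ K) : E.comp ρ α = E.comp ρ' α := by
  induction H with
  | rel _ _ H => exact H.comp_eq α
  | refl => rfl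
  | symm _ _ _ ih => exact ih.symm
  | trans _ _ _ _ _ ih ih' => exact ih.trans ih'

theorem URel.there {A B Z A' B' Z' : E.Obj} {J : E.Pro A' B'} {Γ : E.Path B' Z'} {f : E.Hom A A'}
    {g : E.Hom B B'} {h : E.Hom Z Z'} {P : E.Path A B} {Q : E.Path B Z} {R : E.Path A Z}
    (τ : E.Cell f g P J) {ρ ρ' : E.Row g h Q Γ} (H : S.URel ρ ρ') (e : P.append Q = R) :
    S.URel (Row.cons τ ρ e) (Row.cons τ ρ' e) := by
  induction H with
  | rel _ _ H => exact .rel _ _ (.there τ H e)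
  | refl => exact .refl _
  | symm _ _ _ ih => exact .symm _ _ ih
  | trans _ _ _ _ _ ih ih' => exact .trans _ _ _ ih ih'

/-- A splitting can be whiskered with identity 2-cells on the left. On the right this fails to be
automatic, since `Ξ` may end in a 2-cell that has to meet the next proarrow. -/
theorem exists_append_of_split {A B Z : E.Obj} (Γ₁ : E.Path Z A) {Θ Θ' : E.Path A B}
    {I : E.Row (E.one A) (E.one B) Θ Θ'} {π : E.Row (E.one A) (E.one B) Θ' Θ}
    {ρ : E.Row (E.one A) (E.one B) Θ Θ} (h₁ : VComp π I (E.idRow Θ')) (h₂ : VComp I π ρ)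
    (h₃ : S.URel ρ (E.idRow Θ)) :
    ∃ (π' : E.Row (E.one Z) (E.one B) (Γ₁.append Θ') (Γ₁.append Θ))
      (ρ' : E.Row (E.one Z) (E.one B) (Γ₁.append Θ) (Γ₁.append Θ)),
      VComp π' ((E.idRow Γ₁).append I rfl) (E.idRow (Γ₁.append Θ')) ∧
      VComp ((E.idRow Γ₁).append I rfl) π' ρ' ∧ S.URel ρ' (E.idRow (Γ₁.append Θ)) := by
  induction Γ₁ with
  | nil A => exact ⟨π, ρ, h₁, h₂, h₃⟩
  | cons L Γ₁ ih =>
    obtain ⟨π', ρ', h₄, h₅, h₆⟩ := ih h₁ h₂ h₃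
    exact ⟨Row.cons (E.idCell L) π' rfl, Row.cons (E.idCell L) ρ' rfl, VComp.id_cons _ h₄ _ _,
      VComp.id_cons _ h₅ _ _, URel.there _ h₆ rfl⟩

/-- A 2-cell that is split by a row of 2-cells, up to moving elements of units, exhibits its
codomain as a composite. -/
theorem isComposite_of_split {A B : E.Obj} {Γ : E.Path A B} {J : E.Pro A B}
    {w : E.Cell (E.one A) (E.one B) Γ J} {Ξ : E.Row (E.one A) (E.one B) (ProPath.single J) Γ}
    (hΞ : compTo Ξ w (VDC.one_one A) (VDC.one_one B) = E.idCell J)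
    (h : ∀ {C : E.Obj} (Γ₂ : E.Path B C), ∃ (π : E.Row (E.one A) (E.one C) (ProPath.cons J Γ₂)
      (Γ.append Γ₂)) (ρ : E.Row (E.one A) (E.one C) (Γ.append Γ₂) (Γ.append Γ₂)),
      Ξ.IsAppend (E.idRow Γ₂) π ∧ VComp (Row.cons w (E.idRow Γ₂) rfl) π ρ ∧
        S.URel ρ (E.idRow (Γ.append Γ₂))) : VDC.IsComposite w := by
  intro Z W Y Y' Γ₁ Γ₂ f g K φ
  obtain ⟨π, ρ, h₁, h₂, h₃⟩ := h Γ₂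
  have hπ : VComp π (Row.cons w (E.idRow Γ₂) rfl) (E.idRow (ProPath.cons J Γ₂)) := by
    have := VComp.cons h₁ w (VDC.one_one A) (VDC.one_one B) (VComp.idRow_left (E.idRow Γ₂)) rfl rfl
    rwa [hΞ] at this
  obtain ⟨π', ρ', h₄, h₅, h₆⟩ := exists_append_of_split Γ₁ hπ h₂ h₃
  -- The factorization is `φ` below `π'`. It restricts to `φ` because `ρ'` is related to the
  -- identity row and `φ` respects `URel`; it is the only one because `π'` above the insertion of
  -- `w` is the identity row.
  refine ⟨compTo π' φ (E.lawful.one_vcomp f) (E.lawful.one_vcomp g), ?_, fun ψ hψ => ?_⟩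
  · refine (h₅.comp_eq φ _ _ _ _ (E.lawful.one_vcomp f) (E.lawful.one_vcomp g)).trans ?_
    exact (congrArg (reframe _ _) (h₆.comp_eq φ)).trans (VDC.compTo_idRow φ _ _)
  · refine .trans ?_ (congrArg (fun x => compTo π' x _ _) hψ)
    exact ((h₄.comp_eq ψ _ _ _ _ (E.lawful.one_vcomp f) (E.lawful.one_vcomp g)).trans
        (VDC.compTo_idRow ψ _ _)).symm

variable (S)

theorem homWitness_spec {A B Y : E.Obj} (f : E.Hom A Y) (g : E.Hom B Y) :
    compTo (Row.single (S.homWitness f g)) (S.restrCell f g (S.unit Y)) (E.lawful.one_vcomp f)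
      (E.lawful.one_vcomp g) = S.ulact (S.restrCell f (E.one Y) (S.unit Y))
        (S.restrCell (E.one Y) g (S.unit Y)) rfl :=
  S.lift_compTo _ _ _ _ _ _

/-- The splitting of the canonical 2-cell is the unit 2-cell of the companion of `f` next to a
2-cell `θ` from `U(f, g)` to the conjoint of `g`. -/
theorem homWitness_isComposite {A B Y : E.Obj} (f : E.Hom A Y) (g : E.Hom B Y) :
    VDC.IsComposite (S.homWitness f g) := by
  -- The cartesian 2-cell of `U(f, g)` factored through that of `U(1, g)`; this trades the
  -- restriction along `f` for a vertical boundary `f`.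
  set θ : E.Cell f (E.one B) (ProPath.single (S.restr f g (S.unit Y))) (S.conjoint g) :=
    S.lift (compTo (Row.single (S.restrCell f g (S.unit Y)))
      (E.idCell (S.unit Y)) rfl (VDC.vcomp_one_eq g)) with hθ
  have θ_spec : compTo (Row.single θ) (S.restrCell (E.one Y) g (S.unit Y)) (E.lawful.vcomp_one f)
      (E.lawful.one_vcomp g) = S.restrCell f g (S.unit Y) :=
    (S.lift_compTo _ _ _ _ _ _).trans (VDC.compTo_single_idCell _ _ _)
  -- The canonical 2-cell followed by `θ` lets the cartesian 2-cell of the companion act on the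
  -- identity of the conjoint.
  have e₁ : compTo (Row.single (S.homWitness f g)) θ (E.lawful.one_vcomp f) (VDC.one_one B) =
      S.ulact (S.restrCell f (E.one Y) (S.unit Y)) (E.idCell (S.conjoint g)) rfl := by
    refine S.restr_ext (hh := E.lawful.vcomp_one f) (hk := E.lawful.one_vcomp g) ?_
    refine ((VComp.single _ _ _ _).comp_eq _ (E.lawful.vcomp_one f) (E.lawful.one_vcomp g)
      (E.lawful.one_vcomp f) (E.lawful.one_vcomp g) _ _).symm.trans ?_
    refine (congrArg (fun β => compTo _ β _ _) θ_spec).trans ((S.homWitness_spec f g).trans ?_)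
    refine .trans ?_ (S.compTo_ulact _ _ _ _).symm
    exact congrArg (S.ulact _ · _) (VDC.compTo_idRow _ _ _).symm
  refine @isComposite_of_split E S A B _ _ _ (Row.cons (S.companionUnit f) (Row.single θ) rfl) ?_
    fun Γ₂ => ⟨Row.cons (S.companionUnit f) (Row.cons θ (E.idRow Γ₂) rfl) rfl,
      Row.cons (S.companionUnit f) (Row.cons (S.ulact (S.restrCell f (E.one Y) (S.unit Y))
        (E.idCell (S.conjoint g)) rfl) (E.idRow Γ₂) rfl) rfl, ?_, ?_, ?_⟩
  · refine S.restr_ext (hh := E.lawful.one_vcomp f) (hk := E.lawful.one_vcomp g) ?_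
    refine ((VComp.single _ _ _ _).comp_eq _ (E.lawful.one_vcomp f) (E.lawful.one_vcomp g)
      (E.lawful.one_vcomp f) (E.lawful.one_vcomp g) _ _).symm.trans ?_
    refine (congrArg (fun β => compTo _ β _ _) (S.homWitness_spec f g)).trans ?_
    have H := VComp.cons₁ (S.companionUnit f) (S.restrCell f (E.one Y) (S.unit Y))
      (E.lawful.one_vcomp f) (E.lawful.vcomp_one f) (VComp.single (Row.single θ)
        (S.restrCell (E.one Y) g (S.unit Y)) (E.lawful.vcomp_one f) (E.lawful.one_vcomp g)) rfl rfl
    rw [θ_spec, S.companionUnit_spec] at H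
    refine (H.comp_eq _ _ _ _ _ (E.lawful.vcomp_one f) (E.lawful.vcomp_one g)).trans ?_
    exact (S.ulact_uid _ rfl).trans (VDC.compTo_idRow _ _ _).symm
  · exact .cons _ (.single _ _ rfl) rfl rfl
  · refine VComp.cons₀_one _ ?_ rfl rfl
    have H := VComp.cons₁ (S.homWitness f g) θ (E.lawful.one_vcomp f) (VDC.one_one B)
      (VComp.idRow_left (E.idRow Γ₂)) rfl rfl
    rwa [e₁] at H
  -- Moving that acting element back to the companion unit gives the identity of the companion, by
  -- the triangle identity.
  · have H := UIAct.of_eq (S := S) (S.companionUnit f) (S.restrCell f (E.one Y) (S.unit Y))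
      (E.idCell (S.conjoint g)) (E.idRow Γ₂) rfl rfl rfl rfl rfl rfl
      (S.uract_companionUnit f).symm rfl
    exact .symm _ _ (.rel _ _ H)

theorem proWitness_spec {A B Y Z : E.Obj} (f : E.Hom A Y) (g : E.Hom B Z) (J : E.Pro Y Z) :
    compTo (Row.single (S.proWitness f g J)) (S.restrCell f g J) (E.lawful.one_vcomp f)
      (E.lawful.one_vcomp g) = S.uract (S.ulact (S.restrCell f (E.one Y) (S.unit Y))
        (E.idCell J) rfl) (S.restrCell (E.one Z) g (S.unit Z)) rfl := by
  refine (S.lift_compTo _ _ _ _ _ _).trans (eq_of_heq ((VDC.compTo_heq _ _ _ _).trans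
    ((VDC.compTo_heq _ _ (E.lawful.vcomp_one _) (E.lawful.vcomp_one _)).symm.trans
      (uract_heq (E.lawful.vcomp_one f) (VDC.one_one Z) (E.lawful.vcomp_one g)
        (VDC.compTo_heq _ _ _ _).symm (((VDC.compTo_heq _ _ _ _).trans (VDC.compTo_heq _ _
          (E.lawful.vcomp_one _) (E.lawful.vcomp_one _)).symm).trans
            (heq_of_eq (VDC.compTo_single_idCell _ _ _))) rfl))))

/-- Here the splitting is the unit 2-cell of the companion, the cartesian 2-cell of `J(f, g)` and
the unit 2-cell of the conjoint, side by side. -/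
theorem proWitness_isComposite {A B Y Z : E.Obj} (f : E.Hom A Y) (g : E.Hom B Z) (J : E.Pro Y Z) :
    VDC.IsComposite (S.proWitness f g J) := by
  refine @isComposite_of_split E S A B _ _ _ (Row.cons (S.companionUnit f) (Row.cons (S.restrCell f g J)
    (Row.single (S.conjointUnit g)) (ProPath.append_nil _)) rfl) ?_
    fun Γ₂ => ⟨Row.cons (S.companionUnit f) (Row.cons (S.restrCell f g J)
      (Row.cons (S.conjointUnit g) (E.idRow Γ₂) rfl) rfl) rfl,
      Row.cons (S.companionUnit f) (Row.cons (S.uract (S.ulact (S.restrCell f (E.one Y) (S.unit Y))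
        (E.idCell J) rfl) (S.restrCell (E.one Z) g (S.unit Z)) rfl)
        (Row.cons (S.conjointUnit g) (E.idRow Γ₂) rfl) rfl) rfl, ?_, ?_, ?_⟩
  · refine S.restr_ext (hh := E.lawful.one_vcomp f) (hk := E.lawful.one_vcomp g) ?_
    refine ((VComp.single _ _ _ _).comp_eq _ (E.lawful.one_vcomp f) (E.lawful.one_vcomp g)
      (E.lawful.one_vcomp f) (E.lawful.one_vcomp g) _ _).symm.trans ?_
    refine (congrArg (fun β => compTo _ β _ _) (S.proWitness_spec f g J)).trans ?_
    have H₁ := VComp.cons₁ (S.companionUnit f) (S.restrCell f (E.one Y) (S.unit Y))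
      (E.lawful.one_vcomp f) (E.lawful.vcomp_one f)
      (VComp.idRow_right (Row.single (S.restrCell f g J))) rfl rfl
    rw [S.companionUnit_spec] at H₁
    have e₁ : compTo (Row.cons (S.companionUnit f) (Row.single (S.restrCell f g J)) rfl)
        (S.ulact (S.restrCell f (E.one Y) (S.unit Y)) (E.idCell J) rfl) (E.lawful.one_vcomp f)
        (E.lawful.vcomp_one g) = S.restrCell f g J :=
      (H₁.comp_eq _ _ _ _ _ (E.lawful.vcomp_one f) (E.lawful.vcomp_one g)).trans
        (S.ulact_uid _ rfl)
    have H₂ := VComp.cons (.cons (S.companionUnit f) (.single (S.restrCell f g J)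
      (Row.single (S.conjointUnit g)) (ProPath.append_nil _)) rfl rfl)
      (S.ulact (S.restrCell f (E.one Y) (S.unit Y)) (E.idCell J) rfl) (E.lawful.one_vcomp f)
      (E.lawful.vcomp_one g) (VComp.single (Row.single (S.conjointUnit g))
        (S.restrCell (E.one Z) g (S.unit Z)) (E.lawful.vcomp_one g) (E.lawful.one_vcomp g)) rfl
        (ProPath.append_nil _)
    rw [e₁, S.conjointUnit_spec] at H₂
    refine (H₂.comp_eq _ _ _ _ _ (E.lawful.vcomp_one f) (E.lawful.vcomp_one g)).trans ?_
    exact (S.uract_uid _ _).trans (VDC.compTo_idRow _ _ _).symm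
  · exact .cons _ (.cons _ (.single _ _ rfl) _ rfl) rfl rfl
  · refine VComp.cons₀_one _ ?_ rfl rfl
    have H := VComp.cons₁ (S.proWitness f g J) (S.restrCell f g J) (E.lawful.one_vcomp f)
      (E.lawful.one_vcomp g) (VComp.idRow_left (Row.cons (S.conjointUnit g) (E.idRow Γ₂) rfl))
      rfl rfl
    rwa [S.proWitness_spec] at H
  -- Two moves reach the identity row: the element on the right passes to the conjoint unit, the one
  -- on the left to the companion unit, and each triangle identity removes one of them.
  · have H₁ := UIAct.of_eq (S := S) (S.ulact (S.restrCell f (E.one Y) (S.unit Y)) (E.idCell J) rfl)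
      (S.restrCell (E.one Z) g (S.unit Z)) (S.conjointUnit g) (E.idRow Γ₂) rfl rfl rfl rfl rfl rfl
      rfl (S.ulact_conjointUnit g).symm
    have H₂ := UIAct.of_eq (S := S) (S.companionUnit f) (S.restrCell f (E.one Y) (S.unit Y))
      (E.idCell J) (E.idRow (ProPath.cons (S.conjoint g) Γ₂)) rfl rfl rfl rfl rfl rfl
      (S.uract_companionUnit f).symm rfl
    exact .trans _ _ _ (.rel _ _ (UIAct.there (S.companionUnit f) H₁ rfl))
      (.symm _ _ (.rel _ _ H₂))

end VDC.EquipmentData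

end VirtualEquipments

-- Object classes are taken in the universe of pairs of an object and an arrow, because the objects
-- of `|Y|` are all arrows into `Y`.
open VirtualEquipments in
theorem mainTheorem2 (E : VDC.{u, v, p, c}) (S : E.EquipmentData) :
    ∃ (hcl : VCatClosed.{u, v, p, c, max u v} E) (hV : (VCatData hcl).IsLawful),
      let V : VDC := ⟨VCatData hcl, hV⟩
      -- enriched categories form a virtual equipment
      V.IsVirtualEquipment ∧
      -- restrictions of enriched profunctors are componentwise
      (∀ {C D C' D' : EnrichedCat.{u, v, p, c, max u v} E} (F : EFunctor C C') (G : EFunctor D D')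
        (K : Prof C' D'),
        ∃ (hK : (restrProf S F G K).IsLawful) (hκ : (restrMor S F G K hK).IsLawful),
          VDC.IsCartesian (E := V) (f := F) (g := G) (L := (⟨restrProf S F G K, hK⟩ : Prof C D))
            (K := K) ⟨restrMor S F G K hK, hκ⟩) ∧
      -- the homs of `|Y|` are the composites of a companion and a conjoint
      (∀ (Y : E.Obj) (x y : (repCat S Y).Obj),
        VDC.IsComposite (J := (repCat S Y).hom x y) (S.homWitness x.2 y.2)) ∧
      -- the components of `|J|` are the composites of a companion, `J` and a conjoint
      (∀ {Y Z : E.Obj} (J : E.Pro Y Z) (x : (repCat S Y).Obj) (y : (repCat S Z).Obj),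
        VDC.IsComposite (J := (repProf S J).pro x y) (S.proWitness x.2 y.2 J)) ∧
      -- representatives form a functor of virtual double categories
      ∃ (H : RepLawful S) (H' : H.MorLawful), (H.embedding H').IsFunctor (D := E) (D' := V) := by
  exact ⟨vcatClosed E, vcatData_isLawful _, vcat_isVirtualEquipment S, fun F G K =>
      ⟨S.restrProf_isLawful F G K, S.restrMor_isLawful F G K, S.restrictMor_isCartesian F G K⟩,
    fun Y x y => S.homWitness_isComposite x.2 y.2, fun J x y => S.proWitness_isComposite x.2 y.2 J,
    S.repLawful, S.repLawful.morLawful, S.repLawful.embedding_isFunctor _⟩
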